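/- Write $\mathbb{R}^2_+=\{x=(x_1,x_2)\in\mathbb{R}^2 : x_2>0\}$, $x^*=(x_1,-x_2)$, $\nabla^\perp=(\partial_2,-\partial_1)$, and $$E(x)=-\frac1{2\pi}\log|x|,\qquad D(x,y)=E(x-y)-E(x-y^*),\qquad \Gamma(x,t)=\frac1{4\pi t}e^{-|x|^2/4t}.$$ For $\omega\in L^1(\mathbb{R}^2_+)$ (real valued) let $$K\omega(x)=\int_{\mathbb{R}^2_+}\nabla_x^\perp D(x,y)\,\omega(y)\,dy$$ (the Biot–Savart law); its first component on the boundary, $(K\omega)^1(x_1,0)=\frac1\pi\int_{\mathbb{R}^2_+}\frac{y_2}{|x_1-y_1|^2+y_2^2}\,\omega(y)\,dy$, is defined for a.e. $x_1\in\mathbb{R}$ and is the tangential trace of $K\omega$. Let $S(t)$, $t>0$, be the Stokes semigroup of the half plane with no-slip boundary condition, i.e. $(S(t)u)^i(x)=\sum_{j=1}^2\int_{\mathbb{R}^2_+}G_{ij}(x,z,t)\,u^j(z)\,dz$ with $$G_{ij}(x,z,t)=\Gamma(x-z,t)\delta_{ij}-\Gamma(x-z^*,t)\delta_{ij}-4(1-\delta_{j2})\,\partial_{x_j}\int_0^{x_2}\!\!\int_{\mathbb{R}}\partial_{x_i}E(x-w)\,\Gamma(w-z^*,t)\,dw_1\,dw_2,$$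 and let $T(t)=-\nabla^\perp\cdot S(t)K$. Let $\omega_0\in L^1(\mathbb{R}^2_+)$ and $u_0=K\omega_0$. If the tangential trace of $u_0$ vanishes, i.e. $u_0^1(x_1,0)=0$ for a.e. $x_1\in\mathbb{R}$, then $T(t)\omega_0\in L^1(\mathbb{R}^2_+)$ for every $t>0$ and $$T(t)\omega_0\to\omega_0\quad\text{in }L^1(\mathbb{R}^2_+)\quad\text{as }t\to0^+.$$ -/

import Mathlib

open MeasureTheory Filter Topology Set

namespace HalfPlaneStokes

noncomputable section

/-- The open upper half plane `ℝ²₊ = {(x₁, x₂) | x₂ > 0}`. -/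
def halfPlane : Set (ℝ × ℝ) := {x | 0 < x.2}

/-- Reflection `x* = (x₁, -x₂)` in the boundary of the half plane. -/
def reflect (x : ℝ × ℝ) : ℝ × ℝ := (x.1, -x.2)

/-- Partial derivatives of a function of two real variables. The index `0` stands for the
tangential variable `x₁`, the index `1` for the normal variable `x₂`. -/
def pd (i : Fin 2) (f : ℝ × ℝ → ℝ) (x : ℝ × ℝ) : ℝ :=
  if i = 0 then deriv (fun s => f (s, x.2)) x.1 else deriv (fun s => f (x.1, s)) x.2

/-- The Kronecker delta. -/
def kron (i j : Fin 2) : ℝ := if i = j then 1 else 0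

/-- `E(x) = -(1/2π) log |x|`, with `|x|` the Euclidean length. -/
def E (x : ℝ × ℝ) : ℝ := -(1 / (2 * Real.pi)) * Real.log (Real.sqrt (x.1 ^ 2 + x.2 ^ 2))

/-- Green function of the Dirichlet Laplacian of the half plane,
`D(x, y) = E(x - y) - E(x - y*)`. -/
def D (x y : ℝ × ℝ) : ℝ := E (x - y) - E (x - reflect y)

/-- The Gauss kernel `Γ(x, t) = (4πt)⁻¹ exp(-|x|²/4t)` of the plane. -/
def heatKernel (x : ℝ × ℝ) (t : ℝ) : ℝ :=
  1 / (4 * Real.pi * t) * Real.exp (-(x.1 ^ 2 + x.2 ^ 2) / (4 * t))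

/-- The operator `∇^⊥ = (∂₂, -∂₁)` on scalar functions. -/
def perpGrad (f : ℝ × ℝ → ℝ) (i : Fin 2) (x : ℝ × ℝ) : ℝ :=
  if i = 0 then pd 1 f x else -pd 0 f x

/-- `∇^⊥ · v = ∂₂v¹ - ∂₁v²` for a vector field `v`. -/
def perpDiv (v : Fin 2 → ℝ × ℝ → ℝ) (x : ℝ × ℝ) : ℝ := pd 1 (v 0) x - pd 0 (v 1) x

/-- The Biot-Savart law `(Kω)(x) = ∫_{ℝ²₊} ∇^⊥_x D(x, y) ω(y) dy`, evaluated also at boundary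
points `x = (x₁, 0)`. -/
def K (ω : ℝ × ℝ → ℝ) (i : Fin 2) (x : ℝ × ℝ) : ℝ :=
  ∫ y in halfPlane, perpGrad (fun x' => D x' y) i x * ω y

/-- `∫₀^{x₂} ∫_ℝ ∂_{x_i}E(x - w) Γ(w - z*, t) dw₁ dw₂`. -/
def stripPotential (i : Fin 2) (t : ℝ) (z x : ℝ × ℝ) : ℝ :=
  ∫ w₂ in Ioo 0 x.2, ∫ w₁ : ℝ, pd i E (x - (w₁, w₂)) * heatKernel ((w₁, w₂) - reflect z) t

/-- The Green matrix `G_{ij}(x, z, t)` of the Stokes equations in the half plane with no-slip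
boundary condition. -/
def G (i j : Fin 2) (x z : ℝ × ℝ) (t : ℝ) : ℝ :=
  heatKernel (x - z) t * kron i j - heatKernel (x - reflect z) t * kron i j
    - 4 * (1 - kron j 1) * pd j (stripPotential i t z) x

/-- The Stokes semigroup `(S(t)u)ⁱ(x) = ∑ⱼ ∫_{ℝ²₊} G_{ij}(x, z, t) uʲ(z) dz`. -/
def S (t : ℝ) (u : Fin 2 → ℝ × ℝ → ℝ) (i : Fin 2) (x : ℝ × ℝ) : ℝ :=
  ∫ z in halfPlane, ∑ j, G i j x z t * u j z

/-- The vorticity semigroup `T(t)ω = -∇^⊥ · S(t) K ω`. -/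
def T (t : ℝ) (ω : ℝ × ℝ → ℝ) (x : ℝ × ℝ) : ℝ := -perpDiv (S t (K ω)) x

end

end HalfPlaneStokes

namespace HalfPlaneStokes

noncomputable section

/-! The composition of `T t` with the Biot–Savart law can be computed in closed form. With `M_n(ζ) =
∫₀^∞ kⁿ e^{-kζ - tk²} dk` and `ζ = s - ia`, the convolution at `a` of the Gaussian with `s/(v² +
s²)` is `Re M₀(ζ)`, and with the conjugate kernel `v/(v² + s²)` it is `Im M₀(ζ)`. All tangential
integrals in the Green matrix and in the Biot–Savart law are therefore real or imaginary parts of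
the `M_n`, and `M_n' = -M_{n+1}` handles the derivatives.

Taking the curl of the Stokes flow cancels the nonlocal terms containing `M₂`, leaving the kernels
`curlKernel` (`T_eq`). Composing these with the Biot–Savart kernel and integrating first in the
tangential variable, the normal integrand is an exact derivative on each side of `z₂ = y₂`, up to
one term on `0 < z₂ < y₂` (`integral_curlKernel_eq`). The jump at `z₂ = y₂` is the Neumann heat
kernel; the boundary value at `z₂ = 0` is `-(2/π) Γ₁(x₂) Re M₀(y₂ - i(x₁ - y₁))`, where `Γ₁` is the
one-dimensional Gauss kernel; the leftover is `remainderKernel`.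

The boundary term is the only one that sees the trace: integrated against `ω₀`, its tangential
factor is `π` times the Gaussian convolved with `u₀¹(·, 0)`, hence zero
(`integral_trace_kernel_eq_zero`). The remainder kernel has `L¹` norm in `x` at most `C min(1, √t /
y₂)`, which is bounded and tends to zero for each `y₂ > 0`, so dominated convergence removes it
(`exists_lintegral_remainderKernel_le`, `tendsto_lintegral_remainder`). The Neumann part is the
planar heat flow of the zero extension, evaluated at `x` and at its reflection, and converges by
continuity of translations in `L¹` (`tendsto_lintegral_heatFlow_sub`, `lintegral_neumann_sub_le`).
-/

/-! ### The one-dimensional Gauss kernel -/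

/-- The one-dimensional Gauss kernel `(4πt)^{-1/2} exp(-r²/4t)`. -/
def gauss (t r : ℝ) : ℝ := (Real.sqrt (4 * Real.pi * t))⁻¹ * Real.exp (-r ^ 2 / (4 * t))

/-- The derivative of the one-dimensional Gauss kernel. -/
def gaussDeriv (t r : ℝ) : ℝ := -(r / (2 * t)) * gauss t r

/-- Laplace transform `∫₀^∞ kⁿ e^{-kζ - tk²} dk` of a Gaussian with polynomial weight. -/
def moment (n : ℕ) (t : ℝ) (ζ : ℂ) : ℂ :=
  ∫ k in Ioi (0 : ℝ), (k : ℂ) ^ n * Complex.exp (-k * ζ - t * k ^ 2)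

lemma heatKernel_eq {t : ℝ} (ht : 0 < t) (x : ℝ × ℝ) :
    heatKernel x t = gauss t x.1 * gauss t x.2 := by
  unfold heatKernel gauss
  have h : (Real.sqrt (4 * Real.pi * t)) * (Real.sqrt (4 * Real.pi * t)) = 4 * Real.pi * t :=
    Real.mul_self_sqrt (by positivity)
  rw [mul_mul_mul_comm, ← mul_inv, h, ← Real.exp_add, one_div]
  congr 2
  ring

lemma hasDerivAt_gauss (t r : ℝ) : HasDerivAt (gauss t) (gaussDeriv t r) r := by
  unfold gaussDeriv
  have h := (((hasDerivAt_pow 2 r).neg.div_const (4 * t)).exp).const_mul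
    (Real.sqrt (4 * Real.pi * t))⁻¹
  refine h.congr_deriv ?_
  simp only [gauss, Pi.neg_apply]
  by_cases ht : t = 0
  · simp [ht]
  · field_simp; norm_num; ring

lemma gauss_pos {t : ℝ} (ht : 0 < t) (r : ℝ) : 0 < gauss t r := by
  unfold gauss; positivity

lemma gauss_nonneg (t r : ℝ) : 0 ≤ gauss t r := by
  unfold gauss; positivity

@[fun_prop]
lemma continuous_gauss (t : ℝ) : Continuous (gauss t) := by
  unfold gauss; fun_prop

@[fun_prop]
lemma continuous_gaussDeriv (t : ℝ) : Continuous (gaussDeriv t) := by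
  unfold gaussDeriv; fun_prop

lemma gauss_neg (t r : ℝ) : gauss t (-r) = gauss t r := by simp [gauss]

lemma integrable_gauss {t : ℝ} (ht : 0 < t) : Integrable (gauss t) := by
  unfold gauss
  have := (integrable_exp_neg_mul_sq (b := 1 / (4 * t)) (by positivity)).const_mul
    (Real.sqrt (4 * Real.pi * t))⁻¹
  refine this.congr (.of_forall fun x => ?_)
  simp only []
  congr 2; ring

lemma integral_gauss {t : ℝ} (ht : 0 < t) : ∫ r, gauss t r = 1 := by
  have h : ∀ r, gauss t r = (Real.sqrt (4 * Real.pi * t))⁻¹ * Real.exp (-(1 / (4 * t)) * r ^ 2) := by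
    intro r; unfold gauss; congr 2; ring
  simp_rw [h]
  rw [integral_const_mul, integral_gaussian]
  have : Real.pi / (1 / (4 * t)) = 4 * Real.pi * t := by field_simp
  rw [this]
  exact inv_mul_cancel₀ (by positivity)

/-- Since `(a + b)² ≥ a² + b²` for nonnegative arguments, the two variables decouple. In the
remainder this frees the `x₂`-integral from the inner variable. -/
lemma gauss_add_le {t : ℝ} (ht : 0 < t) {a b : ℝ} (ha : 0 ≤ a) (hb : 0 ≤ b) :
    gauss t (a + b) ≤ gauss t a * Real.exp (-b ^ 2 / (4 * t)) := by
  unfold gauss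
  rw [mul_assoc _ (Real.exp _), ← Real.exp_add]
  gcongr
  rw [← add_div]
  gcongr
  nlinarith [mul_nonneg ha hb]

lemma exp_neg_le_inv {x : ℝ} (hx : 0 ≤ x) : Real.exp (-x) ≤ 1 / (1 + x) := by
  rw [Real.exp_neg, ← one_div]
  gcongr
  linarith [Real.add_one_le_exp x]

lemma exp_neg_le_sq {x : ℝ} (hx : 0 ≤ x) : Real.exp (-x) ≤ 4 / (1 + x) ^ 2 := by
  have h := exp_neg_le_inv (x := x / 2) (by positivity)
  have h2 : Real.exp (-x) = Real.exp (-(x / 2)) ^ 2 := by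
    rw [← Real.exp_nat_mul]; congr 1; push_cast; ring
  rw [h2]
  calc Real.exp (-(x / 2)) ^ 2 ≤ (1 / (1 + x / 2)) ^ 2 := by gcongr
    _ ≤ (2 / (1 + x)) ^ 2 := by
      gcongr ?_ ^ 2
      rw [div_le_div_iff₀ (by positivity) (by positivity)]; linarith
    _ = _ := by rw [div_pow]; norm_num

/-- The Gauss kernel and its derivative are dominated by the Lorentz function. -/
lemma exists_gauss_le {t : ℝ} (ht : 0 < t) : ∃ C, 0 < C ∧ ∀ r,
    gauss t r ≤ C / (1 + r ^ 2) ∧ |gaussDeriv t r| ≤ C / (1 + r ^ 2) := by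
  set c := (Real.sqrt (4 * Real.pi * t))⁻¹ with hc
  have hc0 : 0 < c := by positivity
  -- The square of the Lorentz weight leaves one factor `1 + r²` to absorb the `|r|` produced by the
  -- derivative.
  have key : ∀ r, gauss t r * (1 + r ^ 2) ^ 2 ≤ c * 4 * (1 + 4 * t) ^ 2 := by
    intro r
    have h := exp_neg_le_sq (x := r ^ 2 / (4 * t)) (by positivity)
    have : gauss t r ≤ c * (4 / (1 + r ^ 2 / (4 * t)) ^ 2) := by
      unfold gauss
      rw [neg_div]
      gcongr
    calc gauss t r * (1 + r ^ 2) ^ 2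
        ≤ c * (4 / (1 + r ^ 2 / (4 * t)) ^ 2) * (1 + r ^ 2) ^ 2 := by gcongr
      _ ≤ c * (4 / (1 + r ^ 2 / (4 * t)) ^ 2) * ((1 + 4 * t) * (1 + r ^ 2 / (4 * t))) ^ 2 := by
          gcongr
          have : (1 + 4 * t) * (1 + r ^ 2 / (4 * t)) = 1 + r ^ 2 + 4 * t + r ^ 2 / (4 * t) := by
            field_simp; ring
          rw [this]
          have : 0 ≤ r ^ 2 / (4 * t) := by positivity
          linarith
      _ = _ := by field_simp
  set B := c * 4 * (1 + 4 * t) ^ 2 with hB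
  have hB0 : 0 < B := by positivity
  refine ⟨B * (1 + 1 / (2 * t)), by positivity, fun r => ⟨?_, ?_⟩⟩
  · rw [le_div_iff₀ (by positivity)]
    calc gauss t r * (1 + r ^ 2) ≤ gauss t r * (1 + r ^ 2) ^ 2 := by
          have := gauss_nonneg t r
          gcongr
          nlinarith [sq_nonneg r, sq_nonneg (r ^ 2)]
      _ ≤ B := key r
      _ ≤ _ := by
          have : 0 ≤ B * (1 / (2 * t)) := by positivity
          linarith
  · rw [le_div_iff₀ (by positivity)]
    unfold gaussDeriv
    rw [abs_mul, abs_neg, abs_div, abs_of_pos (gauss_pos ht r), abs_of_pos (by positivity : 0 < 2 * t)]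
    have hr : |r| ≤ 1 + r ^ 2 := by
      rw [abs_le]; constructor <;> nlinarith [sq_nonneg (r - 1), sq_nonneg (r + 1)]
    calc |r| / (2 * t) * gauss t r * (1 + r ^ 2)
        ≤ (1 + r ^ 2) / (2 * t) * gauss t r * (1 + r ^ 2) := by
          have := gauss_nonneg t r
          gcongr
      _ = (1 / (2 * t)) * (gauss t r * (1 + r ^ 2) ^ 2) := by ring
      _ ≤ (1 / (2 * t)) * B := by gcongr; exact key r
      _ ≤ _ := by nlinarith

lemma integrable_gaussDeriv {t : ℝ} (ht : 0 < t) : Integrable (gaussDeriv t) := by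
  obtain ⟨C, -, hC⟩ := exists_gauss_le ht
  refine (integrable_inv_one_add_sq.const_mul C).mono'
    (continuous_gaussDeriv t).aestronglyMeasurable (.of_forall fun r => ?_)
  simpa [div_eq_mul_inv] using (hC r).2

/-! ### Gaussian Laplace moments: derivatives, recurrences, decay -/

lemma norm_moment_integrand (n : ℕ) (t : ℝ) (ζ : ℂ) {k : ℝ} (hk : 0 ≤ k) :
    ‖(k : ℂ) ^ n * Complex.exp (-k * ζ - t * k ^ 2)‖
      = k ^ n * Real.exp (-k * ζ.re - t * k ^ 2) := by
  rw [norm_mul, norm_pow, Complex.norm_real, Real.norm_of_nonneg hk, Complex.norm_exp]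
  congr 2
  simp [← Complex.ofReal_pow]

lemma integrableOn_pow_mul_exp (n : ℕ) {t : ℝ} (ht : 0 < t) (r : ℝ) :
    IntegrableOn (fun k : ℝ => k ^ n * Real.exp (-k * r - t * k ^ 2)) (Ioi 0) := by
  have h := (integrable_rpow_mul_exp_neg_mul_sq (b := t / 2) (by positivity)
    -- Half of the Gaussian is kept for integrability; completing the square with the other half
    -- costs the constant `exp (r² / 2t)`.
    (s := n) (by linarith [Nat.cast_nonneg (α := ℝ) n])).const_mul (Real.exp (r ^ 2 / (2 * t)))
  refine h.integrableOn.mono' (Continuous.aestronglyMeasurable (by fun_prop)) ?_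
  filter_upwards [ae_restrict_mem measurableSet_Ioi] with k hk
  have hk : 0 < k := hk
  rw [Real.norm_of_nonneg (by positivity), Real.rpow_natCast, mul_left_comm, ← Real.exp_add]
  gcongr
  have : r ^ 2 / (2 * t) + -(t / 2) * k ^ 2 - (-k * r - t * k ^ 2) = (r + t * k) ^ 2 / (2 * t) := by
    field_simp; ring
  have h2 : 0 ≤ (r + t * k) ^ 2 / (2 * t) := by positivity
  linarith

lemma integrableOn_moment (n : ℕ) {t : ℝ} (ht : 0 < t) (ζ : ℂ) :
    IntegrableOn (fun k : ℝ => (k : ℂ) ^ n * Complex.exp (-k * ζ - t * k ^ 2)) (Ioi 0) := by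
  refine (integrableOn_pow_mul_exp n ht ζ.re).mono'
    (Continuous.aestronglyMeasurable (by fun_prop)) ?_
  filter_upwards [ae_restrict_mem measurableSet_Ioi] with k hk
  rw [norm_moment_integrand n t ζ (le_of_lt hk)]

lemma hasDerivAt_moment (n : ℕ) {t : ℝ} (ht : 0 < t) (ζ : ℂ) :
    HasDerivAt (moment n t) (-moment (n + 1) t ζ) ζ := by
  have h := hasDerivAt_integral_of_dominated_loc_of_deriv_le
    (μ := volume.restrict (Ioi (0 : ℝ)))
    (F := fun (z : ℂ) (k : ℝ) => (k : ℂ) ^ n * Complex.exp (-k * z - t * k ^ 2))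
    (F' := fun (z : ℂ) (k : ℝ) => -((k : ℂ) ^ (n + 1) * Complex.exp (-k * z - t * k ^ 2)))
    (x₀ := ζ) (s := Metric.ball ζ 1)
    -- On the unit ball around `ζ` the real part drops by at most `1`, which gives a bound
    -- independent of the point.
    (bound := fun k : ℝ => k ^ (n + 1) * Real.exp (-k * (ζ.re - 1) - t * k ^ 2))
    (Metric.ball_mem_nhds ζ one_pos)
    (.of_forall fun z => Continuous.aestronglyMeasurable (by fun_prop))
    (integrableOn_moment n ht ζ) (Continuous.aestronglyMeasurable (by fun_prop)) ?_
    (integrableOn_pow_mul_exp (n + 1) ht (ζ.re - 1)) ?_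
  · have h2 := h.2
    rw [integral_neg] at h2
    exact h2
  · filter_upwards [ae_restrict_mem measurableSet_Ioi] with k hk z hz
    have hk : 0 < k := hk
    rw [norm_neg, norm_moment_integrand (n + 1) t z hk.le]
    have h1 : |(z - ζ).re| < 1 := (Complex.abs_re_le_norm _).trans_lt (by simpa [dist_eq_norm] using hz)
    have := (abs_lt.1 h1).1
    simp only [Complex.sub_re] at this
    exact mul_le_mul_of_nonneg_left (Real.exp_le_exp.2 (by nlinarith)) (by positivity)
  · filter_upwards with k z _
    have : HasDerivAt (fun z : ℂ => -k * z - t * k ^ 2) (-k : ℂ) z := by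
      simpa using ((hasDerivAt_id z).const_mul (-k : ℂ)).sub_const ((t : ℂ) * k ^ 2)
    exact ((this.cexp).const_mul ((k : ℂ) ^ n)).congr_deriv (by rw [pow_succ]; ring)

@[fun_prop]
lemma continuous_moment (n : ℕ) {t : ℝ} (ht : 0 < t) : Continuous (moment n t) :=
  continuous_iff_continuousAt.2 fun ζ => (hasDerivAt_moment n ht ζ).continuousAt

lemma hasDerivAt_exp_quadratic (t : ℝ) (ζ : ℂ) (k : ℝ) :
    HasDerivAt (fun k : ℝ => Complex.exp (-k * ζ - t * k ^ 2))
      ((-ζ - 2 * t * k) * Complex.exp (-k * ζ - t * k ^ 2)) k := by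
  have h1 : HasDerivAt (fun k : ℂ => -k * ζ - t * k ^ 2) (-ζ - 2 * t * k) (k : ℂ) := by
    have := ((hasDerivAt_id (k : ℂ)).neg.mul_const ζ).sub
      ((hasDerivAt_pow 2 (k : ℂ)).const_mul (t : ℂ))
    exact this.congr_deriv (by push_cast; ring)
  exact (h1.cexp).comp_ofReal.congr_deriv (by ring)

/-- Integrate the derivative of `e^{-kζ - tk²}` over the half-line; the boundary value at `k = 0`
gives the `1`. -/
lemma moment_zero_recurrence {t : ℝ} (ht : 0 < t) (ζ : ℂ) :
    ζ * moment 0 t ζ + 2 * t * moment 1 t ζ = 1 := by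
  have h0 := integrableOn_moment 0 ht ζ
  have h1 := integrableOn_moment 1 ht ζ
  have hd := fun (k : ℝ) (_ : k ∈ Ioi (0 : ℝ)) => hasDerivAt_exp_quadratic t ζ k
  have hi : IntegrableOn (fun k : ℝ => (-ζ - 2 * t * k) * Complex.exp (-k * ζ - t * k ^ 2))
      (Ioi 0) := by
    refine ((h0.const_mul (-ζ)).sub (h1.const_mul (2 * t : ℂ))).congr (.of_forall fun k => ?_)
    simp only [Pi.sub_apply]
    ring
  have hlim := tendsto_zero_of_hasDerivAt_of_integrableOn_Ioi hd hi (by simpa using h0)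
  have := integral_Ioi_of_hasDerivAt_of_tendsto (hasDerivAt_exp_quadratic t ζ 0).continuousAt.continuousWithinAt hd hi hlim
  have h2 : ∫ k in Ioi (0 : ℝ), (-ζ - 2 * t * k) * Complex.exp (-k * ζ - t * k ^ 2)
      = (-ζ) * moment 0 t ζ - (2 * t : ℂ) * moment 1 t ζ := by
    unfold moment
    rw [← integral_const_mul, ← integral_const_mul, ← integral_sub (h0.const_mul _) (h1.const_mul _)]
    congr 1
    ext k
    ring
  rw [h2] at this
  simp at this
  linear_combination -this

/-- The same integration applied to `k^{n+1} e^{-kζ - tk²}`, whose boundary values both vanish. -/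
lemma moment_recurrence (n : ℕ) {t : ℝ} (ht : 0 < t) (ζ : ℂ) :
    ζ * moment (n + 1) t ζ + 2 * t * moment (n + 2) t ζ = (n + 1) * moment n t ζ := by
  have h0 := integrableOn_moment n ht ζ
  have h1 := integrableOn_moment (n + 1) ht ζ
  have h2 := integrableOn_moment (n + 2) ht ζ
  have hd := fun (k : ℝ) => ((hasDerivAt_pow (n + 1) (k : ℂ)).comp_ofReal).mul
    (hasDerivAt_exp_quadratic t ζ k)
  have heq : ∀ k : ℝ, ((n + 1 : ℕ) : ℂ) * (k : ℂ) ^ (n + 1 - 1) * Complex.exp (-k * ζ - t * k ^ 2) +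
      (k : ℂ) ^ (n + 1) * ((-ζ - 2 * t * k) * Complex.exp (-k * ζ - t * k ^ 2)) =
      ((n + 1 : ℂ)) * ((k : ℂ) ^ n * Complex.exp (-k * ζ - t * k ^ 2)) -
      ζ * ((k : ℂ) ^ (n + 1) * Complex.exp (-k * ζ - t * k ^ 2)) -
      (2 * t : ℂ) * ((k : ℂ) ^ (n + 2) * Complex.exp (-k * ζ - t * k ^ 2)) := by
    intro k
    simp only [Nat.add_sub_cancel]
    push_cast
    ring
  simp_rw [heq] at hd
  have hi := ((h0.const_mul (n + 1 : ℂ)).sub (h1.const_mul ζ)).sub (h2.const_mul (2 * t : ℂ))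
  have hlim := tendsto_zero_of_hasDerivAt_of_integrableOn_Ioi (fun k _ => hd k) hi h1
  have := integral_Ioi_of_hasDerivAt_of_tendsto (hd 0).continuousAt.continuousWithinAt
    (fun k _ => hd k) hi hlim
  have h3 : ∫ k in Ioi (0 : ℝ), ((n + 1 : ℂ) * ((k : ℂ) ^ n * Complex.exp (-k * ζ - t * k ^ 2)) -
      ζ * ((k : ℂ) ^ (n + 1) * Complex.exp (-k * ζ - t * k ^ 2)) -
      (2 * t : ℂ) * ((k : ℂ) ^ (n + 2) * Complex.exp (-k * ζ - t * k ^ 2)))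
      = (n + 1 : ℂ) * moment n t ζ - ζ * moment (n + 1) t ζ - (2 * t : ℂ) * moment (n + 2) t ζ := by
    rw [integral_sub, integral_sub, integral_const_mul, integral_const_mul, integral_const_mul]
    · rfl
    exacts [h0.const_mul _, h1.const_mul _, (h0.const_mul _).sub (h1.const_mul _), h2.const_mul _]
  rw [h3] at this
  simp at this
  linear_combination -this

lemma norm_moment_le (n : ℕ) {t : ℝ} (ht : 0 < t) {ζ : ℂ} (hζ : 0 ≤ ζ.re) :
    ‖moment n t ζ‖ ≤ ‖moment n t 0‖ := by
  have h0 : moment n t 0 = ((∫ k in Ioi (0 : ℝ), k ^ n * Real.exp (-k * 0 - t * k ^ 2) : ℝ) : ℂ) := by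
    unfold moment
    rw [← integral_complex_ofReal]
    congr 1
    ext k
    push_cast
    rfl
  rw [h0, Complex.norm_real, Real.norm_of_nonneg]
  · refine norm_integral_le_of_norm_le (integrableOn_pow_mul_exp n ht 0) ?_
    filter_upwards [ae_restrict_mem measurableSet_Ioi] with k hk
    have hk : 0 < k := hk
    rw [norm_moment_integrand n t ζ hk.le]
    exact mul_le_mul_of_nonneg_left (Real.exp_le_exp.2 (by nlinarith)) (by positivity)
  · refine setIntegral_nonneg measurableSet_Ioi fun k hk => ?_
    have hk : 0 < k := hk
    positivity

/-- The recurrences express `ζ² M₁` through `1`, `t M₁` and `t² M₃`. For `Re ζ ≥ 0` the moments are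
largest at `ζ = 0`, where the recurrences give `M₁ = 1/(2t)` and `M₃ = 1/(2t²)`. The total is `1/2 +
1 + 3 + 2 ≤ 7`. That the constant does not depend on `t` is essential for the remainder estimate as
`t → 0`. -/
lemma norm_sq_mul_moment_one_le {t : ℝ} (ht : 0 < t) {ζ : ℂ} (hζ : 0 ≤ ζ.re) :
    (t + ‖ζ‖ ^ 2) * ‖moment 1 t ζ‖ ≤ 7 := by
  have e1 := moment_zero_recurrence ht 0
  have e3 := moment_recurrence 1 ht 0
  have htc : (t : ℂ) ≠ 0 := by exact_mod_cast ht.ne'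
  simp only [zero_mul, zero_add] at e1 e3
  have m1 : ‖moment 1 t 0‖ = 1 / (2 * t) := by
    have : moment 1 t 0 = ((1 / (2 * t) : ℝ) : ℂ) := by
      push_cast; field_simp; linear_combination e1
    rw [this, Complex.norm_real, Real.norm_of_nonneg (by positivity)]
  have m3 : ‖moment 3 t 0‖ = 1 / (2 * t ^ 2) := by
    have : moment 3 t 0 = ((1 / (2 * t ^ 2) : ℝ) : ℂ) := by
      push_cast at e3 ⊢; field_simp; linear_combination (t : ℂ) * e3 + e1
    rw [this, Complex.norm_real, Real.norm_of_nonneg (by positivity)]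
  have b1 := (norm_moment_le 1 ht hζ).trans_eq m1
  have b3 := (norm_moment_le 3 ht hζ).trans_eq m3
  have key : ζ ^ 2 * moment 1 t ζ = 1 - 6 * t * moment 1 t ζ + 4 * t ^ 2 * moment 3 t ζ := by
    have r0 := moment_zero_recurrence ht ζ
    have r1 := moment_recurrence 0 ht ζ
    have r2 := moment_recurrence 1 ht ζ
    push_cast at r1 r2
    norm_num at r1 r2
    linear_combination ζ * r1 + r0 - 2 * t * r2
  have hk : ‖ζ‖ ^ 2 * ‖moment 1 t ζ‖ ≤ 1 + 6 * t * ‖moment 1 t ζ‖ + 4 * t ^ 2 * ‖moment 3 t ζ‖ := by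
    rw [← norm_pow, ← norm_mul, key]
    refine (norm_add_le _ _).trans (add_le_add ((norm_sub_le _ _).trans ?_) ?_)
    · simp [abs_of_pos ht]
    · simp [abs_of_pos ht]
  have c1 : t * ‖moment 1 t ζ‖ ≤ 1 / 2 := by
    calc _ ≤ t * (1 / (2 * t)) := by gcongr
      _ = _ := by field_simp
  have c3 : t ^ 2 * ‖moment 3 t ζ‖ ≤ 1 / 2 := by
    calc _ ≤ t ^ 2 * (1 / (2 * t ^ 2)) := by gcongr
      _ = _ := by field_simp
  nlinarith

/-- Quadratic decay in the tangential variable, at fixed `t`. It is used only for domination, so the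
constant may depend on `t`. -/
lemma exists_norm_moment_le {t : ℝ} (ht : 0 < t) : ∃ C, 0 < C ∧ ∀ ζ : ℂ, 0 ≤ ζ.re →
    ‖moment 1 t ζ‖ ≤ C / (1 + ζ.im ^ 2) ∧ ‖moment 2 t ζ‖ ≤ C / (1 + ζ.im ^ 2) := by
  -- A crude constant: its difference from each bound below expands into a polynomial with
  -- nonnegative coefficients.
  set A := 10 * (1 + t) ^ 2 * (1 + ‖moment 0 t 0‖ + ‖moment 1 t 0‖ + ‖moment 2 t 0‖ +
    ‖moment 3 t 0‖ + ‖moment 4 t 0‖) with hA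
  refine ⟨A, by positivity, fun ζ hζ => ?_⟩
  have r0 := moment_zero_recurrence ht ζ
  have r1 := moment_recurrence 0 ht ζ
  have r2 := moment_recurrence 1 ht ζ
  have r3 := moment_recurrence 2 ht ζ
  push_cast at r1 r2 r3
  norm_num at r1 r2 r3
  have k1 : ζ ^ 2 * moment 1 t ζ = 1 - 6 * t * moment 1 t ζ + 4 * t ^ 2 * moment 3 t ζ := by
    linear_combination ζ * r1 + r0 - 2 * t * r2
  have k2 : ζ ^ 2 * moment 2 t ζ
      = 2 * moment 0 t ζ - 10 * t * moment 2 t ζ + 4 * t ^ 2 * moment 4 t ζ := by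
    linear_combination ζ * r2 + 2 * r1 - 2 * t * r3
  have b0 := norm_moment_le 0 ht hζ
  have b1 := norm_moment_le 1 ht hζ
  have b2 := norm_moment_le 2 ht hζ
  have b3 := norm_moment_le 3 ht hζ
  have b4 := norm_moment_le 4 ht hζ
  have him : ζ.im ^ 2 ≤ ‖ζ‖ ^ 2 := by
    rw [← sq_abs]; gcongr; exact Complex.abs_im_le_norm ζ
  have h1 : ‖ζ‖ ^ 2 * ‖moment 1 t ζ‖ ≤ 1 + 6 * t * ‖moment 1 t ζ‖ + 4 * t ^ 2 * ‖moment 3 t ζ‖ := by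
    rw [← norm_pow, ← norm_mul, k1]
    refine (norm_add_le _ _).trans (add_le_add ((norm_sub_le _ _).trans ?_) ?_)
    · simp [abs_of_pos ht]
    · simp [abs_of_pos ht]
  have h2 : ‖ζ‖ ^ 2 * ‖moment 2 t ζ‖
      ≤ 2 * ‖moment 0 t ζ‖ + 10 * t * ‖moment 2 t ζ‖ + 4 * t ^ 2 * ‖moment 4 t ζ‖ := by
    rw [← norm_pow, ← norm_mul, k2]
    refine (norm_add_le _ _).trans (add_le_add ((norm_sub_le _ _).trans ?_) ?_)
    · simp [abs_of_pos ht]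
    · simp [abs_of_pos ht]
  set n0 := ‖moment 0 t 0‖
  set n1 := ‖moment 1 t 0‖
  set n2 := ‖moment 2 t 0‖
  set n3 := ‖moment 3 t 0‖
  set n4 := ‖moment 4 t 0‖
  have hn : 0 ≤ n0 ∧ 0 ≤ n1 ∧ 0 ≤ n2 ∧ 0 ≤ n3 ∧ 0 ≤ n4 := by
    refine ⟨?_, ?_, ?_, ?_, ?_⟩ <;> exact norm_nonneg _
  obtain ⟨p0, p1, p2, p3, p4⟩ := hn
  constructor
  · rw [le_div_iff₀ (by positivity)]
    calc ‖moment 1 t ζ‖ * (1 + ζ.im ^ 2) ≤ ‖moment 1 t ζ‖ + ‖ζ‖ ^ 2 * ‖moment 1 t ζ‖ := by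
          nlinarith [norm_nonneg (moment 1 t ζ)]
      _ ≤ n1 + (1 + 6 * t * n1 + 4 * t ^ 2 * n3) := by
          refine add_le_add b1 (h1.trans ?_); gcongr
      _ ≤ A := by
          rw [hA, ← sub_nonneg]; ring_nf; positivity
  · rw [le_div_iff₀ (by positivity)]
    calc ‖moment 2 t ζ‖ * (1 + ζ.im ^ 2) ≤ ‖moment 2 t ζ‖ + ‖ζ‖ ^ 2 * ‖moment 2 t ζ‖ := by
          nlinarith [norm_nonneg (moment 2 t ζ)]
      _ ≤ n2 + (2 * n0 + 10 * t * n2 + 4 * t ^ 2 * n4) := by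
          refine add_le_add b2 (h2.trans ?_); gcongr
      _ ≤ A := by
          rw [hA, ← sub_nonneg]; ring_nf; positivity

/-! ### Fourier and Laplace transforms of the Gauss and Poisson kernels -/

open Complex in
lemma norm_exp_real_mul_I (k v : ℝ) : ‖cexp (k * v * I)‖ = 1 := by
  rw [← ofReal_mul, norm_exp_ofReal_mul_I]

open Complex in
lemma integral_Ioi_exp_eq_inv {s : ℝ} (hs : 0 < s) (v : ℝ) :
    ∫ k in Ioi (0 : ℝ), cexp (-k * s) * cexp (k * v * I) = (s - v * I : ℂ)⁻¹ := by
  have h := integral_exp_mul_complex_Ioi (a := -(s - v * I)) (by simpa using hs) 0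
  simp only [ofReal_zero, mul_zero, exp_zero] at h
  rw [neg_div_neg_eq, one_div] at h
  rw [← h]
  congr 1
  ext k
  rw [← Complex.exp_add]
  ring_nf

open Complex in
/-- Laplace representation of the Cauchy-type integral of an integrable function. -/
lemma integral_mul_inv_eq_laplace {f : ℝ → ℂ} (hf : Integrable f) {φ : ℝ → ℂ}
    (hφ : ∀ k : ℝ, ∫ v, f v * cexp (k * v * I) = φ k) {s : ℝ} (hs : 0 < s) :
    ∫ v, f v * (s - v * I : ℂ)⁻¹ = ∫ k in Ioi (0 : ℝ), cexp (-k * s) * φ k := by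
  -- Write `(s - iv)⁻¹` as the Laplace integral of `e^{ikv}` and exchange the integrals; the inner
  -- one is then the Fourier transform of `f`.
  simp_rw [← hφ, ← integral_Ioi_exp_eq_inv hs, ← integral_const_mul]
  rw [integral_integral_swap]
  · congr 1
    ext k
    congr 1
    ext v
    ring
  · have hi : IntegrableOn (fun k : ℝ => cexp (-k * s)) (Ioi 0) := by
      have := integrableOn_exp_mul_complex_Ioi (a := -(s : ℂ)) (by simpa using hs) 0
      refine this.congr (.of_forall fun k => ?_)
      show cexp _ = cexp _
      ring_nf
    have hp := hf.mul_prod hi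
    have hc : AEStronglyMeasurable (fun z : ℝ × ℝ => cexp (z.2 * z.1 * I))
      (volume.prod (volume.restrict (Ioi 0))) := Continuous.aestronglyMeasurable (by fun_prop)
    refine hp.mono ((hp.1.mul hc).congr (.of_forall fun z => ?_)) (.of_forall fun z => ?_)
    · simp only [Pi.mul_apply, Function.uncurry]; ring
    · simp only [Function.uncurry, norm_mul, norm_exp_real_mul_I, mul_one, le_refl]

open Complex in
lemma integral_gauss_mul_exp {t : ℝ} (ht : 0 < t) (a k : ℝ) :
    ∫ v : ℝ, (gauss t (a - v) : ℂ) * cexp (k * v * I) = cexp (k * a * I - t * k ^ 2) := by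
  have h1 : ∀ v : ℝ, (gauss t (a - v) : ℂ) * cexp (k * v * I) =
      (fun w : ℝ => (gauss t w : ℂ) * cexp (k * (a - w) * I)) (a - v) := by
    intro v; push_cast; ring_nf
  simp_rw [h1]
  rw [integral_sub_left_eq_self (fun w : ℝ => (gauss t w : ℂ) * cexp (k * (a - w) * I))]
  have h2 : ∀ w : ℝ, (gauss t w : ℂ) * cexp (k * (a - w) * I) =
      ((Real.sqrt (4 * Real.pi * t))⁻¹ * cexp (k * a * I) : ℂ) *
      (cexp (I * (-k : ℂ) * w) * cexp (-(1 / (4 * t) : ℂ) * w ^ 2)) := by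
    intro w
    unfold gauss
    push_cast
    have : (k * (a - w) * I : ℂ) = k * a * I + I * (-k) * w := by ring
    rw [this, Complex.exp_add, show -(1 / (4 * t) : ℂ) * w ^ 2 = -w ^ 2 / (4 * t) by ring]
    ring
  simp_rw [h2]
  have hb : 0 < (1 / (4 * t) : ℂ).re := by
    rw [show (1 / (4 * t) : ℂ) = ((1 / (4 * t) : ℝ) : ℂ) by push_cast; rfl, ofReal_re]; positivity
  have htc : (t : ℂ) ≠ 0 := by exact_mod_cast ht.ne'
  rw [integral_const_mul, fourierIntegral_gaussian hb]
  have h3 : ((Real.pi : ℂ) / (1 / (4 * t) : ℂ)) ^ (1 / 2 : ℂ) = (Real.sqrt (4 * Real.pi * t) : ℂ) := by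
    rw [show ((Real.pi : ℂ) / (1 / (4 * t) : ℂ)) = ((4 * Real.pi * t : ℝ) : ℂ) by
      push_cast; field_simp, Real.sqrt_eq_rpow, ofReal_cpow (by positivity)]
    norm_num
  have h4 : (Real.sqrt (4 * Real.pi * t) : ℂ) ≠ 0 := by
    exact_mod_cast (Real.sqrt_pos.2 (by positivity)).ne'
  rw [h3, sub_eq_add_neg, Complex.exp_add,
    show (-(-(k : ℂ)) ^ 2 / (4 * (1 / (4 * t)))) = (-(t * k ^ 2) : ℂ) by field_simp]
  field_simp
  push_cast
  field_simp

lemma integrable_gauss_comp {t : ℝ} (ht : 0 < t) (a : ℝ) :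
    Integrable (fun v : ℝ => (gauss t (a - v) : ℂ)) :=
  ((integrable_gauss ht).comp_sub_left a).ofReal

lemma integrable_gaussDeriv_comp {t : ℝ} (ht : 0 < t) (a : ℝ) :
    Integrable (fun v : ℝ => (gaussDeriv t (a - v) : ℂ)) :=
  ((integrable_gaussDeriv ht).comp_sub_left a).ofReal

open Complex in
lemma integrable_mul_exp_I {f : ℝ → ℂ} (hf : Integrable f) (k : ℝ) :
    Integrable (fun v : ℝ => f v * cexp (k * v * I)) := by
  refine hf.mono (hf.1.mul (Continuous.aestronglyMeasurable (by fun_prop)))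
    (.of_forall fun v => ?_)
  rw [norm_mul, norm_exp_real_mul_I, mul_one]

open Complex in
lemma integral_gaussDeriv_mul_exp {t : ℝ} (ht : 0 < t) (a k : ℝ) :
    ∫ v : ℝ, (gaussDeriv t (a - v) : ℂ) * cexp (k * v * I)
      = k * I * cexp (k * a * I - t * k ^ 2) := by
  have hu : ∀ v : ℝ, HasDerivAt (fun v : ℝ => (gauss t (a - v) : ℂ))
      (-(gaussDeriv t (a - v) : ℂ)) v := fun v => by
    have := ((hasDerivAt_gauss t (a - v)).comp v ((hasDerivAt_id v).const_sub a)).ofReal_comp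
    exact this.congr_deriv (by push_cast; ring)
  have hv : ∀ v : ℝ, HasDerivAt (fun v : ℝ => cexp (k * v * I)) (cexp (k * v * I) * (k * I)) v :=
    fun v => by
    have : HasDerivAt (fun v : ℂ => k * v * I) (k * I) (v : ℂ) := by
      simpa using ((hasDerivAt_id (v : ℂ)).const_mul (k : ℂ)).mul_const I
    exact this.cexp.comp_ofReal
  have hg := integrable_mul_exp_I (integrable_gauss_comp ht a) k
  have hg' := integrable_mul_exp_I (integrable_gaussDeriv_comp ht a) k
  have h := integral_mul_deriv_eq_deriv_mul_of_integrable (fun v _ => hu v) (fun v _ => hv v)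
    ((hg.mul_const (k * I)).congr (.of_forall fun v => by simp only [Pi.mul_apply]; ring))
    (hg'.neg.congr (.of_forall fun v => by simp only [Pi.mul_apply, Pi.neg_apply]; ring)) hg
  simp only [neg_mul, integral_neg, neg_neg] at h
  rw [← h]
  simp_rw [← mul_assoc _ (cexp _)]
  rw [integral_mul_const, integral_gauss_mul_exp ht]
  ring

open Complex in
lemma integral_gauss_mul_inv {t : ℝ} (ht : 0 < t) (a : ℝ) {s : ℝ} (hs : 0 < s) :
    ∫ v : ℝ, (gauss t (a - v) : ℂ) * (s - v * I : ℂ)⁻¹ = moment 0 t (s - a * I) := by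
  rw [integral_mul_inv_eq_laplace (integrable_gauss_comp ht a)
    (fun k => integral_gauss_mul_exp ht a k) hs]
  unfold moment
  congr 1
  ext k
  rw [← Complex.exp_add, pow_zero, one_mul]
  ring_nf

open Complex in
lemma integral_gaussDeriv_mul_inv {t : ℝ} (ht : 0 < t) (a : ℝ) {s : ℝ} (hs : 0 < s) :
    ∫ v : ℝ, (gaussDeriv t (a - v) : ℂ) * (s - v * I : ℂ)⁻¹ = I * moment 1 t (s - a * I) := by
  rw [integral_mul_inv_eq_laplace (integrable_gaussDeriv_comp ht a)
    (fun k => integral_gaussDeriv_mul_exp ht a k) hs]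
  unfold moment
  rw [← integral_const_mul]
  congr 1
  ext k
  rw [mul_left_comm, ← Complex.exp_add, pow_one]
  ring_nf

lemma integrable_poisson {s : ℝ} (hs : 0 < s) :
    Integrable (fun v : ℝ => s / (v ^ 2 + s ^ 2)) := by
  have := (integrable_inv_one_add_sq.comp_div hs.ne').const_mul s⁻¹
  refine this.congr (.of_forall fun v => ?_)
  simp only []
  field_simp
  ring

lemma integral_poisson {s : ℝ} (hs : 0 < s) : ∫ v : ℝ, s / (v ^ 2 + s ^ 2) = Real.pi := by
  have h : ∀ v : ℝ, s / (v ^ 2 + s ^ 2) = s⁻¹ * (fun w : ℝ => (1 + w ^ 2)⁻¹) (v / s) := by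
    intro v
    simp only []
    field_simp
    ring
  simp_rw [h]
  rw [integral_const_mul, Measure.integral_comp_div (fun w : ℝ => (1 + w ^ 2)⁻¹) s, integral_univ_inv_one_add_sq,
    abs_of_pos hs, smul_eq_mul, inv_mul_cancel_left₀ hs.ne']

-- Fourier inversion: splitting at `k = 0`, the transform of `e^{-s|k|}` is twice the Poisson
-- kernel, and both functions are integrable. Rescaling by `2π` removes the normalization of the
-- Fourier transform.
open Complex FourierTransform in
lemma integral_poisson_mul_exp {s : ℝ} (hs : 0 < s) (k : ℝ) :
    ∫ v : ℝ, ((s / (v ^ 2 + s ^ 2) : ℝ) : ℂ) * cexp (k * v * I)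
      = Real.pi * Real.exp (-s * |k|) := by
  have hdecomp : ∀ w : ℝ, IntegrableOn (fun k : ℝ => cexp (-k * s) * cexp (k * w * I)) (Ioi 0) := by
    intro w
    have := integrableOn_exp_mul_complex_Ioi (a := -(s - w * I)) (by simpa using hs) 0
    refine this.congr (.of_forall fun k => ?_)
    show cexp _ = cexp _ * cexp _
    rw [← Complex.exp_add]
    ring_nf
  set f : ℝ → ℂ := fun k => ((Real.exp (-s * |k|) : ℝ) : ℂ) with hf
  have hpos : ∀ w : ℝ, ∀ k ∈ Ioi (0 : ℝ), cexp (-k * s) * cexp (k * w * I) = f k * cexp (k * w * I) := by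
    intro w k hk
    have hk : 0 < k := hk
    simp only [hf, abs_of_pos hk]
    push_cast
    ring_nf
  have hneg : ∀ w : ℝ, ∀ k ∈ Ioi (0 : ℝ), cexp (-k * s) * cexp (k * (-w : ℝ) * I)
      = (fun k : ℝ => f k * cexp (k * w * I)) (-k) := by
    intro w k hk
    have hk : 0 < k := hk
    simp only [hf, abs_neg, abs_of_pos hk]
    push_cast
    ring_nf
  have hI1 : ∀ w : ℝ, IntegrableOn (fun k : ℝ => f k * cexp (k * w * I)) (Ioi 0) :=
    fun w => (hdecomp w).congr_fun (hpos w) measurableSet_Ioi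
  have hI2 : ∀ w : ℝ, IntegrableOn (fun k : ℝ => f k * cexp (k * w * I)) (Iic 0) := by
    intro w
    have := ((hdecomp (-w)).congr_fun (hneg w) measurableSet_Ioi)
    have h2 := (integrableOn_Ici_iff_integrableOn_Ioi (by simp)).2 this
    rw [← neg_zero] at h2
    have h3 := h2.comp_neg_Iic
    simp only [neg_neg] at h3
    exact h3
  have hval : ∀ w : ℝ, ∫ k : ℝ, f k * cexp (k * w * I) = ((2 * (s / (w ^ 2 + s ^ 2)) : ℝ) : ℂ) := by
    intro w
    rw [← intervalIntegral.integral_Iic_add_Ioi (hI2 w) (hI1 w),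
      ← setIntegral_congr_fun measurableSet_Ioi (hpos w), integral_Ioi_exp_eq_inv hs w]
    have := integral_comp_neg_Ioi 0 (fun k : ℝ => f k * cexp (k * w * I))
    rw [neg_zero] at this
    rw [← this, ← setIntegral_congr_fun measurableSet_Ioi (hneg w), integral_Ioi_exp_eq_inv hs]
    have h1 : (s - w * I : ℂ) ≠ 0 := fun h => hs.ne' (by simpa using congrArg re h)
    have h2 : (s + w * I : ℂ) ≠ 0 := fun h => hs.ne' (by simpa using congrArg re h)
    have h3 : (w ^ 2 + s ^ 2 : ℂ) = (s - w * I) * (s + w * I) := by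
      ring_nf; rw [I_sq]; ring
    push_cast
    rw [h3]
    simp only [neg_mul, sub_neg_eq_add]
    field_simp
    ring
  have hfi : Integrable f := by
    rw [← integrableOn_univ, ← Iic_union_Ioi (a := (0 : ℝ))]
    simpa using (hI2 0).union (hI1 0)
  have hfc : Continuous f := by fun_prop
  have hF : 𝓕 f = fun w : ℝ => ((2 * (s / ((2 * Real.pi * w) ^ 2 + s ^ 2)) : ℝ) : ℂ) := by
    ext w
    rw [Real.fourier_real_eq_integral_exp_smul]
    have := hval (-(2 * Real.pi * w))
    rw [neg_sq] at this
    rw [← this]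
    congr 1
    ext k
    rw [smul_eq_mul, mul_comm]
    push_cast
    ring_nf
  have hFi : Integrable (𝓕 f) := by
    rw [hF]
    exact (((integrable_poisson hs).comp_mul_left' (by positivity : 2 * Real.pi ≠ 0)).const_mul 2).ofReal
  have hinv := congrFun (hfc.fourierInv_fourier_eq hfi hFi) k
  rw [Real.fourierInv_eq', hF] at hinv
  have hch := Measure.integral_comp_mul_left
    (fun v : ℝ => (2 : ℂ) * (((s / (v ^ 2 + s ^ 2) : ℝ) : ℂ) * cexp (k * v * I))) (2 * Real.pi)
  have : ∀ v : ℝ, cexp (((2 * Real.pi * inner ℝ v k : ℝ) : ℂ) * I) • ((2 * (s / ((2 * Real.pi * v) ^ 2 + s ^ 2)) : ℝ) : ℂ)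
     = (fun v : ℝ => (2 : ℂ) * (((s / (v ^ 2 + s ^ 2) : ℝ) : ℂ) * cexp (k * v * I))) (2 * Real.pi * v) := by
    intro v
    simp only [smul_eq_mul, RCLike.inner_apply, conj_trivial]
    push_cast
    ring_nf
  simp_rw [this] at hinv
  rw [hch, integral_const_mul, abs_of_pos (by positivity), real_smul] at hinv
  rw [hf] at hinv
  simp only [] at hinv
  rw [← hinv]
  generalize ∫ v : ℝ, ((s / (v ^ 2 + s ^ 2) : ℝ) : ℂ) * cexp (k * v * I) = J
  push_cast
  field_simp

-- On the line `Re ζ = 0` the moment is a superposition of the waves `e^{ika}` with `k > 0`.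
-- Convolution with the Poisson kernel multiplies each by `π e^{-ks}`, which moves `ζ` to real part
-- `s`.
open Complex in
lemma integral_moment_mul_poisson (n : ℕ) {t : ℝ} (ht : 0 < t) (a : ℝ) {s : ℝ} (hs : 0 < s) :
    ∫ v : ℝ, moment n t (-((a - v : ℝ) : ℂ) * I) * ((s / (v ^ 2 + s ^ 2) : ℝ) : ℂ)
      = Real.pi * moment n t (s - a * I) := by
  unfold moment
  simp_rw [← integral_mul_const]
  rw [integral_integral_swap]
  · rw [← integral_const_mul]
    refine setIntegral_congr_fun measurableSet_Ioi fun k hk => ?_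
    have hk : 0 < k := hk
    have h : ∀ v : ℝ, (k : ℂ) ^ n * cexp (-k * (-((a - v : ℝ) : ℂ) * I) - t * k ^ 2) *
        ((s / (v ^ 2 + s ^ 2) : ℝ) : ℂ) = (k : ℂ) ^ n * cexp (k * a * I - t * k ^ 2) *
        (((s / (v ^ 2 + s ^ 2) : ℝ) : ℂ) * cexp ((-k : ℝ) * v * I)) := by
      intro v
      rw [show (-k * (-((a - v : ℝ) : ℂ) * I) - t * k ^ 2 : ℂ) =
        (k * a * I - t * k ^ 2) + (-k : ℝ) * v * I by push_cast; ring, Complex.exp_add]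
      ring
    simp_rw [h]
    rw [integral_const_mul, integral_poisson_mul_exp hs, abs_neg, abs_of_pos hk,
      show (-k * (s - a * I) - t * k ^ 2 : ℂ) = (k * a * I - t * k ^ 2) + -s * k by ring,
      Complex.exp_add]
    push_cast
    ring
  · have hp := (integrable_poisson hs).ofReal (𝕜 := ℂ) |>.mul_prod (integrableOn_moment n ht 0)
    have hc : AEStronglyMeasurable (fun z : ℝ × ℝ => cexp (z.2 * (a - z.1 : ℝ) * I))
      (volume.prod (volume.restrict (Ioi 0))) := Continuous.aestronglyMeasurable (by fun_prop)
    have he : ∀ z : ℝ × ℝ, Function.uncurry (fun (x y : ℝ) => (y : ℂ) ^ n *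
        cexp (-y * (-((a - x : ℝ) : ℂ) * I) - t * y ^ 2) * ((s / (x ^ 2 + s ^ 2) : ℝ) : ℂ)) z =
        (((s / (z.1 ^ 2 + s ^ 2) : ℝ) : ℂ) * (z.2 ^ n * cexp (-z.2 * 0 - t * z.2 ^ 2))) *
        cexp (z.2 * (a - z.1 : ℝ) * I) := by
      intro z
      simp only [Function.uncurry]
      rw [show (-z.2 * (-((a - z.1 : ℝ) : ℂ) * I) - t * z.2 ^ 2 : ℂ) =
        (-z.2 * 0 - t * z.2 ^ 2) + z.2 * (a - z.1 : ℝ) * I by ring, Complex.exp_add]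
      ring
    refine hp.mono ((hp.1.mul hc).congr (.of_forall fun z => (he z).symm)) (.of_forall fun z => ?_)
    rw [he, norm_mul _ (cexp (z.2 * (a - z.1 : ℝ) * I)), norm_exp_real_mul_I, mul_one]
    exact le_rfl

/-! ### The Biot–Savart kernel and Fubini against it -/

lemma measurableSet_halfPlane : MeasurableSet halfPlane :=
  measurableSet_lt measurable_const measurable_snd

lemma halfPlane_eq : halfPlane = univ ×ˢ Ioi (0 : ℝ) := by
  ext x; simp [halfPlane]

lemma restrict_halfPlane :
    (volume : Measure (ℝ × ℝ)).restrict halfPlane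
      = (volume : Measure ℝ).prod (volume.restrict (Ioi (0 : ℝ))) := by
  rw [halfPlane_eq, Measure.volume_eq_prod, ← Measure.prod_restrict, Measure.restrict_univ]

lemma ae_restrict_halfPlane :
    ∀ᵐ z ∂((volume : Measure (ℝ × ℝ)).restrict halfPlane), 0 < z.2 :=
  ae_restrict_mem measurableSet_halfPlane

lemma E_eq (v s : ℝ) : E (v, s) = -(1 / (4 * Real.pi)) * Real.log (v ^ 2 + s ^ 2) := by
  unfold E
  rw [Real.log_sqrt (by positivity)]
  ring

lemma hasDerivAt_E_fst {v s : ℝ} (h : v ^ 2 + s ^ 2 ≠ 0) :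
    HasDerivAt (fun r => E (r, s)) (-(1 / (2 * Real.pi)) * (v / (v ^ 2 + s ^ 2))) v := by
  simp_rw [E_eq]
  have := ((((hasDerivAt_pow 2 v).add_const (s ^ 2)).log h).const_mul (-(1 / (4 * Real.pi))))
  exact this.congr_deriv (by field_simp; norm_num; ring)

lemma hasDerivAt_E_snd {v s : ℝ} (h : v ^ 2 + s ^ 2 ≠ 0) :
    HasDerivAt (fun r => E (v, r)) (-(1 / (2 * Real.pi)) * (s / (v ^ 2 + s ^ 2))) s := by
  simp_rw [E_eq]
  have := ((((hasDerivAt_pow 2 s).const_add (v ^ 2)).log h).const_mul (-(1 / (4 * Real.pi))))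
  exact this.congr_deriv (by field_simp; norm_num; ring)

/-- The Biot-Savart kernel `∇^⊥_z D(z, y)` in closed form. -/
def bsKernel (i : Fin 2) (z y : ℝ × ℝ) : ℝ :=
  if i = 0 then
    -(1 / (2 * Real.pi)) * ((z.2 - y.2) / ((z.1 - y.1) ^ 2 + (z.2 - y.2) ^ 2)
      - (z.2 + y.2) / ((z.1 - y.1) ^ 2 + (z.2 + y.2) ^ 2))
  else
    1 / (2 * Real.pi) * ((z.1 - y.1) / ((z.1 - y.1) ^ 2 + (z.2 - y.2) ^ 2)
      - (z.1 - y.1) / ((z.1 - y.1) ^ 2 + (z.2 + y.2) ^ 2))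

lemma perpGrad_D (i : Fin 2) {z y : ℝ × ℝ} (h₁ : (z.1 - y.1) ^ 2 + (z.2 - y.2) ^ 2 ≠ 0)
    (h₂ : (z.1 - y.1) ^ 2 + (z.2 + y.2) ^ 2 ≠ 0) :
    perpGrad (fun x' => D x' y) i z = bsKernel i z y := by
  unfold perpGrad bsKernel pd D
  split_ifs with hi h1 h2
  · simp at h1
  · have e : ∀ s, E ((z.1, s) - y) - E ((z.1, s) - reflect y)
        = E (z.1 - y.1, s - y.2) - E (z.1 - y.1, s + y.2) := by
      intro s; simp [reflect, Prod.sub_def]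
    simp_rw [e]
    have d1 := (hasDerivAt_E_snd h₁).comp z.2 ((hasDerivAt_id z.2).sub_const y.2)
    have d2 := (hasDerivAt_E_snd h₂).comp z.2 ((hasDerivAt_id z.2).add_const y.2)
    exact ((d1.sub d2).congr_deriv (by ring)).deriv
  · have e : ∀ s, E ((s, z.2) - y) - E ((s, z.2) - reflect y)
        = E (s - y.1, z.2 - y.2) - E (s - y.1, z.2 + y.2) := by
      intro s; simp [reflect, Prod.sub_def]
    simp_rw [e]
    have d1 := (hasDerivAt_E_fst h₁).comp z.1 ((hasDerivAt_id z.1).sub_const y.1)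
    have d2 := (hasDerivAt_E_fst h₂).comp z.1 ((hasDerivAt_id z.1).sub_const y.1)
    rw [neg_eq_iff_eq_neg]
    exact ((d1.sub d2).congr_deriv (by ring)).deriv
  · simp at *

lemma K_eq (ω : ℝ × ℝ → ℝ) (i : Fin 2) {z : ℝ × ℝ} (hz : 0 ≤ z.2) :
    K ω i z = ∫ y in halfPlane, bsKernel i z y * ω y := by
  unfold K
  refine integral_congr_ae ?_
  -- The closed form may fail only at the singularity `y = z`, a null set. Boundary points `z` are
  -- included because `y₂ > 0` keeps the image singularity away.
  have hne : ∀ᵐ y ∂((volume : Measure (ℝ × ℝ)).restrict halfPlane), y ≠ z :=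
    ae_restrict_of_ae (Measure.ae_ne volume z)
  filter_upwards [ae_restrict_halfPlane, hne] with y hy hyz
  have h1 : (z.1 - y.1) ^ 2 + (z.2 - y.2) ^ 2 ≠ 0 := by
    intro h
    refine hyz (Prod.ext ?_ ?_) <;> nlinarith [sq_nonneg (z.1 - y.1), sq_nonneg (z.2 - y.2)]
  have h2 : (z.1 - y.1) ^ 2 + (z.2 + y.2) ^ 2 ≠ 0 := by positivity
  simp only [perpGrad_D i h1 h2]

lemma measurable_bsKernel (i : Fin 2) :
    Measurable (fun p : (ℝ × ℝ) × (ℝ × ℝ) => bsKernel i p.1 p.2) := by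
  unfold bsKernel
  split_ifs <;> fun_prop

/-- A tensor product of inverse square roots, dominating the Biot-Savart kernel. -/
def rootKernel (z y : ℝ × ℝ) : ℝ :=
  (Real.sqrt |z.1 - y.1|)⁻¹ * (Real.sqrt |z.2 - y.2|)⁻¹

/-- With `q = √|v|` and `r = √|s|` this is `q³ r ≤ q⁴ + r⁴`. The product form turns the planar
singularity into two separately integrable one-dimensional ones. -/
lemma abs_div_sq_add_sq_le {v s : ℝ} (hv : v ≠ 0) (hs : s ≠ 0) :
    |v| / (v ^ 2 + s ^ 2) ≤ (Real.sqrt |v|)⁻¹ * (Real.sqrt |s|)⁻¹ := by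
  set q := Real.sqrt |v| with hq
  set r := Real.sqrt |s| with hr
  have q0 : 0 < q := Real.sqrt_pos.2 (abs_pos.2 hv)
  have r0 : 0 < r := Real.sqrt_pos.2 (abs_pos.2 hs)
  have eq : |v| = q ^ 2 := (Real.sq_sqrt (abs_nonneg v)).symm
  have er : |s| = r ^ 2 := (Real.sq_sqrt (abs_nonneg s)).symm
  rw [← sq_abs v, ← sq_abs s, eq, er, ← mul_inv, ← one_div, div_le_div_iff₀ (by positivity) (by positivity)]
  have h : q ^ 3 * r ≤ q ^ 4 + r ^ 4 := by
    rcases le_total r q with h | h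
    · nlinarith [pow_pos q0 3, pow_pos r0 4]
    · have : q ^ 3 ≤ r ^ 3 := by gcongr
      nlinarith [pow_pos q0 4]
  nlinarith

lemma abs_bsKernel_le (i : Fin 2) {z y : ℝ × ℝ} (hz : 0 < z.2) (hy : 0 < y.2)
    (h₁ : z.1 ≠ y.1) (h₂ : z.2 ≠ y.2) :
    |bsKernel i z y| ≤ 1 / Real.pi * rootKernel z y := by
  have a1 := abs_div_sq_add_sq_le (sub_ne_zero.2 h₁) (sub_ne_zero.2 h₂)
  have a2 := abs_div_sq_add_sq_le (sub_ne_zero.2 h₂) (sub_ne_zero.2 h₁)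
  have a3 := abs_div_sq_add_sq_le (sub_ne_zero.2 h₁) (by positivity : z.2 + y.2 ≠ 0)
  have a4 := abs_div_sq_add_sq_le (by positivity : z.2 + y.2 ≠ 0) (sub_ne_zero.2 h₁)
  have hle : |z.2 - y.2| ≤ |z.2 + y.2| := by
    rw [abs_of_pos (by positivity : 0 < z.2 + y.2), abs_le]; constructor <;> linarith
  have hp : 0 < Real.sqrt |z.2 - y.2| := Real.sqrt_pos.2 (abs_pos.2 (sub_ne_zero.2 h₂))
  have hinv : (Real.sqrt |z.2 + y.2|)⁻¹ ≤ (Real.sqrt |z.2 - y.2|)⁻¹ := by gcongr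
  have hm : 0 ≤ (Real.sqrt |z.1 - y.1|)⁻¹ := by positivity
  have hm2 := mul_le_mul_of_nonneg_left hinv hm
  unfold bsKernel rootKernel
  have fin : ∀ a b c : ℝ, |a| ≤ c → |b| ≤ c → 1 / (2 * Real.pi) * |a - b| ≤ 1 / Real.pi * c := by
    intro a b c ha hb
    calc 1 / (2 * Real.pi) * |a - b| ≤ 1 / (2 * Real.pi) * (c + c) := by
          gcongr
          exact (abs_sub a b).trans (add_le_add ha hb)
      _ = _ := by field_simp; ring
  have habs : ∀ a b c : ℝ, |a / (b ^ 2 + c ^ 2)| = |a| / (b ^ 2 + c ^ 2) := by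
    intro a b c; rw [abs_div, abs_of_nonneg (by positivity : 0 ≤ b ^ 2 + c ^ 2)]
  split_ifs
  · rw [abs_mul, abs_neg, abs_of_pos (by positivity : 0 < 1 / (2 * Real.pi))]
    refine fin _ _ _ ?_ ?_
    · rw [habs]; rw [add_comm, mul_comm (Real.sqrt _)⁻¹] at a2; exact a2
    · rw [habs]; rw [add_comm ((z.2 + y.2) ^ 2), mul_comm (Real.sqrt _)⁻¹] at a4; exact a4.trans hm2
  · rw [abs_mul, abs_of_pos (by positivity : 0 < 1 / (2 * Real.pi))]
    refine fin _ _ _ ?_ ?_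
    · rw [habs]; exact a1
    · rw [habs]; exact a3.trans hm2

lemma integrable_indicator_inv_sqrt :
    Integrable (indicator (Icc (-1) 1) (fun u : ℝ => (Real.sqrt |u|)⁻¹)) := by
  rw [integrable_indicator_iff measurableSet_Icc, integrableOn_Icc_iff_integrableOn_Ioc,
    ← intervalIntegrable_iff_integrableOn_Ioc_of_le (by norm_num)]
  have h1 : IntervalIntegrable (fun u : ℝ => (Real.sqrt |u|)⁻¹) volume 0 1 := by
    have := intervalIntegral.intervalIntegrable_rpow' (a := 0) (b := 1) (r := -(1 / 2)) (by norm_num)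
    refine this.congr (fun u hu => ?_)
    rw [uIoc_of_le zero_le_one] at hu
    show u ^ (-(1 / 2) : ℝ) = (Real.sqrt |u|)⁻¹
    rw [Real.rpow_neg hu.1.le, abs_of_pos hu.1, Real.sqrt_eq_rpow]
  have h2 := (IntervalIntegrable.iff_comp_neg (f := fun u : ℝ => (Real.sqrt |u|)⁻¹)).1 h1
  simp only [abs_neg, neg_zero] at h2
  exact h2.symm.trans h1

/-- Within distance `1` of `y` the inverse root is integrable and the weight is at most `1`; farther
away the inverse root is at most `1` and the weight is integrable. Neither bound depends on `y`. -/
lemma exists_lintegral_inv_sqrt_le : ∃ C : ENNReal, C ≠ ⊤ ∧ ∀ y : ℝ,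
    ∫⁻ v : ℝ, ENNReal.ofReal ((1 + v ^ 2)⁻¹ * (Real.sqrt |v - y|)⁻¹) ≤ C := by
  set f := indicator (Icc (-1) 1) (fun u : ℝ => (Real.sqrt |u|)⁻¹) with hf
  refine ⟨(∫⁻ v : ℝ, ENNReal.ofReal (1 + v ^ 2)⁻¹) + ∫⁻ u, ENNReal.ofReal (f u),
    ENNReal.add_ne_top.2 ⟨integrable_inv_one_add_sq.lintegral_lt_top.ne,
      integrable_indicator_inv_sqrt.lintegral_lt_top.ne⟩, fun y => ?_⟩
  rw [← lintegral_sub_right_eq_self (fun u => ENNReal.ofReal (f u)) y, ← lintegral_add_left (by fun_prop)]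
  refine lintegral_mono fun v => ?_
  have hf0 : 0 ≤ f (v - y) := indicator_nonneg (fun _ _ => by positivity) _
  rw [← ENNReal.ofReal_add (by positivity) hf0]
  refine ENNReal.ofReal_le_ofReal ?_
  have h1 : (1 + v ^ 2)⁻¹ ≤ 1 := inv_le_one_of_one_le₀ (by nlinarith [sq_nonneg v])
  have h0 : 0 ≤ (1 + v ^ 2)⁻¹ := by positivity
  by_cases hv : v - y ∈ Icc (-1 : ℝ) 1
  · rw [hf, indicator_of_mem hv]
    have : 0 ≤ (Real.sqrt |v - y|)⁻¹ := by positivity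
    nlinarith
  · have h2 : 1 ≤ |v - y| := by
      by_contra h
      push Not at h
      exact hv ⟨(abs_lt.1 h).1.le, (abs_lt.1 h).2.le⟩
    have : (Real.sqrt |v - y|)⁻¹ ≤ 1 := inv_le_one_of_one_le₀ (Real.one_le_sqrt.2 h2)
    nlinarith

/-- The integrable weight `((1 + z₁²)(1 + z₂²))⁻¹`. -/
def weight (z : ℝ × ℝ) : ℝ := (1 + z.1 ^ 2)⁻¹ * (1 + z.2 ^ 2)⁻¹

lemma weight_pos (z : ℝ × ℝ) : 0 < weight z := by unfold weight; positivity

@[fun_prop]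
lemma continuous_weight : Continuous weight := by
  unfold weight
  refine Continuous.mul (Continuous.inv₀ (by fun_prop) fun z => by positivity)
    (Continuous.inv₀ (by fun_prop) fun z => by positivity)

lemma integrable_weight : Integrable weight :=
  integrable_inv_one_add_sq.mul_prod integrable_inv_one_add_sq

lemma measurable_rootKernel :
    Measurable (fun p : (ℝ × ℝ) × (ℝ × ℝ) => rootKernel p.1 p.2) := by
  unfold rootKernel
  fun_prop

lemma exists_lintegral_weight_le : ∃ C : ENNReal, C ≠ ⊤ ∧ ∀ y : ℝ × ℝ,
    ∫⁻ z : ℝ × ℝ, ENNReal.ofReal (weight z * rootKernel z y) ≤ C := by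
  obtain ⟨C, hC, h⟩ := exists_lintegral_inv_sqrt_le
  refine ⟨C * C, ENNReal.mul_ne_top hC hC, fun y => ?_⟩
  have e : ∀ z : ℝ × ℝ, ENNReal.ofReal (weight z * rootKernel z y) =
      ENNReal.ofReal ((1 + z.1 ^ 2)⁻¹ * (Real.sqrt |z.1 - y.1|)⁻¹) *
      ENNReal.ofReal ((1 + z.2 ^ 2)⁻¹ * (Real.sqrt |z.2 - y.2|)⁻¹) := by
    intro z
    rw [← ENNReal.ofReal_mul (by positivity)]
    congr 1
    unfold weight rootKernel
    ring
  simp_rw [e]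
  rw [Measure.volume_eq_prod, lintegral_prod_mul
    (f := fun v : ℝ => ENNReal.ofReal ((1 + v ^ 2)⁻¹ * (Real.sqrt |v - y.1|)⁻¹))
    (g := fun v : ℝ => ENNReal.ofReal ((1 + v ^ 2)⁻¹ * (Real.sqrt |v - y.2|)⁻¹))
    (by fun_prop) (by fun_prop)]
  exact mul_le_mul' (h _) (h _)

/-- The velocity `K ω` need not be integrable, but a kernel dominated by `weight` compensates: its
integral in `z` against `rootKernel` is bounded uniformly in `y`, and `ω` supplies integrability in
`y`. All exchanges of integrals with the Biot–Savart law rest on this. -/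
lemma integrable_mul_bsKernel {ω : ℝ × ℝ → ℝ} (hω : IntegrableOn ω halfPlane) (i : Fin 2)
    {J : ℝ × ℝ → ℝ} (hJ : Measurable J) {C : ℝ} (hC : ∀ z ∈ halfPlane, |J z| ≤ C * weight z) :
    Integrable (fun p : (ℝ × ℝ) × (ℝ × ℝ) => J p.1 * (bsKernel i p.1 p.2 * ω p.2))
      ((volume.restrict halfPlane).prod (volume.restrict halfPlane)) := by
  obtain ⟨A, hA, hAle⟩ := exists_lintegral_weight_le
  have hm : AEStronglyMeasurable (fun p : (ℝ × ℝ) × (ℝ × ℝ) => J p.1 * (bsKernel i p.1 p.2 * ω p.2))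
      ((volume.restrict halfPlane).prod (volume.restrict halfPlane)) :=
    (hJ.comp measurable_fst).aestronglyMeasurable.mul
      ((measurable_bsKernel i).aestronglyMeasurable.mul hω.1.comp_snd)
  refine ⟨hm, ?_⟩
  -- Forced by the hypothesis at a single point, since the weight is positive.
  have hC0 : 0 ≤ C := by
    have h1 := hC (0, 1) (by simp [halfPlane])
    have h2 := weight_pos (0, 1)
    by_contra h
    push Not at h
    nlinarith [abs_nonneg (J (0, 1))]
  unfold HasFiniteIntegral
  rw [lintegral_prod_symm _ hm.enorm]
  have hbound : ∀ᵐ y ∂((volume : Measure (ℝ × ℝ)).restrict halfPlane),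
      ∫⁻ z in halfPlane, ‖J z * (bsKernel i z y * ω y)‖ₑ
        ≤ ENNReal.ofReal (C * (1 / Real.pi)) * A * ‖ω y‖ₑ := by
    filter_upwards [ae_restrict_halfPlane] with y hy
    have hne : ∀ᵐ z : ℝ × ℝ, z.1 ≠ y.1 ∧ z.2 ≠ y.2 := by
      have h1 : ∀ᵐ z : ℝ × ℝ, z.1 ≠ y.1 := by
        rw [Measure.volume_eq_prod]
        exact Measure.quasiMeasurePreserving_fst.ae (Measure.ae_ne volume y.1)
      have h2 : ∀ᵐ z : ℝ × ℝ, z.2 ≠ y.2 := by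
        rw [Measure.volume_eq_prod]
        exact Measure.quasiMeasurePreserving_snd.ae (Measure.ae_ne volume y.2)
      exact h1.and h2
    calc ∫⁻ z in halfPlane, ‖J z * (bsKernel i z y * ω y)‖ₑ
        ≤ ∫⁻ z in halfPlane, ENNReal.ofReal (C * (1 / Real.pi)) *
            ENNReal.ofReal (weight z * rootKernel z y) * ‖ω y‖ₑ := by
          refine lintegral_mono_ae ?_
          filter_upwards [ae_restrict_halfPlane, ae_restrict_of_ae hne] with z hz hzy
          rw [enorm_mul, enorm_mul, ← mul_assoc]
          refine mul_le_mul_left ?_ _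
          rw [← enorm_mul, ← ENNReal.ofReal_mul (by positivity), ← ofReal_norm]
          refine ENNReal.ofReal_le_ofReal ?_
          rw [norm_mul, Real.norm_eq_abs, Real.norm_eq_abs]
          calc |J z| * |bsKernel i z y| ≤ (C * weight z) * (1 / Real.pi * rootKernel z y) :=
                mul_le_mul (hC z hz) (abs_bsKernel_le i hz hy hzy.1 hzy.2) (abs_nonneg _)
                  (mul_nonneg hC0 (weight_pos z).le)
            _ = _ := by ring
      _ ≤ ∫⁻ z, ENNReal.ofReal (C * (1 / Real.pi)) *
            ENNReal.ofReal (weight z * rootKernel z y) * ‖ω y‖ₑ := setLIntegral_le_lintegral _ _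
      _ ≤ _ := by
          have hmz : Measurable fun z => ENNReal.ofReal (weight z * rootKernel z y) :=
            (continuous_weight.measurable.mul
              (measurable_rootKernel.comp (measurable_id.prodMk measurable_const))).ennreal_ofReal
          rw [lintegral_mul_const _ (hmz.const_mul _), lintegral_const_mul _ hmz]
          gcongr
          exact hAle y
  refine (lintegral_mono_ae hbound).trans_lt ?_
  rw [lintegral_const_mul'' _ hω.1.enorm]
  exact ENNReal.mul_lt_top (ENNReal.mul_lt_top ENNReal.ofReal_lt_top hA.lt_top) hω.2

lemma integrable_mul_K {ω : ℝ × ℝ → ℝ} (hω : IntegrableOn ω halfPlane) (i : Fin 2)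
    {J : ℝ × ℝ → ℝ} (hJ : Measurable J) {C : ℝ} (hC : ∀ z ∈ halfPlane, |J z| ≤ C * weight z) :
    IntegrableOn (fun z => J z * K ω i z) halfPlane := by
  have h := (integrable_mul_bsKernel hω i hJ hC).integral_prod_left
  refine h.congr ?_
  filter_upwards [ae_restrict_halfPlane] with z hz
  rw [integral_const_mul, K_eq ω i hz.le]

/-- Measurability is read off from `weight * K ω`, which is integrable, by dividing by the positive
weight. -/
lemma aestronglyMeasurable_K {ω : ℝ × ℝ → ℝ} (hω : IntegrableOn ω halfPlane) (i : Fin 2) :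
    AEStronglyMeasurable (K ω i) (volume.restrict halfPlane) := by
  have h := (integrable_mul_K hω i (J := weight) (C := 1) continuous_weight.measurable
    (fun z _ => by rw [abs_of_pos (weight_pos z), one_mul])).1
  have h2 := (continuous_weight.inv₀ fun z => (weight_pos z).ne').aestronglyMeasurable
    (μ := volume.restrict halfPlane) |>.mul h
  refine h2.congr (.of_forall fun z => ?_)
  simp only [Pi.mul_apply]
  exact inv_mul_cancel_left₀ (weight_pos z).ne' _

lemma integral_mul_K {ω : ℝ × ℝ → ℝ} (hω : IntegrableOn ω halfPlane) (i : Fin 2)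
    {J : ℝ × ℝ → ℝ} (hJ : Measurable J) {C : ℝ} (hC : ∀ z ∈ halfPlane, |J z| ≤ C * weight z) :
    ∫ z in halfPlane, J z * K ω i z
      = ∫ y in halfPlane, (∫ z in halfPlane, J z * bsKernel i z y) * ω y := by
  have h := integral_integral_swap (f := fun z y => J z * (bsKernel i z y * ω y))
    (integrable_mul_bsKernel hω i hJ hC)
  calc _ = ∫ z in halfPlane, ∫ y in halfPlane, J z * (bsKernel i z y * ω y) := by
        refine setIntegral_congr_fun measurableSet_halfPlane fun z hz => ?_
        show J z * K ω i z = _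
        rw [integral_const_mul, K_eq ω i (le_of_lt hz)]
    _ = _ := h
    _ = _ := by
        congr 1
        ext y
        rw [← integral_mul_const]
        congr 1
        ext z
        ring

/-! ### Real and imaginary parts of the moments -/

/-- Real part of the Gaussian moments on the line `ζ = s - a i`. -/
def momentRe (n : ℕ) (t a s : ℝ) : ℝ := (moment n t (s - a * Complex.I)).re

/-- Imaginary part of the Gaussian moments on the line `ζ = s - a i`. -/
def momentIm (n : ℕ) (t a s : ℝ) : ℝ := (moment n t (s - a * Complex.I)).im

lemma continuous_momentRe (n : ℕ) {t : ℝ} (ht : 0 < t) :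
    Continuous (fun p : ℝ × ℝ => momentRe n t p.1 p.2) :=
  Complex.continuous_re.comp ((continuous_moment n ht).comp (by fun_prop))

lemma continuous_momentIm (n : ℕ) {t : ℝ} (ht : 0 < t) :
    Continuous (fun p : ℝ × ℝ => momentIm n t p.1 p.2) :=
  Complex.continuous_im.comp ((continuous_moment n ht).comp (by fun_prop))

@[fun_prop]
lemma continuous_momentRe_comp {X : Type*} [TopologicalSpace X] (n : ℕ) {t : ℝ} (ht : 0 < t)
    {f g : X → ℝ} (hf : Continuous f) (hg : Continuous g) :
    Continuous (fun x => momentRe n t (f x) (g x)) :=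
  (continuous_momentRe n ht).comp (hf.prodMk hg)

@[fun_prop]
lemma continuous_momentIm_comp {X : Type*} [TopologicalSpace X] (n : ℕ) {t : ℝ} (ht : 0 < t)
    {f g : X → ℝ} (hf : Continuous f) (hg : Continuous g) :
    Continuous (fun x => momentIm n t (f x) (g x)) :=
  (continuous_momentIm n ht).comp (hf.prodMk hg)

lemma hasDerivAt_moment_fst (n : ℕ) {t : ℝ} (ht : 0 < t) (a s : ℝ) :
    HasDerivAt (fun a : ℝ => moment n t (s - a * Complex.I))
      (Complex.I * moment (n + 1) t (s - a * Complex.I)) a := by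
  have h : HasDerivAt (fun a : ℂ => s - a * Complex.I) (-Complex.I) (a : ℂ) := by
    simpa using ((hasDerivAt_id (a : ℂ)).mul_const Complex.I).const_sub (s : ℂ)
  exact ((hasDerivAt_moment n ht _).comp (a : ℂ) h).comp_ofReal.congr_deriv (by ring)

lemma hasDerivAt_moment_snd (n : ℕ) {t : ℝ} (ht : 0 < t) (a s : ℝ) :
    HasDerivAt (fun s : ℝ => moment n t (s - a * Complex.I))
      (-moment (n + 1) t (s - a * Complex.I)) s := by
  have h : HasDerivAt (fun s : ℂ => s - a * Complex.I) 1 (s : ℂ) :=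
    (hasDerivAt_id (s : ℂ)).sub_const _
  exact ((hasDerivAt_moment n ht _).comp (s : ℂ) h).comp_ofReal.congr_deriv (by ring)

lemma hasDerivAt_re {f : ℝ → ℂ} {f' : ℂ} {r : ℝ} (h : HasDerivAt f f' r) :
    HasDerivAt (fun r => (f r).re) f'.re r :=
  Complex.reCLM.hasFDerivAt.comp_hasDerivAt r h

lemma hasDerivAt_im {f : ℝ → ℂ} {f' : ℂ} {r : ℝ} (h : HasDerivAt f f' r) :
    HasDerivAt (fun r => (f r).im) f'.im r :=
  Complex.imCLM.hasFDerivAt.comp_hasDerivAt r h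

lemma hasDerivAt_momentRe_fst (n : ℕ) {t : ℝ} (ht : 0 < t) (a s : ℝ) :
    HasDerivAt (fun a => momentRe n t a s) (-momentIm (n + 1) t a s) a :=
  (hasDerivAt_re (hasDerivAt_moment_fst n ht a s)).congr_deriv (by simp [momentIm])

lemma hasDerivAt_momentIm_fst (n : ℕ) {t : ℝ} (ht : 0 < t) (a s : ℝ) :
    HasDerivAt (fun a => momentIm n t a s) (momentRe (n + 1) t a s) a :=
  (hasDerivAt_im (hasDerivAt_moment_fst n ht a s)).congr_deriv (by simp [momentRe])

lemma hasDerivAt_momentRe_snd (n : ℕ) {t : ℝ} (ht : 0 < t) (a s : ℝ) :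
    HasDerivAt (fun s => momentRe n t a s) (-momentRe (n + 1) t a s) s :=
  (hasDerivAt_re (hasDerivAt_moment_snd n ht a s)).congr_deriv (by simp [momentRe])

lemma abs_momentRe_one_le {t : ℝ} (ht : 0 < t) (a : ℝ) {s : ℝ} (hs : 0 ≤ s) :
    |momentRe 1 t a s| ≤ 7 / (t + a ^ 2 + s ^ 2) := by
  have h := norm_sq_mul_moment_one_le ht (ζ := s - a * Complex.I) (by simpa using hs)
  have hn : ‖(s - a * Complex.I : ℂ)‖ ^ 2 = a ^ 2 + s ^ 2 := by
    rw [← Complex.normSq_eq_norm_sq, Complex.normSq_apply]; simp; ring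
  rw [le_div_iff₀ (by positivity)]
  rw [hn] at h
  have h2 := Complex.abs_re_le_norm (moment 1 t (s - a * Complex.I))
  have h3 : 0 < t + a ^ 2 + s ^ 2 := by positivity
  unfold momentRe
  nlinarith

lemma re_inv_sub (s v : ℝ) : ((s - v * Complex.I : ℂ)⁻¹).re = s / (v ^ 2 + s ^ 2) := by
  rw [Complex.inv_re, Complex.normSq_apply]; simp; ring

lemma im_inv_sub (s v : ℝ) : ((s - v * Complex.I : ℂ)⁻¹).im = v / (v ^ 2 + s ^ 2) := by
  rw [Complex.inv_im, Complex.normSq_apply]; simp; ring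

lemma integrable_mul_inv_sub {f : ℝ → ℂ} (hf : Integrable f) {s : ℝ} (hs : 0 < s) :
    Integrable (fun v : ℝ => f v * (s - v * Complex.I : ℂ)⁻¹) := by
  have hne : ∀ v : ℝ, (s - v * Complex.I : ℂ) ≠ 0 := fun v h => hs.ne' (by simpa using congrArg Complex.re h)
  refine hf.mul_bdd (c := s⁻¹)
    (Continuous.aestronglyMeasurable (Continuous.inv₀ (by fun_prop) hne)) (.of_forall fun v => ?_)
  rw [norm_inv]
  gcongr
  refine le_trans ?_ (Complex.abs_re_le_norm _)
  simp [abs_of_pos hs]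

lemma integral_ofReal_mul_re {f : ℝ → ℝ} {g : ℝ → ℂ}
    (h : Integrable fun v => (f v : ℂ) * g v) :
    ∫ v, f v * (g v).re = (∫ v, (f v : ℂ) * g v).re := by
  have := integral_re h
  simp only [RCLike.re_to_complex, Complex.re_ofReal_mul] at this
  exact this

lemma integral_ofReal_mul_im {f : ℝ → ℝ} {g : ℝ → ℂ}
    (h : Integrable fun v => (f v : ℂ) * g v) :
    ∫ v, f v * (g v).im = (∫ v, (f v : ℂ) * g v).im := by
  have := integral_im h
  simp only [RCLike.im_to_complex, Complex.im_ofReal_mul] at this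
  exact this

lemma integral_gauss_mul_poisson {t : ℝ} (ht : 0 < t) (a : ℝ) {s : ℝ} (hs : 0 < s) :
    ∫ v, gauss t (a - v) * (s / (v ^ 2 + s ^ 2)) = momentRe 0 t a s := by
  have h := integral_ofReal_mul_re (integrable_mul_inv_sub (integrable_gauss_comp ht a) hs)
  rw [integral_gauss_mul_inv ht a hs] at h
  simp only [re_inv_sub] at h
  exact h

lemma integral_gauss_mul_conjPoisson {t : ℝ} (ht : 0 < t) (a : ℝ) {s : ℝ} (hs : 0 < s) :
    ∫ v, gauss t (a - v) * (v / (v ^ 2 + s ^ 2)) = momentIm 0 t a s := by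
  have h := integral_ofReal_mul_im (integrable_mul_inv_sub (integrable_gauss_comp ht a) hs)
  rw [integral_gauss_mul_inv ht a hs] at h
  simp only [im_inv_sub] at h
  exact h

lemma integral_gaussDeriv_mul_conjPoisson {t : ℝ} (ht : 0 < t) (a : ℝ) {s : ℝ} (hs : 0 < s) :
    ∫ v, gaussDeriv t (a - v) * (v / (v ^ 2 + s ^ 2)) = momentRe 1 t a s := by
  have h := integral_ofReal_mul_im (integrable_mul_inv_sub (integrable_gaussDeriv_comp ht a) hs)
  rw [integral_gaussDeriv_mul_inv ht a hs] at h
  simp only [im_inv_sub, Complex.mul_im, Complex.I_re, Complex.I_im, zero_mul, one_mul,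
    zero_add] at h
  exact h

/-- Semigroup property of the Poisson extension: the boundary values of `Re M₁` extend harmonically
to `Re M₁` at height `s`. -/
lemma integral_momentRe_mul_poisson {t : ℝ} (ht : 0 < t) (a : ℝ) {s : ℝ} (hs : 0 < s) :
    ∫ v, momentRe 1 t (a - v) 0 * (s / (v ^ 2 + s ^ 2)) = Real.pi * momentRe 1 t a s := by
  have hi : Integrable fun v : ℝ =>
      ((s / (v ^ 2 + s ^ 2) : ℝ) : ℂ) * moment 1 t (-((a - v : ℝ) : ℂ) * Complex.I) := by
    refine (integrable_poisson hs).ofReal.mul_bdd (c := ‖moment 1 t 0‖)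
      (Continuous.aestronglyMeasurable ((continuous_moment 1 ht).comp (by fun_prop)))
      (.of_forall fun v => norm_moment_le 1 ht (by simp))
  have h := integral_ofReal_mul_re hi
  have h2 := integral_moment_mul_poisson 1 ht a hs
  simp_rw [mul_comm (moment 1 t _)] at h2
  rw [h2, Complex.re_ofReal_mul] at h
  unfold momentRe
  rw [← h]
  congr 1
  ext v
  rw [mul_comm]
  congr 3
  push_cast
  ring

/-! ### Volterra convolutions and the strip potential in closed form -/

lemma hasDerivAt_intervalIntegral_of_continuous {F F' : ℝ → ℝ → ℝ}
    (hF : ∀ r w, HasDerivAt (fun r => F r w) (F' r w) r)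
    (hc : Continuous (Function.uncurry F)) (hc' : Continuous (Function.uncurry F')) (a b r : ℝ) :
    HasDerivAt (fun r => ∫ w in a..b, F r w) (∫ w in a..b, F' r w) r := by
  obtain ⟨C, hC⟩ := (((isCompact_closedBall r 1).prod (isCompact_uIcc (a := a) (b := b))).image hc').isBounded.exists_norm_le
  refine (intervalIntegral.hasDerivAt_integral_of_dominated_loc_of_deriv_le
    (bound := fun _ => C) (Metric.ball_mem_nhds r one_pos)
    (.of_forall fun r => (hc.comp (by fun_prop : Continuous fun w => (r, w))).aestronglyMeasurable)
    ((hc.comp (by fun_prop : Continuous fun w => (r, w))).intervalIntegrable a b)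
    (hc'.comp (by fun_prop : Continuous fun w => (r, w))).aestronglyMeasurable
    (.of_forall fun w hw r' hr' => ?_) intervalIntegrable_const (.of_forall fun w _ r' _ => hF r' w)).2
  exact hC _ (mem_image_of_mem (Function.uncurry F') (mk_mem_prod (Metric.ball_subset_closedBall hr') (uIoc_subset_uIcc hw)))

/-- Differentiation of a Volterra convolution in its upper limit. -/
lemma hasDerivAt_volterra {b b' c c' : ℝ → ℝ} (hb : ∀ r, HasDerivAt b (b' r) r)
    (hb' : Continuous b') (hc : ∀ r, HasDerivAt c (c' r) r) (hc' : Continuous c') (r : ℝ) :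
    HasDerivAt (fun r => ∫ w in (0 : ℝ)..r, c w * b (r - w))
      (c r * b 0 + ∫ w in (0 : ℝ)..r, c w * b' (r - w)) r := by
  have hbc : Continuous b := continuous_iff_continuousAt.2 fun r => (hb r).continuousAt
  have hcc : Continuous c := continuous_iff_continuousAt.2 fun r => (hc r).continuousAt
  -- The substitution `w = rθ` fixes the interval, so differentiation under the integral applies.
  have scale : ∀ (β : ℝ → ℝ) (r : ℝ), ∫ w in (0 : ℝ)..r, c w * β (r - w)
      = ∫ θ in (0 : ℝ)..1, r * (c (r * θ) * β (r - r * θ)) := by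
    intro β r
    rw [intervalIntegral.integral_const_mul,
      intervalIntegral.mul_integral_comp_mul_left (f := fun w => c w * β (r - w))]
    simp
  simp_rw [scale]
  have hd := hasDerivAt_intervalIntegral_of_continuous
    (F := fun r θ => r * (c (r * θ) * b (r - r * θ)))
    (F' := fun r θ => c (r * θ) * b (r - r * θ) + r * (θ * c' (r * θ) * b (r - r * θ)
      + c (r * θ) * ((1 - θ) * b' (r - r * θ)))) (fun r θ => ?_) (by fun_prop) (by fun_prop) 0 1 r
  · refine hd.congr_deriv ?_
    -- This part of the derivative is `d/dθ` of `θ c(rθ) b(r - rθ)` and integrates to the endpoint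
    -- term; what remains is `r c(rθ) b'(r - rθ)`.
    have hprim : ∫ θ in (0 : ℝ)..1, (c (r * θ) * b (r - r * θ) + r * (θ * c' (r * θ) * b (r - r * θ)
        - θ * c (r * θ) * b' (r - r * θ))) = c r * b 0 := by
      have := intervalIntegral.integral_eq_sub_of_hasDerivAt (a := 0) (b := 1)
        (f := fun θ => θ * (c (r * θ) * b (r - r * θ)))
        (f' := fun θ => c (r * θ) * b (r - r * θ) + r * (θ * c' (r * θ) * b (r - r * θ)
          - θ * c (r * θ) * b' (r - r * θ))) (fun θ _ => ?_)
        (Continuous.intervalIntegrable (by fun_prop) _ _)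
      · rw [this]; simp
      · have h1 : HasDerivAt (fun θ : ℝ => r * θ) r θ := by
          simpa using (hasDerivAt_id θ).const_mul r
        have h2 : HasDerivAt (fun θ : ℝ => r - r * θ) (-r) θ := h1.const_sub r
        have := (hasDerivAt_id θ).mul (((hc _).comp θ h1).mul ((hb _).comp θ h2))
        exact this.congr_deriv (by simp only [Pi.mul_apply, Function.comp_apply, id]; ring)
    rw [← hprim, ← intervalIntegral.integral_add (Continuous.intervalIntegrable (by fun_prop) _ _)
      (Continuous.intervalIntegrable (by fun_prop) _ _)]
    congr 1
    ext θ
    ring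
  · have h1 : HasDerivAt (fun r : ℝ => r * θ) θ r := by
      simpa using (hasDerivAt_id r).mul_const θ
    have h2 : HasDerivAt (fun r : ℝ => r - r * θ) (1 - θ) r := (hasDerivAt_id r).sub h1
    have := (hasDerivAt_id r).mul (((hc _).comp r h1).mul ((hb _).comp r h2))
    exact this.congr_deriv (by simp only [Pi.mul_apply, Function.comp_apply, id]; ring)

/-- The heat kernel factors, and the `w₁`-integral is the convolution of the Gaussian with the
conjugate Poisson kernel, that is `Im M₀`. Only a Volterra convolution in the normal variable
remains. -/
lemma stripPotential_zero {t : ℝ} (ht : 0 < t) (z : ℝ × ℝ) (x₁ : ℝ) {x₂ : ℝ} (hx : 0 ≤ x₂) :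
    stripPotential 0 t z (x₁, x₂) = -(1 / (2 * Real.pi)) *
      ∫ w in (0 : ℝ)..x₂, gauss t (w + z.2) * momentIm 0 t (x₁ - z.1) (x₂ - w) := by
  unfold stripPotential
  rw [intervalIntegral.integral_of_le hx, integral_Ioc_eq_integral_Ioo, ← integral_const_mul]
  refine setIntegral_congr_fun measurableSet_Ioo fun w hw => ?_
  have hs : 0 < x₂ - w := sub_pos.2 hw.2
  have h : ∀ w₁ : ℝ, pd 0 E ((x₁, x₂) - (w₁, w)) * heatKernel ((w₁, w) - reflect z) t =
      (fun v => -(1 / (2 * Real.pi)) * gauss t (w + z.2) *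
        (gauss t (x₁ - z.1 - v) * (v / (v ^ 2 + (x₂ - w) ^ 2)))) (x₁ - w₁) := by
    intro w₁
    rw [heatKernel_eq ht]
    unfold pd
    simp only [if_true, reflect, Prod.mk_sub_mk]
    rw [(hasDerivAt_E_fst (by positivity)).deriv, sub_neg_eq_add,
      show x₁ - z.1 - (x₁ - w₁) = w₁ - z.1 by ring]
    ring
  simp_rw [h]
  rw [integral_sub_left_eq_self (fun v => -(1 / (2 * Real.pi)) * gauss t (w + z.2) *
        (gauss t (x₁ - z.1 - v) * (v / (v ^ 2 + (x₂ - w) ^ 2)))), integral_const_mul,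
        integral_gauss_mul_conjPoisson ht _ hs]
  ring

lemma stripPotential_one {t : ℝ} (ht : 0 < t) (z : ℝ × ℝ) (x₁ : ℝ) {x₂ : ℝ} (hx : 0 ≤ x₂) :
    stripPotential 1 t z (x₁, x₂) = -(1 / (2 * Real.pi)) *
      ∫ w in (0 : ℝ)..x₂, gauss t (w + z.2) * momentRe 0 t (x₁ - z.1) (x₂ - w) := by
  unfold stripPotential
  rw [intervalIntegral.integral_of_le hx, integral_Ioc_eq_integral_Ioo, ← integral_const_mul]
  refine setIntegral_congr_fun measurableSet_Ioo fun w hw => ?_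
  have hs : 0 < x₂ - w := sub_pos.2 hw.2
  have h : ∀ w₁ : ℝ, pd 1 E ((x₁, x₂) - (w₁, w)) * heatKernel ((w₁, w) - reflect z) t =
      (fun v => -(1 / (2 * Real.pi)) * gauss t (w + z.2) *
        (gauss t (x₁ - z.1 - v) * ((x₂ - w) / (v ^ 2 + (x₂ - w) ^ 2)))) (x₁ - w₁) := by
    intro w₁
    rw [heatKernel_eq ht]
    unfold pd
    simp only [reflect, Prod.mk_sub_mk]
    rw [if_neg (by decide), (hasDerivAt_E_snd (by positivity)).deriv, sub_neg_eq_add,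
      show x₁ - z.1 - (x₁ - w₁) = w₁ - z.1 by ring]
    ring
  simp_rw [h]
  rw [integral_sub_left_eq_self (fun v => -(1 / (2 * Real.pi)) * gauss t (w + z.2) *
        (gauss t (x₁ - z.1 - v) * ((x₂ - w) / (v ^ 2 + (x₂ - w) ^ 2)))), integral_const_mul,
        integral_gauss_mul_poisson ht _ hs]
  ring

lemma pd_stripPotential_zero {t : ℝ} (ht : 0 < t) (z : ℝ × ℝ) (x₁ : ℝ) {x₂ : ℝ} (hx : 0 ≤ x₂) :
    pd 0 (stripPotential 0 t z) (x₁, x₂) = -(1 / (2 * Real.pi)) *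
      ∫ w in (0 : ℝ)..x₂, gauss t (w + z.2) * momentRe 1 t (x₁ - z.1) (x₂ - w) := by
  unfold pd
  simp only [if_true, stripPotential_zero ht z _ hx]
  refine ((hasDerivAt_intervalIntegral_of_continuous
    (F := fun r w => gauss t (w + z.2) * momentIm 0 t (r - z.1) (x₂ - w))
    (F' := fun r w => gauss t (w + z.2) * momentRe 1 t (r - z.1) (x₂ - w))
    (fun r w => ?_) ?_ ?_ 0 x₂ x₁).const_mul _).deriv
  · exact ((hasDerivAt_momentIm_fst 0 ht _ _).comp_sub_const r z.1).const_mul _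
  · simp only [Function.uncurry_def]
    fun_prop (disch := assumption)
  · simp only [Function.uncurry_def]
    fun_prop (disch := assumption)

lemma pd_stripPotential_one {t : ℝ} (ht : 0 < t) (z : ℝ × ℝ) (x₁ : ℝ) {x₂ : ℝ} (hx : 0 ≤ x₂) :
    pd 0 (stripPotential 1 t z) (x₁, x₂) = 1 / (2 * Real.pi) *
      ∫ w in (0 : ℝ)..x₂, gauss t (w + z.2) * momentIm 1 t (x₁ - z.1) (x₂ - w) := by
  unfold pd
  simp only [if_true, stripPotential_one ht z _ hx]
  have := ((hasDerivAt_intervalIntegral_of_continuous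
    (F := fun r w => gauss t (w + z.2) * momentRe 0 t (r - z.1) (x₂ - w))
    (F' := fun r w => gauss t (w + z.2) * -momentIm 1 t (r - z.1) (x₂ - w))
    (fun r w => ?_) ?_ ?_ 0 x₂ x₁).const_mul (-(1 / (2 * Real.pi)))).deriv
  · rw [this]
    simp only [mul_neg, intervalIntegral.integral_neg]
    ring
  · exact ((hasDerivAt_momentRe_fst 0 ht _ _).comp_sub_const r z.1).const_mul _
  · simp only [Function.uncurry_def]
    fun_prop (disch := assumption)
  · simp only [Function.uncurry_def]
    fun_prop (disch := assumption)

/-! ### Weighted bounds and differentiation under the integral -/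

lemma lorentz_shift_le {R r z : ℝ} (hr : |r| ≤ R) :
    1 / (1 + (r - z) ^ 2) ≤ 2 * (1 + R ^ 2) * (1 + z ^ 2)⁻¹ := by
  have hR : r ^ 2 ≤ R ^ 2 := by rw [← sq_abs r]; gcongr
  rw [← div_eq_mul_inv, div_le_div_iff₀ (by positivity) (by positivity)]
  nlinarith [sq_nonneg (2 * r - z), sq_nonneg (r - z), mul_nonneg (sq_nonneg R) (sq_nonneg (r - z))]

/-- Decay in `z`, uniform for `|r| ≤ R` and `s ≥ 0`. Multiplying a tangential and a normal bound
gives the domination by `weight` needed to pair kernels and their derivatives with `K ω`. -/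
lemma exists_kernel_bounds {t : ℝ} (ht : 0 < t) (R : ℝ) : ∃ A, 0 < A ∧ ∀ r z : ℝ, |r| ≤ R →
    |gauss t (r - z)| ≤ A * (1 + z ^ 2)⁻¹ ∧ |gauss t (r + z)| ≤ A * (1 + z ^ 2)⁻¹ ∧
    |gaussDeriv t (r - z)| ≤ A * (1 + z ^ 2)⁻¹ ∧ |gaussDeriv t (r + z)| ≤ A * (1 + z ^ 2)⁻¹ ∧
    ∀ s : ℝ, 0 ≤ s → |momentRe 1 t (r - z) s| ≤ A * (1 + z ^ 2)⁻¹ ∧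
      |momentIm 1 t (r - z) s| ≤ A * (1 + z ^ 2)⁻¹ ∧
      |momentRe 2 t (r - z) s| ≤ A * (1 + z ^ 2)⁻¹ := by
  obtain ⟨C₁, h₁, hC₁⟩ := exists_gauss_le ht
  obtain ⟨C₂, h₂, hC₂⟩ := exists_norm_moment_le ht
  have key : ∀ C ≤ C₁ + C₂, ∀ r z u, |r| ≤ R → u ≤ C / (1 + (r - z) ^ 2) →
      u ≤ (C₁ + C₂) * (2 * (1 + R ^ 2)) * (1 + z ^ 2)⁻¹ := by
    intro C hC r z u hr hu
    calc u ≤ C / (1 + (r - z) ^ 2) := hu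
      _ ≤ (C₁ + C₂) / (1 + (r - z) ^ 2) := by gcongr
      _ = (C₁ + C₂) * (1 / (1 + (r - z) ^ 2)) := by ring
      _ ≤ (C₁ + C₂) * (2 * (1 + R ^ 2) * (1 + z ^ 2)⁻¹) := by
          gcongr; exact lorentz_shift_le hr
      _ = _ := by ring
  refine ⟨(C₁ + C₂) * (2 * (1 + R ^ 2)), by positivity, fun r z hr => ?_⟩
  have k1 := fun z u hu => key C₁ (by linarith) r z u hr hu
  have k2 := fun z u hu => key C₂ (by linarith) r z u hr hu
  refine ⟨k1 z _ ?_, ?_, k1 z _ (hC₁ _).2, ?_, fun s hs => ?_⟩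
  · rw [abs_of_nonneg (gauss_nonneg _ _)]; exact (hC₁ _).1
  · have := k1 (-z) |gauss t (r + z)| (by
      rw [abs_of_nonneg (gauss_nonneg _ _), sub_neg_eq_add]; exact (hC₁ _).1)
    rwa [neg_sq] at this
  · have := k1 (-z) |gaussDeriv t (r + z)| (by rw [sub_neg_eq_add]; exact (hC₁ _).2)
    rwa [neg_sq] at this
  · have hm := hC₂ (s - (r - z : ℝ) * Complex.I) (by simpa using hs)
    have him : (s - (r - z : ℝ) * Complex.I : ℂ).im ^ 2 = (r - z) ^ 2 := by
      simp; ring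
    rw [him] at hm
    exact ⟨k2 z _ ((Complex.abs_re_le_norm _).trans hm.1),
      k2 z _ ((Complex.abs_im_le_norm _).trans hm.1), k2 z _ ((Complex.abs_re_le_norm _).trans hm.2)⟩

lemma abs_mul_le_weight {A B a b : ℝ} {z : ℝ × ℝ} (hA : 0 ≤ A)
    (ha : |a| ≤ A * (1 + z.1 ^ 2)⁻¹) (hb : |b| ≤ B * (1 + z.2 ^ 2)⁻¹) :
    |a * b| ≤ A * B * weight z := by
  rw [abs_mul]
  calc |a| * |b| ≤ (A * (1 + z.1 ^ 2)⁻¹) * (B * (1 + z.2 ^ 2)⁻¹) :=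
        mul_le_mul ha hb (abs_nonneg _) (by positivity)
    _ = _ := by unfold weight; ring

lemma abs_volterra_le {A R t x₂ : ℝ} {m : ℝ → ℝ} {z : ℝ × ℝ} (hA : 0 ≤ A) (hx : 0 ≤ x₂) (hR : x₂ ≤ R)
    (hg : ∀ r z : ℝ, |r| ≤ R → |gauss t (r + z)| ≤ A * (1 + z ^ 2)⁻¹)
    (hm : ∀ s, 0 ≤ s → |m s| ≤ A * (1 + z.1 ^ 2)⁻¹) :
    |∫ w in (0 : ℝ)..x₂, gauss t (w + z.2) * m (x₂ - w)| ≤ A * A * R * weight z := by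
  have h := intervalIntegral.norm_integral_le_of_norm_le_const (a := 0) (b := x₂)
    (f := fun w => gauss t (w + z.2) * m (x₂ - w)) (C := A * A * weight z) (fun w hw => ?_)
  · rw [Real.norm_eq_abs, sub_zero, abs_of_nonneg hx] at h
    have := weight_pos z
    calc _ ≤ _ := h
      _ ≤ A * A * weight z * R := by gcongr
      _ = _ := by ring
  · rw [uIoc_of_le hx] at hw
    rw [Real.norm_eq_abs, mul_comm]
    exact abs_mul_le_weight hA (hm _ (by linarith [hw.2]))
      (hg w z.2 (by rw [abs_of_pos hw.1]; linarith [hw.2]))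

lemma hasDerivAt_integral_mul_K {ω : ℝ × ℝ → ℝ} (hω : IntegrableOn ω halfPlane) (i : Fin 2)
    {g g' : ℝ → ℝ × ℝ → ℝ} {s : Set ℝ} {r : ℝ} (hs : s ∈ 𝓝 r) {C : ℝ}
    (hg : ∀ r, Continuous (g r)) (hg' : Continuous (g' r))
    (hC : ∀ z ∈ halfPlane, |g r z| ≤ C * weight z)
    (hC' : ∀ r ∈ s, ∀ z ∈ halfPlane, |g' r z| ≤ C * weight z)
    (hd : ∀ r ∈ s, ∀ z ∈ halfPlane, HasDerivAt (fun r => g r z) (g' r z) r) :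
    HasDerivAt (fun r => ∫ z in halfPlane, g r z * K ω i z)
      (∫ z in halfPlane, g' r z * K ω i z) r := by
  have hK := aestronglyMeasurable_K hω i
  have hw := (integrable_mul_K hω i (J := weight) (C := 1) continuous_weight.measurable
    (fun z _ => by rw [abs_of_pos (weight_pos z), one_mul])).norm.const_mul C
  refine (hasDerivAt_integral_of_dominated_loc_of_deriv_le
    (F := fun r z => g r z * K ω i z) (F' := fun r z => g' r z * K ω i z) hs
    (.of_forall fun r => (hg r).aestronglyMeasurable.mul hK)
    (integrable_mul_K hω i (hg r).measurable hC) (hg'.aestronglyMeasurable.mul hK) ?_ hw ?_).2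
  · filter_upwards [ae_restrict_halfPlane] with z hz r' hr'
    rw [norm_mul, norm_mul, ← mul_assoc, Real.norm_eq_abs, Real.norm_of_nonneg (weight_pos z).le]
    gcongr
    exact hC' r' hr' z hz
  · filter_upwards [ae_restrict_halfPlane] with z hz r' hr'
    exact (hd r' hr' z hz).mul_const _

/-! ### The Stokes semigroup and its vorticity -/

lemma kron_self (i : Fin 2) : kron i i = 1 := by simp [kron]

lemma kron_zero_one : kron 0 1 = 0 := by simp [kron]

lemma kron_one_zero : kron 1 0 = 0 := by simp [kron]

lemma S_zero_eq {t : ℝ} (ht : 0 < t) (u : Fin 2 → ℝ × ℝ → ℝ) (x₁ : ℝ) {x₂ : ℝ} (hx : 0 ≤ x₂) :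
    S t u 0 (x₁, x₂) = ∫ z in halfPlane,
      (gauss t (x₁ - z.1) * (gauss t (x₂ - z.2) - gauss t (x₂ + z.2)) + 2 / Real.pi *
        ∫ w in (0 : ℝ)..x₂, gauss t (w + z.2) * momentRe 1 t (x₁ - z.1) (x₂ - w)) * u 0 z := by
  unfold S
  congr 1
  ext z
  simp only [Fin.sum_univ_two, G, kron_self, kron_zero_one, heatKernel_eq ht,
    pd_stripPotential_zero ht z x₁ hx, reflect, Prod.fst_sub, Prod.snd_sub, sub_neg_eq_add]
  ring

lemma S_one_eq {t : ℝ} (ht : 0 < t) (u : Fin 2 → ℝ × ℝ → ℝ) (x₁ : ℝ) {x₂ : ℝ} (hx : 0 ≤ x₂) :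
    S t u 1 (x₁, x₂) = ∫ z in halfPlane, ((-(2 / Real.pi) *
        ∫ w in (0 : ℝ)..x₂, gauss t (w + z.2) * momentIm 1 t (x₁ - z.1) (x₂ - w)) * u 0 z +
      (gauss t (x₁ - z.1) * (gauss t (x₂ - z.2) - gauss t (x₂ + z.2))) * u 1 z) := by
  unfold S
  congr 1
  ext z
  simp only [Fin.sum_univ_two, G, kron_self, kron_zero_one, kron_one_zero, heatKernel_eq ht,
    pd_stripPotential_one ht z x₁ hx, reflect, Prod.fst_sub, Prod.snd_sub, sub_neg_eq_add]
  ring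

/-- The kernel of the vorticity `-∇^⊥ · S(t) u`, acting on the tangential and on the normal
component of `u`. -/
def curlKernel (i : Fin 2) (t : ℝ) (x z : ℝ × ℝ) : ℝ :=
  if i = 0 then
    gauss t (x.1 - z.1) * (gaussDeriv t (x.2 + z.2) - gaussDeriv t (x.2 - z.2))
      - 2 / Real.pi * (gauss t (x.2 + z.2) * momentRe 1 t (x.1 - z.1) 0)
  else gaussDeriv t (x.1 - z.1) * (gauss t (x.2 - z.2) - gauss t (x.2 + z.2))

lemma continuous_curlKernel (i : Fin 2) {t : ℝ} (ht : 0 < t) (x : ℝ × ℝ) :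
    Continuous (curlKernel i t x) := by
  unfold curlKernel
  split_ifs
  · fun_prop (disch := assumption)
  · fun_prop

lemma continuous_volterra_momentRe (n : ℕ) {t : ℝ} (ht : 0 < t) (x₁ x₂ : ℝ) :
    Continuous fun z : ℝ × ℝ =>
      ∫ w in (0 : ℝ)..x₂, gauss t (w + z.2) * momentRe n t (x₁ - z.1) (x₂ - w) := by
  refine intervalIntegral.continuous_parametric_intervalIntegral_of_continuous' ?_ 0 x₂
  simp only [Function.uncurry_def]
  fun_prop (disch := assumption)

lemma continuous_volterra_momentIm (n : ℕ) {t : ℝ} (ht : 0 < t) (x₁ x₂ : ℝ) :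
    Continuous fun z : ℝ × ℝ =>
      ∫ w in (0 : ℝ)..x₂, gauss t (w + z.2) * momentIm n t (x₁ - z.1) (x₂ - w) := by
  refine intervalIntegral.continuous_parametric_intervalIntegral_of_continuous' ?_ 0 x₂
  simp only [Function.uncurry_def]
  fun_prop (disch := assumption)

lemma hasDerivAt_gauss_sub (t r z : ℝ) :
    HasDerivAt (fun r => gauss t (r - z)) (gaussDeriv t (r - z)) r :=
  (hasDerivAt_gauss t _).comp_sub_const r z

lemma hasDerivAt_gauss_add (t r z : ℝ) :
    HasDerivAt (fun r => gauss t (r + z)) (gaussDeriv t (r + z)) r :=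
  (hasDerivAt_gauss t _).comp_add_const r z

lemma exists_abs_curlKernel_le (i : Fin 2) {t : ℝ} (ht : 0 < t) (x : ℝ × ℝ) :
    ∃ C, ∀ z ∈ halfPlane, |curlKernel i t x z| ≤ C * weight z := by
  obtain ⟨A, hA, h⟩ := exists_kernel_bounds ht (|x.1| + |x.2|)
  refine ⟨A * (A + A) + 2 / Real.pi * (A * A), fun z _ => ?_⟩
  obtain ⟨h1, -, h2, -, h3⟩ := h x.1 z.1 (by linarith [abs_nonneg x.2])
  obtain ⟨h4, h5, h6, h7, -⟩ := h x.2 z.2 (by linarith [abs_nonneg x.1])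
  have hw := weight_pos z
  unfold curlKernel
  split_ifs
  · have e1 : |gaussDeriv t (x.2 + z.2) - gaussDeriv t (x.2 - z.2)| ≤ (A + A) * (1 + z.2 ^ 2)⁻¹ := by
      refine (abs_sub _ _).trans ?_; linarith
    have b1 := abs_mul_le_weight hA.le h1 e1
    have b2 := abs_mul_le_weight hA.le (h3 0 le_rfl).1 h5
    refine (abs_sub _ _).trans ?_
    rw [abs_mul (2 / Real.pi), abs_of_pos (by positivity : 0 < 2 / Real.pi), mul_comm (gauss t (x.2 + z.2)), add_mul,
      mul_assoc (2 / Real.pi)]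
    gcongr
  · have e1 : |gauss t (x.2 - z.2) - gauss t (x.2 + z.2)| ≤ (A + A) * (1 + z.2 ^ 2)⁻¹ := by
      refine (abs_sub _ _).trans ?_; linarith
    have b1 := abs_mul_le_weight hA.le h2 e1
    have : 0 ≤ 2 / Real.pi * (A * A) * weight z := by positivity
    linarith

/-- The Volterra term contributes an endpoint term with `M₁` at height `0` and an integral with
`M₂`. Integrability is recorded because the `M₂` integral is later cancelled against the one in
`pd_S_one`. -/
lemma pd_S_zero {t : ℝ} (ht : 0 < t) {ω : ℝ × ℝ → ℝ} (hω : IntegrableOn ω halfPlane) (x₁ : ℝ)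
    {x₂ : ℝ} (hx : 0 < x₂) :
    IntegrableOn (fun z => (gauss t (x₁ - z.1) * (gaussDeriv t (x₂ - z.2) - gaussDeriv t (x₂ + z.2)) +
        2 / Real.pi * (gauss t (x₂ + z.2) * momentRe 1 t (x₁ - z.1) 0 -
        ∫ w in (0 : ℝ)..x₂, gauss t (w + z.2) * momentRe 2 t (x₁ - z.1) (x₂ - w))) * K ω 0 z) halfPlane ∧
    pd 1 (S t (K ω) 0) (x₁, x₂) = ∫ z in halfPlane,
      (gauss t (x₁ - z.1) * (gaussDeriv t (x₂ - z.2) - gaussDeriv t (x₂ + z.2)) +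
        2 / Real.pi * (gauss t (x₂ + z.2) * momentRe 1 t (x₁ - z.1) 0 -
        ∫ w in (0 : ℝ)..x₂, gauss t (w + z.2) * momentRe 2 t (x₁ - z.1) (x₂ - w))) * K ω 0 z := by
  set R := |x₁| + x₂ + 1 with hR
  obtain ⟨A, hA, h⟩ := exists_kernel_bounds ht R
  have hR0 : 0 < R := by positivity
  have bv : ∀ n, (∀ z s : ℝ, 0 ≤ s → |momentRe n t (x₁ - z) s| ≤ A * (1 + z ^ 2)⁻¹) →
      ∀ r ∈ Ioo 0 (x₂ + 1), ∀ z : ℝ × ℝ,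
      |∫ w in (0 : ℝ)..r, gauss t (w + z.2) * momentRe n t (x₁ - z.1) (r - w)| ≤ A * A * R * weight z :=
    fun n hn r hr z => abs_volterra_le hA.le hr.1.le (by rw [hR]; linarith [hr.2, abs_nonneg x₁])
      (fun r z hr => (h r z hr).2.1) (hn z.1)
  have hx1 : |x₁| ≤ R := by linarith
  have hrR : ∀ r ∈ Ioo 0 (x₂ + 1), |r| ≤ R := fun r hr => by
    rw [abs_of_pos hr.1]; linarith [hr.2, abs_nonneg x₁]
  have bv1 := bv 1 (fun z s hs => ((h x₁ z hx1).2.2.2.2 s hs).1)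
  have bv2 := bv 2 (fun z s hs => ((h x₁ z hx1).2.2.2.2 s hs).2.2)
  have hπ : 0 < 2 / Real.pi := by positivity
  have hmem : Ioo 0 (x₂ + 1) ∈ 𝓝 x₂ := Ioo_mem_nhds hx (by linarith)
  set C := A * (A + A) + 2 / Real.pi * (A * A * R) + 2 / Real.pi * (A * A + A * A * R) with hC
  set g : ℝ → ℝ × ℝ → ℝ := fun r z => gauss t (x₁ - z.1) * (gauss t (r - z.2) - gauss t (r + z.2)) +
      2 / Real.pi * ∫ w in (0 : ℝ)..r, gauss t (w + z.2) * momentRe 1 t (x₁ - z.1) (r - w) with hg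
  set g' : ℝ → ℝ × ℝ → ℝ := fun r z => gauss t (x₁ - z.1) * (gaussDeriv t (r - z.2) - gaussDeriv t (r + z.2)) +
        2 / Real.pi * (gauss t (r + z.2) * momentRe 1 t (x₁ - z.1) 0 -
        ∫ w in (0 : ℝ)..r, gauss t (w + z.2) * momentRe 2 t (x₁ - z.1) (r - w)) with hg'
  have cg : ∀ r, Continuous (g r) := fun r => by
    have := continuous_volterra_momentRe 1 ht x₁ r
    simp only [hg]; fun_prop (disch := assumption)
  have cg' : ∀ r, Continuous (g' r) := fun r => by
    have := continuous_volterra_momentRe 2 ht x₁ r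
    simp only [hg']; fun_prop (disch := assumption)
  have hb : ∀ r ∈ Ioo 0 (x₂ + 1), ∀ z ∈ halfPlane, |g r z| ≤ C * weight z := by
    intro r hr z _
    obtain ⟨h1, -⟩ := h x₁ z.1 hx1
    obtain ⟨h4, h5, -⟩ := h r z.2 (hrR r hr)
    have e1 : |gauss t (r - z.2) - gauss t (r + z.2)| ≤ (A + A) * (1 + z.2 ^ 2)⁻¹ := by
      refine (abs_sub _ _).trans ?_; linarith
    have b1 := abs_mul_le_weight hA.le h1 e1
    have b2 := mul_le_mul_of_nonneg_left (bv1 r hr z) hπ.le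
    refine (abs_add_le _ _).trans ?_
    rw [abs_mul (2 / Real.pi), abs_of_pos hπ]
    have : 0 ≤ 2 / Real.pi * (A * A + A * A * R) * weight z := by have := weight_pos z; positivity
    rw [hC]
    linarith
  have hb' : ∀ r ∈ Ioo 0 (x₂ + 1), ∀ z ∈ halfPlane, |g' r z| ≤ C * weight z := by
    intro r hr z _
    obtain ⟨h1, -, -, -, h3⟩ := h x₁ z.1 hx1
    obtain ⟨-, h5, h6, h7, -⟩ := h r z.2 (hrR r hr)
    have e1 : |gaussDeriv t (r - z.2) - gaussDeriv t (r + z.2)| ≤ (A + A) * (1 + z.2 ^ 2)⁻¹ := by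
      refine (abs_sub _ _).trans ?_; linarith
    have b1 := abs_mul_le_weight hA.le h1 e1
    have b3 := abs_mul_le_weight hA.le (h3 0 le_rfl).1 h5
    rw [mul_comm (momentRe _ _ _ _)] at b3
    have b2 := bv2 r hr z
    have b4 := mul_le_mul_of_nonneg_left ((abs_sub (gauss t (r + z.2) * momentRe 1 t (x₁ - z.1) 0)
      (∫ w in (0 : ℝ)..r, gauss t (w + z.2) * momentRe 2 t (x₁ - z.1) (r - w))).trans
      (add_le_add b3 b2)) hπ.le
    refine (abs_add_le _ _).trans ?_
    rw [abs_mul (2 / Real.pi), abs_of_pos hπ]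
    have : 0 ≤ 2 / Real.pi * (A * A * R) * weight z := by have := weight_pos z; positivity
    rw [hC]
    linarith
  have hd : ∀ r ∈ Ioo 0 (x₂ + 1), ∀ z ∈ halfPlane, HasDerivAt (fun r => g r z) (g' r z) r := by
    intro r _ z _
    refine (((hasDerivAt_gauss_sub t r z.2).sub (hasDerivAt_gauss_add t r z.2)).const_mul _).add
      (HasDerivAt.const_mul _ ?_)
    have cm : Continuous fun s => -momentRe 2 t (x₁ - z.1) s := by fun_prop (disch := assumption)
    refine (hasDerivAt_volterra (fun s => hasDerivAt_momentRe_snd 1 ht (x₁ - z.1) s) cm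
      (fun s => hasDerivAt_gauss_add t s z.2) (by fun_prop) r).congr_deriv ?_
    simp only [mul_neg, intervalIntegral.integral_neg]
    ring
  have hx2 : x₂ ∈ Ioo 0 (x₂ + 1) := ⟨hx, by linarith⟩
  refine ⟨integrable_mul_K hω 0 (cg' x₂).measurable (hb' x₂ hx2), ?_⟩
  have := hasDerivAt_integral_mul_K hω 0 hmem cg (cg' x₂) (hb x₂ hx2) hb' hd
  unfold pd
  rw [if_neg (by decide)]
  refine Eq.trans (Filter.EventuallyEq.deriv_eq ?_) this.deriv
  -- The closed form of `S` needs a nonnegative normal coordinate, so the two functions are compared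
  -- only near `x₂ > 0`.
  filter_upwards [hmem] with r hr
  exact S_zero_eq ht _ x₁ hr.1.le

lemma pd_S_one {t : ℝ} (ht : 0 < t) {ω : ℝ × ℝ → ℝ} (hω : IntegrableOn ω halfPlane) (x₁ : ℝ)
    {x₂ : ℝ} (hx : 0 < x₂) :
    IntegrableOn (fun z => (-(2 / Real.pi) *
        ∫ w in (0 : ℝ)..x₂, gauss t (w + z.2) * momentRe 2 t (x₁ - z.1) (x₂ - w)) * K ω 0 z) halfPlane ∧
    pd 0 (S t (K ω) 1) (x₁, x₂) = (∫ z in halfPlane, (-(2 / Real.pi) *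
        ∫ w in (0 : ℝ)..x₂, gauss t (w + z.2) * momentRe 2 t (x₁ - z.1) (x₂ - w)) * K ω 0 z) +
      ∫ z in halfPlane, curlKernel 1 t (x₁, x₂) z * K ω 1 z := by
  set R := |x₁| + x₂ + 1 with hR
  obtain ⟨A, hA, h⟩ := exists_kernel_bounds ht R
  have hR0 : 0 < R := by positivity
  have hx2 : |x₂| ≤ R := by rw [abs_of_pos hx]; linarith [abs_nonneg x₁]
  have hrR : ∀ r ∈ Metric.ball x₁ 1, |r| ≤ R := fun r hr => by
    rw [Metric.mem_ball, Real.dist_eq] at hr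
    have := abs_add_le (r - x₁) x₁
    rw [sub_add_cancel] at this
    linarith
  have hπ : 0 < 2 / Real.pi := by positivity
  have hmem : Metric.ball x₁ 1 ∈ 𝓝 x₁ := Metric.ball_mem_nhds _ one_pos
  have hx1 : x₁ ∈ Metric.ball x₁ 1 := Metric.mem_ball_self one_pos
  have neg_bound : ∀ {a b : ℝ}, |a| ≤ b → |-(2 / Real.pi) * a| ≤ 2 / Real.pi * b := by
    intro a b hab
    rw [abs_mul, abs_neg, abs_of_pos hπ]; gcongr
  have bIm : ∀ r ∈ Metric.ball x₁ 1, ∀ z : ℝ × ℝ, |-(2 / Real.pi) *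
      ∫ w in (0 : ℝ)..x₂, gauss t (w + z.2) * momentIm 1 t (r - z.1) (x₂ - w)|
        ≤ 2 / Real.pi * (A * A * R) * weight z := fun r hr z => by
    rw [mul_assoc]
    exact neg_bound (abs_volterra_le hA.le hx.le (le_of_abs_le hx2) (fun r z hr => (h r z hr).2.1)
      fun s hs => ((h r z.1 (hrR r hr)).2.2.2.2 s hs).2.1)
  have bRe : ∀ r ∈ Metric.ball x₁ 1, ∀ z : ℝ × ℝ, |-(2 / Real.pi) *
      ∫ w in (0 : ℝ)..x₂, gauss t (w + z.2) * momentRe 2 t (r - z.1) (x₂ - w)|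
        ≤ 2 / Real.pi * (A * A * R) * weight z := fun r hr z => by
    rw [mul_assoc]
    exact neg_bound (abs_volterra_le hA.le hx.le (le_of_abs_le hx2) (fun r z hr => (h r z hr).2.1)
      fun s hs => ((h r z.1 (hrR r hr)).2.2.2.2 s hs).2.2)
  have bdiff : ∀ z : ℝ × ℝ, |gauss t (x₂ - z.2) - gauss t (x₂ + z.2)| ≤ (A + A) * (1 + z.2 ^ 2)⁻¹ :=
    fun z => by
      obtain ⟨h4, h5, -⟩ := h x₂ z.2 hx2
      refine (abs_sub _ _).trans ?_; linarith
  have cIm : ∀ r, Continuous fun z : ℝ × ℝ => -(2 / Real.pi) *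
      ∫ w in (0 : ℝ)..x₂, gauss t (w + z.2) * momentIm 1 t (r - z.1) (x₂ - w) := fun r =>
    continuous_const.mul (continuous_volterra_momentIm 1 ht r x₂)
  have cRe : ∀ r, Continuous fun z : ℝ × ℝ => -(2 / Real.pi) *
      ∫ w in (0 : ℝ)..x₂, gauss t (w + z.2) * momentRe 2 t (r - z.1) (x₂ - w) := fun r =>
    continuous_const.mul (continuous_volterra_momentRe 2 ht r x₂)
  have cG : ∀ r, Continuous fun z : ℝ × ℝ => gauss t (r - z.1) * (gauss t (x₂ - z.2) - gauss t (x₂ + z.2)) :=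
    fun r => by fun_prop
  have bG : ∀ r ∈ Metric.ball x₁ 1, ∀ z : ℝ × ℝ,
      |gauss t (r - z.1) * (gauss t (x₂ - z.2) - gauss t (x₂ + z.2))| ≤ A * (A + A) * weight z :=
    fun r hr z => abs_mul_le_weight hA.le (h r z.1 (hrR r hr)).1 (bdiff z)
  have bG' : ∀ r ∈ Metric.ball x₁ 1, ∀ z : ℝ × ℝ,
      |gaussDeriv t (r - z.1) * (gauss t (x₂ - z.2) - gauss t (x₂ + z.2))| ≤ A * (A + A) * weight z :=
    fun r hr z => abs_mul_le_weight hA.le (h r z.1 (hrR r hr)).2.2.1 (bdiff z)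
  have d1 := hasDerivAt_integral_mul_K hω 0 hmem cIm (cRe x₁) (fun z _ => bIm x₁ hx1 z)
    (fun r hr z _ => bRe r hr z) (fun r _ z _ => by
      refine (hasDerivAt_intervalIntegral_of_continuous
        (F := fun r w => gauss t (w + z.2) * momentIm 1 t (r - z.1) (x₂ - w))
        (F' := fun r w => gauss t (w + z.2) * momentRe 2 t (r - z.1) (x₂ - w))
        (fun r w => ?_) ?_ ?_ 0 x₂ r).const_mul _
      · exact ((hasDerivAt_momentIm_fst 1 ht _ _).comp_sub_const r z.1).const_mul _
      · simp only [Function.uncurry_def]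
        fun_prop (disch := assumption)
      · simp only [Function.uncurry_def]
        fun_prop (disch := assumption))
  have d2 := hasDerivAt_integral_mul_K hω 1 hmem cG
    (g' := fun r z => gaussDeriv t (r - z.1) * (gauss t (x₂ - z.2) - gauss t (x₂ + z.2)))
    (by fun_prop) (fun z _ => bG x₁ hx1 z)
    (fun r hr z _ => bG' r hr z) (fun r _ z _ => (hasDerivAt_gauss_sub t r z.1).mul_const _)
  refine ⟨integrable_mul_K hω 0 (cRe x₁).measurable (fun z _ => bRe x₁ hx1 z), ?_⟩
  unfold pd
  rw [if_pos rfl]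
  refine Eq.trans (Filter.EventuallyEq.deriv_eq ?_) ((d1.add d2).deriv.trans ?_)
  · filter_upwards [hmem] with r hr
    rw [Pi.add_apply, ← integral_add (integrable_mul_K hω 0 (cIm r).measurable (fun z _ => bIm r hr z))
      (integrable_mul_K hω 1 (cG r).measurable (fun z _ => bG r hr z))]
    exact S_one_eq ht _ r hx.le
  · simp [curlKernel]

/-- The `M₂` integrals from `∂₂` of the first component and `∂₁` of the second coincide by the
Cauchy–Riemann equations and cancel in the curl. Only the endpoint term at height `0` survives from
the strip potential. -/
lemma T_eq {t : ℝ} (ht : 0 < t) {ω : ℝ × ℝ → ℝ} (hω : IntegrableOn ω halfPlane) {x : ℝ × ℝ}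
    (hx : x ∈ halfPlane) :
    T t ω x = (∫ z in halfPlane, curlKernel 0 t x z * K ω 0 z) +
      ∫ z in halfPlane, curlKernel 1 t x z * K ω 1 z := by
  obtain ⟨x₁, x₂⟩ := x
  have hx : 0 < x₂ := hx
  obtain ⟨i0, e0⟩ := pd_S_zero ht hω x₁ hx
  obtain ⟨i1, e1⟩ := pd_S_one ht hω x₁ hx
  unfold T perpDiv
  rw [e0, e1, neg_sub, add_comm, add_sub_assoc, ← integral_sub i1 i0, add_comm]
  congr 1
  congr 1
  ext z
  simp only [curlKernel, if_true]
  ring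

/-! ### The kernel of the vorticity semigroup -/

/-- By evenness, `∫₀^∞ cos(ak) e^{-tk²} dk` is half of the Fourier transform of a Gaussian. This is
the value that produces the heat kernel at the jump `z₂ = y₂`. -/
lemma momentRe_zero_zero {t : ℝ} (ht : 0 < t) (a : ℝ) :
    momentRe 0 t a 0 = Real.pi * gauss t a := by
  have hre : ∀ k : ℝ, ((k : ℂ) ^ 0 * Complex.exp (-k * ((0 : ℝ) - a * Complex.I) - t * k ^ 2)).re
      = Real.cos (a * |k|) * Real.exp (-t * |k| ^ 2) := by
    intro k
    rw [sq_abs, pow_zero, one_mul, show (-k * ((0 : ℝ) - a * Complex.I) - t * k ^ 2 : ℂ)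
      = ((-t * k ^ 2 : ℝ) : ℂ) + ((a * k : ℝ) : ℂ) * Complex.I by push_cast; ring, Complex.exp_add,
      ← Complex.ofReal_exp, Complex.re_ofReal_mul, Complex.exp_ofReal_mul_I_re]
    rcases abs_choice k with h | h <;> rw [h]
    · ring
    · rw [mul_neg, Real.cos_neg]; ring
  have hi := integrableOn_moment 0 ht ((0 : ℝ) - a * Complex.I)
  have h1 : momentRe 0 t a 0 = ∫ k in Ioi (0 : ℝ), Real.cos (a * k) * Real.exp (-t * k ^ 2) := by
    have := integral_re hi
    unfold momentRe moment
    rw [← RCLike.re_to_complex, ← this]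
    refine setIntegral_congr_fun measurableSet_Ioi fun k hk => ?_
    have hk : 0 < k := hk
    have := hre k
    rw [abs_of_pos hk] at this
    exact this
  have h2 := integral_comp_abs (f := fun k : ℝ => Real.cos (a * k) * Real.exp (-t * k ^ 2))
  have h3 : (∫ k : ℝ, Real.cos (a * |k|) * Real.exp (-t * |k| ^ 2))
      = Real.sqrt (Real.pi / t) * Real.exp (-a ^ 2 / (4 * t)) := by
    have hg := fourierIntegral_gaussian (b := (t : ℂ)) (by simpa using ht) a
    have hgi : Integrable fun k : ℝ => Complex.exp (Complex.I * a * k) * Complex.exp (-(t : ℂ) * k ^ 2) := by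
      have := integrable_cexp_quadratic (b := (t : ℂ)) (by simpa using ht) (Complex.I * a) 0
      refine this.congr (.of_forall fun k => ?_)
      simp only [add_zero]
      rw [← Complex.exp_add]
      ring_nf
    have := integral_re hgi
    rw [RCLike.re_to_complex, hg, show ((Real.pi : ℂ) / t) = ((Real.pi / t : ℝ) : ℂ) by push_cast; rfl,
      show (1 / 2 : ℂ) = ((1 / 2 : ℝ) : ℂ) by push_cast; rfl, ← Complex.ofReal_cpow (by positivity),
      show (-(a : ℂ) ^ 2 / (4 * t)) = ((-a ^ 2 / (4 * t) : ℝ) : ℂ) by push_cast; rfl,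
      ← Complex.ofReal_exp, ← Complex.ofReal_mul, Complex.ofReal_re, ← Real.sqrt_eq_rpow] at this
    rw [← this]
    congr 1
    ext k
    rw [← hre k, RCLike.re_to_complex, pow_zero, one_mul, ← Complex.exp_add]
    congr 2
    push_cast
    ring
  rw [h3] at h2
  rw [h1]
  have h4 : Real.sqrt (Real.pi / t) = 2 * (Real.pi * (Real.sqrt (4 * Real.pi * t))⁻¹) := by
    rw [show Real.pi / t = (2 * Real.pi) ^ 2 / (4 * Real.pi * t) by field_simp; norm_num,
      Real.sqrt_div (by positivity), Real.sqrt_sq (by positivity)]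
    ring
  rw [h4] at h2
  unfold gauss
  linarith

lemma integrable_gauss_mul_poisson {t : ℝ} (ht : 0 < t) (a : ℝ) {s : ℝ} (hs : 0 < s) :
    Integrable fun v => gauss t (a - v) * (s / (v ^ 2 + s ^ 2)) := by
  have h := (integrable_mul_inv_sub (integrable_gauss_comp ht a) hs).re
  simp only [RCLike.re_to_complex, Complex.re_ofReal_mul, re_inv_sub] at h
  exact h

lemma integrable_gaussDeriv_mul_conjPoisson {t : ℝ} (ht : 0 < t) (a : ℝ) {s : ℝ} (hs : 0 < s) :
    Integrable fun v => gaussDeriv t (a - v) * (v / (v ^ 2 + s ^ 2)) := by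
  have h := (integrable_mul_inv_sub (integrable_gaussDeriv_comp ht a) hs).im
  simp only [RCLike.im_to_complex, Complex.im_ofReal_mul, im_inv_sub] at h
  exact h

lemma abs_momentRe_le (n : ℕ) {t : ℝ} (ht : 0 < t) (a : ℝ) {s : ℝ} (hs : 0 ≤ s) :
    |momentRe n t a s| ≤ ‖moment n t 0‖ :=
  (Complex.abs_re_le_norm _).trans (norm_moment_le n ht (by simpa using hs))

lemma integrable_momentRe_mul_poisson {t : ℝ} (ht : 0 < t) (a : ℝ) {s : ℝ} (hs : 0 < s) :
    Integrable fun v => momentRe 1 t (a - v) 0 * (s / (v ^ 2 + s ^ 2)) :=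
  (integrable_poisson hs).bdd_mul (c := ‖moment 1 t 0‖)
    (Continuous.aestronglyMeasurable (by fun_prop (disch := assumption)))
    (.of_forall fun v => abs_momentRe_le 1 ht _ le_rfl)

/-- Here `σ` is the sign of `z₂ - y₂` and `s` its modulus: the first component of the Biot–Savart
kernel is odd in `z₂ - y₂`, whereas the moments live at nonnegative height. -/
lemma integral_curlKernel_mul_bsKernel_zero {t : ℝ} (ht : 0 < t) (x y : ℝ × ℝ) {z₂ s σ : ℝ}
    (hs : 0 < s) (hr : 0 < z₂ + y.2) (hσ : σ ^ 2 = 1) (hd : z₂ - y.2 = σ * s) :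
    ∫ z₁, curlKernel 0 t x (z₁, z₂) * bsKernel 0 (z₁, z₂) y = -(1 / (2 * Real.pi)) *
      ((gaussDeriv t (x.2 + z₂) - gaussDeriv t (x.2 - z₂)) *
        (σ * momentRe 0 t (x.1 - y.1) s - momentRe 0 t (x.1 - y.1) (z₂ + y.2)) -
      2 / Real.pi * gauss t (x.2 + z₂) * (σ * (Real.pi * momentRe 1 t (x.1 - y.1) s) -
        Real.pi * momentRe 1 t (x.1 - y.1) (z₂ + y.2))) := by
  have h : ∀ z₁, curlKernel 0 t x (z₁, z₂) * bsKernel 0 (z₁, z₂) y =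
      (fun v => -(1 / (2 * Real.pi)) * ((gaussDeriv t (x.2 + z₂) - gaussDeriv t (x.2 - z₂)) *
        (σ * (gauss t (x.1 - y.1 - v) * (s / (v ^ 2 + s ^ 2))) -
          gauss t (x.1 - y.1 - v) * ((z₂ + y.2) / (v ^ 2 + (z₂ + y.2) ^ 2))) -
        2 / Real.pi * gauss t (x.2 + z₂) *
        (σ * (momentRe 1 t (x.1 - y.1 - v) 0 * (s / (v ^ 2 + s ^ 2))) -
          momentRe 1 t (x.1 - y.1 - v) 0 * ((z₂ + y.2) / (v ^ 2 + (z₂ + y.2) ^ 2))))) (z₁ - y.1) := by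
    intro z₁
    simp only [curlKernel, bsKernel, if_true, hd, mul_pow, hσ, one_mul, sub_sub_sub_cancel_right]
    ring
  simp_rw [h]
  have i1 := (integrable_gauss_mul_poisson ht (x.1 - y.1) hs).const_mul σ
  have i2 := integrable_gauss_mul_poisson ht (x.1 - y.1) hr
  have i3 := (integrable_momentRe_mul_poisson ht (x.1 - y.1) hs).const_mul σ
  have i4 := integrable_momentRe_mul_poisson ht (x.1 - y.1) hr
  rw [integral_sub_right_eq_self (fun v => -(1 / (2 * Real.pi)) * ((gaussDeriv t (x.2 + z₂) - gaussDeriv t (x.2 - z₂)) *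
        (σ * (gauss t (x.1 - y.1 - v) * (s / (v ^ 2 + s ^ 2))) -
          gauss t (x.1 - y.1 - v) * ((z₂ + y.2) / (v ^ 2 + (z₂ + y.2) ^ 2))) -
        2 / Real.pi * gauss t (x.2 + z₂) *
        (σ * (momentRe 1 t (x.1 - y.1 - v) 0 * (s / (v ^ 2 + s ^ 2))) -
          momentRe 1 t (x.1 - y.1 - v) 0 * ((z₂ + y.2) / (v ^ 2 + (z₂ + y.2) ^ 2))))),
    integral_const_mul, integral_sub, integral_const_mul, integral_const_mul,
    integral_sub i1 i2, integral_sub i3 i4, integral_const_mul, integral_const_mul,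
    integral_gauss_mul_poisson ht _ hs, integral_gauss_mul_poisson ht _ hr,
    integral_momentRe_mul_poisson ht _ hs, integral_momentRe_mul_poisson ht _ hr]
  exacts [(i1.sub i2).const_mul _, (i3.sub i4).const_mul _]

lemma integral_curlKernel_mul_bsKernel_one {t : ℝ} (ht : 0 < t) (x y : ℝ × ℝ) {z₂ s : ℝ}
    (hs : 0 < s) (hr : 0 < z₂ + y.2) (hd : (z₂ - y.2) ^ 2 = s ^ 2) :
    ∫ z₁, curlKernel 1 t x (z₁, z₂) * bsKernel 1 (z₁, z₂) y = 1 / (2 * Real.pi) *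
      (gauss t (x.2 - z₂) - gauss t (x.2 + z₂)) *
        (momentRe 1 t (x.1 - y.1) s - momentRe 1 t (x.1 - y.1) (z₂ + y.2)) := by
  have h : ∀ z₁, curlKernel 1 t x (z₁, z₂) * bsKernel 1 (z₁, z₂) y =
      (fun v => 1 / (2 * Real.pi) * (gauss t (x.2 - z₂) - gauss t (x.2 + z₂)) *
        (gaussDeriv t (x.1 - y.1 - v) * (v / (v ^ 2 + s ^ 2)) -
          gaussDeriv t (x.1 - y.1 - v) * (v / (v ^ 2 + (z₂ + y.2) ^ 2)))) (z₁ - y.1) := by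
    intro z₁
    simp only [curlKernel, bsKernel, if_neg (by decide : ¬(1 : Fin 2) = 0), hd,
      sub_sub_sub_cancel_right]
    ring
  simp_rw [h]
  have i1 := integrable_gaussDeriv_mul_conjPoisson ht (x.1 - y.1) hs
  have i2 := integrable_gaussDeriv_mul_conjPoisson ht (x.1 - y.1) hr
  rw [integral_sub_right_eq_self (fun v => 1 / (2 * Real.pi) *
        (gauss t (x.2 - z₂) - gauss t (x.2 + z₂)) *
        (gaussDeriv t (x.1 - y.1 - v) * (v / (v ^ 2 + s ^ 2)) -
          gaussDeriv t (x.1 - y.1 - v) * (v / (v ^ 2 + (z₂ + y.2) ^ 2)))),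
    integral_const_mul, integral_sub i1 i2, integral_gaussDeriv_mul_conjPoisson ht _ hs,
    integral_gaussDeriv_mul_conjPoisson ht _ hr]

/-- The kernel of the part of the vorticity semigroup which is not of Gaussian type. -/
def remainderKernel (t : ℝ) (x y : ℝ × ℝ) : ℝ :=
  -(2 / Real.pi) * ∫ z in (0 : ℝ)..y.2, gauss t (x.2 + z) * momentRe 1 t (x.1 - y.1) (y.2 - z)

/-- The kernel of the Neumann heat semigroup of the half plane. -/
def neumannKernel (t : ℝ) (x y : ℝ × ℝ) : ℝ :=
  gauss t (x.1 - y.1) * (gauss t (x.2 - y.2) + gauss t (x.2 + y.2))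

lemma integrableOn_curlKernel_mul_bsKernel (i : Fin 2) {t : ℝ} (ht : 0 < t) (x : ℝ × ℝ) :
    ∀ᵐ y ∂((volume : Measure (ℝ × ℝ)).restrict halfPlane),
      IntegrableOn (fun z => curlKernel i t x z * bsKernel i z y) halfPlane := by
  obtain ⟨C, hC⟩ := exists_abs_curlKernel_le i ht x
  -- Taking the positive function `weight` as vorticity gives joint integrability; slicing at almost
  -- every `y` and dividing by `weight y` isolates the kernel.
  have h := integrable_mul_bsKernel integrable_weight.integrableOn i
    (continuous_curlKernel i ht x).measurable hC
  filter_upwards [h.prod_left_ae] with y hy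
  refine (hy.mul_const (weight y)⁻¹).congr (.of_forall fun z => ?_)
  simp only []
  rw [← mul_assoc, mul_assoc _ (weight y), mul_inv_cancel₀ (weight_pos y).ne', mul_one]

/-- After the `z₁`-integration the integrand in `z₂` is, up to the factor `-1/(2π)`, the derivative
of `hp` above `y₂`, and the derivative of `hn` plus `4 Γ₁(x₂ + z) Re M₁` below. The sign change of
the Biot–Savart kernel separates `hp` from `hn`. Their difference at `y₂` gives the Neumann kernel,
`hn 0` the trace term, and the extra term the remainder. -/
lemma integral_curlKernel_eq {t : ℝ} (ht : 0 < t) (x : ℝ × ℝ) {y : ℝ × ℝ} (hy : y ∈ halfPlane)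
    (h₀ : IntegrableOn (fun z => curlKernel 0 t x z * bsKernel 0 z y) halfPlane)
    (h₁ : IntegrableOn (fun z => curlKernel 1 t x z * bsKernel 1 z y) halfPlane) :
    (∫ z in halfPlane, curlKernel 0 t x z * bsKernel 0 z y) +
      ∫ z in halfPlane, curlKernel 1 t x z * bsKernel 1 z y =
    neumannKernel t x y - 2 / Real.pi * gauss t x.2 * momentRe 0 t (x.1 - y.1) y.2
      + remainderKernel t x y := by
  have hy : 0 < y.2 := hy
  set a := x.1 - y.1 with ha
  rw [IntegrableOn, restrict_halfPlane] at h₀ h₁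
  rw [restrict_halfPlane, integral_prod_symm _ h₀, integral_prod_symm _ h₁,
    ← integral_add h₀.integral_prod_right h₁.integral_prod_right]
  have hint := h₀.integral_prod_right.add h₁.integral_prod_right
  set f : ℝ → ℝ := fun z₂ => (∫ z₁, curlKernel 0 t x (z₁, z₂) * bsKernel 0 (z₁, z₂) y) +
    ∫ z₁, curlKernel 1 t x (z₁, z₂) * bsKernel 1 (z₁, z₂) y with hf
  have hint : IntegrableOn f (Ioi 0) := hint
  set b : ℝ → ℝ := fun z => gauss t (x.2 - z) + gauss t (x.2 + z) with hb
  set b' : ℝ → ℝ := fun z => gaussDeriv t (x.2 + z) - gaussDeriv t (x.2 - z) with hb'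
  have db : ∀ z, HasDerivAt b (b' z) z := fun z => by
    have h1 := (hasDerivAt_gauss t (x.2 - z)).comp_const_sub x.2 z
    have h2 := (hasDerivAt_gauss t (x.2 + z)).comp_const_add x.2 z
    exact (h1.add h2).congr_deriv (by rw [hb']; ring)
  set m : ℕ → ℝ → ℝ := fun n s => momentRe n t a s with hm
  have dm : ∀ s, HasDerivAt (m 0) (-(m 1 s)) s := fun s => hasDerivAt_momentRe_snd 0 ht a s
  have cm : ∀ n, Continuous (m n) := fun n => by
    simp only [hm]; fun_prop (disch := assumption)
  have cb' : Continuous b' := by fun_prop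
  have cb : Continuous b := by fun_prop
  set hp : ℝ → ℝ := fun z => b z * (m 0 (z - y.2) - m 0 (z + y.2)) with hhp
  set hp' : ℝ → ℝ := fun z => b' z * (m 0 (z - y.2) - m 0 (z + y.2)) +
    b z * (-(m 1 (z - y.2)) - -(m 1 (z + y.2))) with hhp'
  set hn : ℝ → ℝ := fun z => b z * (-m 0 (y.2 - z) - m 0 (z + y.2)) with hhn
  set hn' : ℝ → ℝ := fun z => b' z * (-m 0 (y.2 - z) - m 0 (z + y.2)) +
    b z * (-(m 1 (y.2 - z)) - -(m 1 (z + y.2))) with hhn'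
  have dhp : ∀ z, HasDerivAt hp (hp' z) z := fun z =>
    (db z).mul (((dm _).comp_sub_const z y.2).sub ((dm _).comp_add_const z y.2))
  have dhn : ∀ z, HasDerivAt hn (hn' z) z := fun z =>
    ((db z).mul ((((dm _).comp_const_sub y.2 z).neg).sub ((dm _).comp_add_const z y.2))).congr_deriv
      (by simp only [hhn', Pi.neg_apply, Pi.sub_apply]; ring)
  have fgt : ∀ z ∈ Ioi y.2, f z = -(1 / (2 * Real.pi)) * hp' z := by
    intro z hz
    have hz : y.2 < z := hz
    simp only [hf]
    rw [integral_curlKernel_mul_bsKernel_zero ht x y (s := z - y.2) (σ := 1) (sub_pos.2 hz)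
      (by linarith) (by norm_num) (by ring), integral_curlKernel_mul_bsKernel_one ht x y
      (s := z - y.2) (sub_pos.2 hz) (by linarith) rfl]
    simp only [hhp', hb, hb', hm, ← ha]
    field_simp
    ring
  have flt : ∀ z ∈ Ioo 0 y.2, f z = -(1 / (2 * Real.pi)) *
      (hn' z + 4 * (gauss t (x.2 + z) * m 1 (y.2 - z))) := by
    intro z hz
    simp only [hf]
    rw [integral_curlKernel_mul_bsKernel_zero ht x y (s := y.2 - z) (σ := -1) (sub_pos.2 hz.2)
      (by linarith [hz.1]) (by norm_num) (by ring), integral_curlKernel_mul_bsKernel_one ht x y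
      (s := y.2 - z) (sub_pos.2 hz.2) (by linarith [hz.1]) (by ring)]
    simp only [hhn', hb, hb', hm, ← ha]
    field_simp
    ring
  -- The Gaussian factors decay while `Re M₀` stays bounded, so infinity contributes nothing.
  have hlim : Tendsto hp atTop (𝓝 0) := by
    obtain ⟨A, hA, hAb⟩ := exists_kernel_bounds ht |x.2|
    have h1 : Tendsto (fun z : ℝ => (A + A) * (1 + z ^ 2)⁻¹ * (‖moment 0 t 0‖ + ‖moment 0 t 0‖))
        atTop (𝓝 0) := by
      have : Tendsto (fun z : ℝ => (1 + z ^ 2)⁻¹) atTop (𝓝 0) :=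
        tendsto_inv_atTop_zero.comp
          (tendsto_atTop_add_const_left _ _ (tendsto_pow_atTop two_ne_zero))
      simpa using (this.const_mul (A + A)).mul_const (‖moment 0 t 0‖ + ‖moment 0 t 0‖)
    refine squeeze_zero_norm' ?_ h1
    filter_upwards [eventually_ge_atTop y.2] with z hz
    obtain ⟨k1, k2, -⟩ := hAb x.2 z le_rfl
    rw [norm_mul, Real.norm_eq_abs, Real.norm_eq_abs]
    refine mul_le_mul ((abs_add_le _ _).trans ?_) ((abs_sub _ _).trans (add_le_add ?_ ?_))
      (abs_nonneg _) (by positivity)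
    · linarith
    · exact abs_momentRe_le 0 ht _ (sub_nonneg.2 hz)
    · exact abs_momentRe_le 0 ht _ (by linarith)
  have hsub : Ioi y.2 ⊆ Ioi 0 := Ioi_subset_Ioi hy.le
  have hpi : IntegrableOn hp' (Ioi y.2) := by
    have := ((hint.mono_set hsub).congr_fun fgt measurableSet_Ioi).const_mul (-(2 * Real.pi))
    refine this.congr (.of_forall fun z => ?_)
    simp only []
    field_simp
  have v1 : ∫ z in Ioi y.2, f z = -(1 / (2 * Real.pi)) * (0 - hp y.2) := by
    rw [setIntegral_congr_fun measurableSet_Ioi fgt, integral_const_mul,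
      integral_Ioi_of_hasDerivAt_of_tendsto' (fun z _ => dhp z) hpi hlim]
  have v2 : ∫ z in Ioc 0 y.2, f z = -(1 / (2 * Real.pi)) *
      (hn y.2 - hn 0 + 4 * ∫ z in (0 : ℝ)..y.2, gauss t (x.2 + z) * m 1 (y.2 - z)) := by
    rw [integral_Ioc_eq_integral_Ioo, setIntegral_congr_fun measurableSet_Ioo flt,
      ← integral_Ioc_eq_integral_Ioo, ← intervalIntegral.integral_of_le hy.le,
      intervalIntegral.integral_const_mul, intervalIntegral.integral_add,
      intervalIntegral.integral_const_mul,
      intervalIntegral.integral_eq_sub_of_hasDerivAt (fun z _ => dhn z)]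
    · exact Continuous.intervalIntegrable (by fun_prop) _ _
    · exact Continuous.intervalIntegrable (by fun_prop) _ _
    · exact Continuous.intervalIntegrable (by fun_prop) _ _
  rw [← Ioc_union_Ioi_eq_Ioi hy.le, setIntegral_union (Ioc_disjoint_Ioi le_rfl) measurableSet_Ioi
    (hint.mono_set Ioc_subset_Ioi_self) (hint.mono_set hsub), v1, v2]
  have m00 : m 0 0 = Real.pi * gauss t a := momentRe_zero_zero ht a
  simp only [hhp, hhn, sub_self, m00, hb, neumannKernel, remainderKernel, sub_zero, add_zero, zero_add,
    ← ha]
  change _ = _ - 2 / Real.pi * gauss t x.2 * m 0 y.2 + -(2 / Real.pi) * ∫ z in (0 : ℝ)..y.2, gauss t (x.2 + z) * m 1 (y.2 - z)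
  field_simp
  ring

/-! ### Vanishing of the trace term -/

lemma gauss_le {t : ℝ} (r : ℝ) : gauss t r ≤ gauss t 0 := by
  by_cases ht : 0 ≤ t
  · unfold gauss
    refine mul_le_mul_of_nonneg_left (Real.exp_le_exp.2 ?_) (by positivity)
    refine div_le_div_of_nonneg_right ?_ (by positivity)
    nlinarith [sq_nonneg r]
  · have : Real.sqrt (4 * Real.pi * t) = 0 :=
      Real.sqrt_eq_zero_of_nonpos (by nlinarith [Real.pi_pos])
    simp [gauss, this]

lemma integrable_trace_kernel {t : ℝ} (ht : 0 < t) {ω : ℝ × ℝ → ℝ} (hω : IntegrableOn ω halfPlane)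
    (x₁ : ℝ) : IntegrableOn (fun y => momentRe 0 t (x₁ - y.1) y.2 * ω y) halfPlane := by
  refine hω.bdd_mul (c := ‖moment 0 t 0‖)
    (Continuous.aestronglyMeasurable (by fun_prop (disch := assumption))) ?_
  filter_upwards [ae_restrict_halfPlane] with y hy
  exact abs_momentRe_le 0 ht _ hy.le

/-- The kernel is the Gaussian convolved with `y₂/(v² + y₂²)`, which is `π` times the tangential
Biot–Savart kernel at the boundary. Exchanging the integrals leaves `π` times the Gaussian average
of the trace. -/
lemma integral_trace_kernel_eq_zero {t : ℝ} (ht : 0 < t) {ω : ℝ × ℝ → ℝ}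
    (hω : IntegrableOn ω halfPlane) (htrace : ∀ᵐ v : ℝ, K ω 0 (v, 0) = 0) (x₁ : ℝ) :
    ∫ y in halfPlane, momentRe 0 t (x₁ - y.1) y.2 * ω y = 0 := by
  have hval : ∀ y : ℝ × ℝ, y ∈ halfPlane →
      ∫ v : ℝ, gauss t (x₁ - v) * (y.2 / ((v - y.1) ^ 2 + y.2 ^ 2)) = momentRe 0 t (x₁ - y.1) y.2 := by
    intro y hy
    rw [← integral_gauss_mul_poisson ht _ hy,
      ← integral_sub_right_eq_self (fun v => gauss t (x₁ - y.1 - v) * (y.2 / (v ^ 2 + y.2 ^ 2))) y.1]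
    congr 1
    ext v
    rw [sub_sub_sub_cancel_right]
  have hint : ∀ y : ℝ × ℝ, y ∈ halfPlane →
      Integrable fun v : ℝ => gauss t (x₁ - v) * (y.2 / ((v - y.1) ^ 2 + y.2 ^ 2)) := by
    intro y hy
    have := (integrable_gauss_mul_poisson ht (x₁ - y.1) hy).comp_sub_right y.1
    simpa only [sub_sub_sub_cancel_right] using this
  have hF : Integrable (Function.uncurry fun (v : ℝ) (y : ℝ × ℝ) =>
      gauss t (x₁ - v) * (y.2 / ((v - y.1) ^ 2 + y.2 ^ 2)) * ω y)
      (volume.prod (volume.restrict halfPlane)) := by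
    have hm : Measurable fun p : ℝ × (ℝ × ℝ) =>
        gauss t (x₁ - p.1) * (p.2.2 / ((p.1 - p.2.1) ^ 2 + p.2.2 ^ 2)) := by
      have : Measurable fun p : ℝ × (ℝ × ℝ) => gauss t (x₁ - p.1) :=
        (by fun_prop : Continuous fun p : ℝ × (ℝ × ℝ) => gauss t (x₁ - p.1)).measurable
      fun_prop
    have hFm : AEStronglyMeasurable (Function.uncurry fun (v : ℝ) (y : ℝ × ℝ) =>
        gauss t (x₁ - v) * (y.2 / ((v - y.1) ^ 2 + y.2 ^ 2)) * ω y)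
        (volume.prod (volume.restrict halfPlane)) :=
      hm.aestronglyMeasurable.mul hω.1.comp_snd
    refine (integrable_prod_iff' hFm).2 ⟨?_, ?_⟩
    · filter_upwards [ae_restrict_halfPlane] with y hy
      exact (hint y hy).mul_const (ω y)
    · refine (integrable_trace_kernel ht hω x₁).norm.congr ?_
      filter_upwards [ae_restrict_halfPlane] with y hy
      have hk : ∀ v, 0 ≤ gauss t (x₁ - v) * (y.2 / ((v - y.1) ^ 2 + y.2 ^ 2)) := fun v => by
        have := gauss_nonneg t (x₁ - v)
        positivity
      rw [← hval y hy, norm_mul, Real.norm_of_nonneg (integral_nonneg hk), ← integral_mul_const]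
      congr 1
      ext v
      rw [Function.uncurry_apply_pair, norm_mul, Real.norm_of_nonneg (hk v)]
  have hswap := integral_integral_swap hF
  have hL : ∫ v : ℝ, ∫ y in halfPlane, gauss t (x₁ - v) * (y.2 / ((v - y.1) ^ 2 + y.2 ^ 2)) * ω y = 0 := by
    rw [← integral_zero ℝ ℝ (μ := volume)]
    refine integral_congr_ae ?_
    filter_upwards [htrace] with v hv
    rw [K_eq ω 0 le_rfl] at hv
    have : ∀ y, gauss t (x₁ - v) * (y.2 / ((v - y.1) ^ 2 + y.2 ^ 2)) * ω y
        = (Real.pi * gauss t (x₁ - v)) * (bsKernel 0 (v, 0) y * ω y) := by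
      intro y
      simp only [bsKernel, if_true, zero_sub, zero_add, neg_sq]
      field_simp
      ring
    simp_rw [this]
    rw [integral_const_mul, hv, mul_zero]
  rw [hL] at hswap
  rw [hswap]
  refine setIntegral_congr_fun measurableSet_halfPlane fun y hy => ?_
  simp only [integral_mul_const]
  rw [hval y hy]

lemma continuous_remainderKernel {t : ℝ} (ht : 0 < t) :
    Continuous fun p : (ℝ × ℝ) × (ℝ × ℝ) => remainderKernel t p.1 p.2 := by
  unfold remainderKernel
  refine continuous_const.mul
    (intervalIntegral.continuous_parametric_intervalIntegral_of_continuous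
      (f := fun (p : (ℝ × ℝ) × (ℝ × ℝ)) z =>
        gauss t (p.1.2 + z) * momentRe 1 t (p.1.1 - p.2.1) (p.2.2 - z)) ?_ (by fun_prop))
  simp only [Function.uncurry_def]
  fun_prop (disch := assumption)

lemma continuous_neumannKernel (t : ℝ) :
    Continuous fun p : (ℝ × ℝ) × (ℝ × ℝ) => neumannKernel t p.1 p.2 := by
  unfold neumannKernel
  fun_prop

lemma integrable_neumannKernel_mul {ω : ℝ × ℝ → ℝ}
    (hω : IntegrableOn ω halfPlane) (t : ℝ) (x : ℝ × ℝ) :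
    IntegrableOn (fun y => neumannKernel t x y * ω y) halfPlane := by
  refine hω.bdd_mul (c := gauss t 0 * (gauss t 0 + gauss t 0))
    (((continuous_neumannKernel t).comp (Continuous.prodMk_right x)).aestronglyMeasurable)
    (.of_forall fun y => ?_)
  have h := gauss_nonneg t
  unfold neumannKernel
  rw [Real.norm_of_nonneg (mul_nonneg (h _) (add_nonneg (h _) (h _)))]
  exact mul_le_mul (gauss_le _) (add_le_add (gauss_le _) (gauss_le _)) (add_nonneg (h _) (h _)) (h _)

lemma T_eq_add {t : ℝ} (ht : 0 < t) {ω : ℝ × ℝ → ℝ} (hω : IntegrableOn ω halfPlane)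
    (htrace : ∀ᵐ v : ℝ, K ω 0 (v, 0) = 0) {x : ℝ × ℝ} (hx : x ∈ halfPlane) :
    T t ω x = (∫ y in halfPlane, neumannKernel t x y * ω y) +
      ∫ y in halfPlane, remainderKernel t x y * ω y := by
  have hint : ∀ i, IntegrableOn (fun y => (∫ z in halfPlane, curlKernel i t x z * bsKernel i z y) * ω y)
      halfPlane := by
    intro i
    obtain ⟨C, hC⟩ := exists_abs_curlKernel_le i ht x
    have := (integrable_mul_bsKernel hω i (continuous_curlKernel i ht x).measurable hC).integral_prod_right
    refine this.congr (.of_forall fun y => ?_)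
    simp only []
    rw [← integral_mul_const]
    congr 1
    ext z
    ring
  have hsum : ∀ᵐ y ∂((volume : Measure (ℝ × ℝ)).restrict halfPlane),
      (∫ z in halfPlane, curlKernel 0 t x z * bsKernel 0 z y) * ω y +
      (∫ z in halfPlane, curlKernel 1 t x z * bsKernel 1 z y) * ω y =
      neumannKernel t x y * ω y - 2 / Real.pi * gauss t x.2 * (momentRe 0 t (x.1 - y.1) y.2 * ω y)
      + remainderKernel t x y * ω y := by
    filter_upwards [integrableOn_curlKernel_mul_bsKernel 0 ht x,
      integrableOn_curlKernel_mul_bsKernel 1 ht x, ae_restrict_halfPlane] with y h0 h1 hy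
    rw [← add_mul, integral_curlKernel_eq ht x hy h0 h1]
    ring
  have i1 := integrable_neumannKernel_mul hω t x
  have i2 := (integrable_trace_kernel ht hω x.1).const_mul (2 / Real.pi * gauss t x.2)
  -- The other terms of the kernel identity are integrable against `ω`, hence so is the remainder.
  have i3 : IntegrableOn (fun y => remainderKernel t x y * ω y) halfPlane := by
    refine ((((hint 0).add (hint 1)).sub i1).add i2).congr ?_
    filter_upwards [hsum] with y hy
    simp only [Pi.add_apply, Pi.sub_apply]
    linarith
  rw [T_eq ht hω hx]
  obtain ⟨C₀, hC₀⟩ := exists_abs_curlKernel_le 0 ht x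
  obtain ⟨C₁, hC₁⟩ := exists_abs_curlKernel_le 1 ht x
  rw [integral_mul_K hω 0 (continuous_curlKernel 0 ht x).measurable hC₀,
    integral_mul_K hω 1 (continuous_curlKernel 1 ht x).measurable hC₁,
    ← integral_add (hint 0) (hint 1), integral_congr_ae hsum, integral_add, integral_sub i1 i2,
    integral_const_mul, integral_trace_kernel_eq_zero ht hω htrace, mul_zero, sub_zero]
  exacts [i1.sub i2, i3]

/-! ### The remainder in `L¹` -/

lemma enorm_remainderKernel_le {t : ℝ} (ht : 0 < t) {x y : ℝ × ℝ} (hx : x ∈ halfPlane)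
    (hy : y ∈ halfPlane) :
    ‖remainderKernel t x y‖ₑ ≤ ∫⁻ z in Ioc 0 y.2,
      ENNReal.ofReal (7 / (t + (x.1 - y.1) ^ 2 + (y.2 - z) ^ 2)) *
        (ENNReal.ofReal (gauss t x.2) *
          ENNReal.ofReal (2 / Real.pi * Real.exp (-z ^ 2 / (4 * t)))) := by
  have hy : 0 < y.2 := hy
  have hx : 0 < x.2 := hx
  unfold remainderKernel
  rw [intervalIntegral.integral_of_le hy.le, ← integral_const_mul]
  refine (enorm_integral_le_lintegral_enorm _).trans (setLIntegral_mono' measurableSet_Ioc fun z hz => ?_)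
  have hg := gauss_nonneg t x.2
  rw [← ENNReal.ofReal_mul (by positivity), ← ENNReal.ofReal_mul (by positivity), ← ofReal_norm]
  refine ENNReal.ofReal_le_ofReal ?_
  rw [norm_mul, norm_mul, norm_neg, Real.norm_of_nonneg (by positivity : 0 ≤ 2 / Real.pi),
    Real.norm_of_nonneg (gauss_nonneg _ _), Real.norm_eq_abs]
  calc 2 / Real.pi * (gauss t (x.2 + z) * |momentRe 1 t (x.1 - y.1) (y.2 - z)|)
      ≤ 2 / Real.pi * ((gauss t x.2 * Real.exp (-z ^ 2 / (4 * t))) *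
        (7 / (t + (x.1 - y.1) ^ 2 + (y.2 - z) ^ 2))) := by
        gcongr
        · exact gauss_add_le ht hx.le hz.1.le
        · exact abs_momentRe_one_le ht _ (sub_nonneg.2 hz.2)
    _ = _ := by ring

lemma lintegral_lorentz_le {q : ℝ} (hq : 0 < q) (c : ℝ) :
    ∫⁻ v : ℝ, ENNReal.ofReal (7 / (q + (v - c) ^ 2)) = ENNReal.ofReal (7 * Real.pi / Real.sqrt q) := by
  have hs : 0 < Real.sqrt q := Real.sqrt_pos.2 hq
  have hi := ((integrable_poisson hs).comp_sub_right c).const_mul (7 / Real.sqrt q)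
  have he : ∀ v : ℝ, 7 / (q + (v - c) ^ 2)
      = 7 / Real.sqrt q * (Real.sqrt q / ((v - c) ^ 2 + Real.sqrt q ^ 2)) := by
    intro v
    rw [Real.sq_sqrt hq.le]
    field_simp
    ring
  simp_rw [he]
  rw [← ofReal_integral_eq_lintegral_ofReal hi (.of_forall fun v => by positivity),
    integral_const_mul, integral_sub_right_eq_self (fun v => Real.sqrt q / (v ^ 2 + Real.sqrt q ^ 2)),
    integral_poisson hs]
  congr 1
  ring

lemma lintegral_gauss_le {t : ℝ} (ht : 0 < t) :
    ∫⁻ r in Ioi (0 : ℝ), ENNReal.ofReal (gauss t r) ≤ 1 := by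
  refine (setLIntegral_le_lintegral _ _).trans ?_
  rw [← ofReal_integral_eq_lintegral_ofReal (integrable_gauss ht) (.of_forall (gauss_nonneg t)),
    integral_gauss ht, ENNReal.ofReal_one]

/-- The pointwise bound factors in `x₁` and `x₂`: the Lorentz function gives `7π / √(t + (y₂ - z)²)`
and the Gaussian at most `1`. With the prefactor `2/π` this makes `14`. -/
lemma lintegral_remainderKernel_le {t : ℝ} (ht : 0 < t) {y : ℝ × ℝ} (hy : y ∈ halfPlane) :
    ∫⁻ x in halfPlane, ‖remainderKernel t x y‖ₑ ≤ ∫⁻ z in Ioc 0 y.2,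
      ENNReal.ofReal (14 * Real.exp (-z ^ 2 / (4 * t)) / Real.sqrt (t + (y.2 - z) ^ 2)) := by
  refine (setLIntegral_mono' measurableSet_halfPlane
    fun x hx => enorm_remainderKernel_le ht hx hy).trans ?_
  have hmg : Measurable (gauss t) := (continuous_gauss t).measurable
  rw [lintegral_lintegral_swap (Measurable.aemeasurable (by
    simp only [Function.uncurry_def]; fun_prop))]
  refine lintegral_mono fun z => ?_
  rw [restrict_halfPlane]
  have hq : 0 < t + (y.2 - z) ^ 2 := by positivity
  have he : ∀ x : ℝ × ℝ, t + (x.1 - y.1) ^ 2 + (y.2 - z) ^ 2 = (t + (y.2 - z) ^ 2) + (x.1 - y.1) ^ 2 :=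
    fun x => by ring
  simp_rw [he]
  rw [lintegral_prod_mul (f := fun v : ℝ => ENNReal.ofReal (7 / ((t + (y.2 - z) ^ 2) + (v - y.1) ^ 2)))
    (g := fun r : ℝ => ENNReal.ofReal (gauss t r) *
          ENNReal.ofReal (2 / Real.pi * Real.exp (-z ^ 2 / (4 * t)))) (by fun_prop) (by fun_prop),
    lintegral_lorentz_le hq, lintegral_mul_const _ (by fun_prop)]
  calc _ ≤ ENNReal.ofReal (7 * Real.pi / Real.sqrt (t + (y.2 - z) ^ 2)) *
        (1 * ENNReal.ofReal (2 / Real.pi * Real.exp (-z ^ 2 / (4 * t)))) := by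
        gcongr
        exact lintegral_gauss_le ht
    _ = _ := by
        rw [one_mul, ← ENNReal.ofReal_mul (by positivity)]
        congr 1
        field_simp
        ring

/-- Let `q = √(t + (y₂ - z)²)`. From `q ≥ √t` and `q ≥ y₂ - z` follows `1/q ≤ min(1, √t/y₂) (1 +
z/√t) / √t`. The factor growing in `z` is absorbed by the Gaussian, and `z = √t u` makes the
integral independent of `t`. -/
lemma exists_lintegral_remainderKernel_le : ∃ C : ℝ, 0 ≤ C ∧ ∀ t : ℝ, 0 < t → ∀ y ∈ halfPlane,
    ∫⁻ x in halfPlane, ‖remainderKernel t x y‖ₑ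
      ≤ ENNReal.ofReal (C * min 1 (Real.sqrt t / y.2)) := by
  -- This is `(1 + u) e^{-u²/4}`, the profile left after scaling out `t`.
  set ψ : ℝ → ℝ := fun u => Real.exp (-(1 / 4) * u ^ 2) + u * Real.exp (-(1 / 4) * u ^ 2) with hψ
  have hψi : IntegrableOn ψ (Ioi 0) :=
    ((integrable_exp_neg_mul_sq (by norm_num)).add
      (integrable_mul_exp_neg_mul_sq (by norm_num))).integrableOn
  have hψ0 : ∀ u ∈ Ioi (0 : ℝ), 0 ≤ ψ u := fun u hu => by
    have hu : 0 < u := hu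
    simp only [hψ]; positivity
  refine ⟨14 * ∫ u in Ioi 0, ψ u, mul_nonneg (by norm_num) (setIntegral_nonneg measurableSet_Ioi hψ0),
    fun t ht y hy => ?_⟩
  have hy : 0 < y.2 := hy
  have hst : 0 < Real.sqrt t := Real.sqrt_pos.2 ht
  set m := min 1 (Real.sqrt t / y.2) with hm
  have hm0 : 0 < m := lt_min one_pos (by positivity)
  have key : ∀ z ∈ Ioc 0 y.2, 14 * Real.exp (-z ^ 2 / (4 * t)) / Real.sqrt (t + (y.2 - z) ^ 2)
      ≤ 14 * m / Real.sqrt t * ψ ((Real.sqrt t)⁻¹ * z) := by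
    intro z hz
    have hψz : ψ ((Real.sqrt t)⁻¹ * z) = Real.exp (-z ^ 2 / (4 * t)) * (1 + z / Real.sqrt t) := by
      have : -(1 / 4) * ((Real.sqrt t)⁻¹ * z) ^ 2 = -z ^ 2 / (4 * t) := by
        rw [mul_pow, inv_pow, Real.sq_sqrt ht.le]; field_simp
      simp only [hψ, this]
      ring
    have hq1 : Real.sqrt t ≤ Real.sqrt (t + (y.2 - z) ^ 2) :=
      Real.sqrt_le_sqrt (by nlinarith [sq_nonneg (y.2 - z)])
    have hq2 : y.2 - z ≤ Real.sqrt (t + (y.2 - z) ^ 2) :=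
      Real.le_sqrt_of_sq_le (by linarith)
    set q := Real.sqrt (t + (y.2 - z) ^ 2) with hq
    have hz0 := hz.1
    have hqpos : 0 < q := hst.trans_le hq1
    have main : 1 / q ≤ m / Real.sqrt t * (1 + z / Real.sqrt t) := by
      have h1 : 1 ≤ q / Real.sqrt t * (1 + z / Real.sqrt t) := by
        have a1 : 1 ≤ q / Real.sqrt t := (one_le_div hst).2 hq1
        have a2 : 0 ≤ z / Real.sqrt t := by positivity
        nlinarith
      -- Write `y₂ = (y₂ - z) + z`, bounding the first summand by `q` and the second by `q z / √t`.
      have h2 : y.2 ≤ q * (1 + z / Real.sqrt t) := by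
        have : z ≤ q * (z / Real.sqrt t) := by
          rw [mul_div_assoc', le_div_iff₀ hst]; nlinarith
        linarith
      rw [div_le_iff₀ hqpos]
      rcases min_choice 1 (Real.sqrt t / y.2) with h | h <;> rw [hm, h]
      · calc (1 : ℝ) ≤ _ := h1
          _ = _ := by ring
      · calc (1 : ℝ) = y.2 / y.2 := (div_self hy.ne').symm
          _ ≤ q * (1 + z / Real.sqrt t) / y.2 := by gcongr
          _ = _ := by field_simp
    rw [hψz]
    calc 14 * Real.exp (-z ^ 2 / (4 * t)) / q = 14 * Real.exp (-z ^ 2 / (4 * t)) * (1 / q) := by ring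
      _ ≤ 14 * Real.exp (-z ^ 2 / (4 * t)) * (m / Real.sqrt t * (1 + z / Real.sqrt t)) := by gcongr
      _ = _ := by ring
  have hsc : ∫ z in Ioi 0, ψ ((Real.sqrt t)⁻¹ * z) = Real.sqrt t * ∫ u in Ioi 0, ψ u := by
    rw [integral_comp_mul_left_Ioi ψ 0 (inv_pos.2 hst), mul_zero, inv_inv, smul_eq_mul]
  have hsi : IntegrableOn (fun z => ψ ((Real.sqrt t)⁻¹ * z)) (Ioi 0) := by
    rw [integrableOn_Ioi_comp_mul_left_iff ψ 0 (inv_pos.2 hst), mul_zero]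
    exact hψi
  refine (lintegral_remainderKernel_le ht hy).trans ?_
  calc _ ≤ ∫⁻ z in Ioc 0 y.2, ENNReal.ofReal (14 * m / Real.sqrt t * ψ ((Real.sqrt t)⁻¹ * z)) :=
        setLIntegral_mono' measurableSet_Ioc fun z hz => ENNReal.ofReal_le_ofReal (key z hz)
    _ ≤ ∫⁻ z in Ioi 0, ENNReal.ofReal (14 * m / Real.sqrt t * ψ ((Real.sqrt t)⁻¹ * z)) :=
        lintegral_mono_set Ioc_subset_Ioi_self
    _ = ENNReal.ofReal (∫ z in Ioi 0, 14 * m / Real.sqrt t * ψ ((Real.sqrt t)⁻¹ * z)) := by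
        refine (ofReal_integral_eq_lintegral_ofReal (hsi.const_mul _) ?_).symm
        filter_upwards [ae_restrict_mem measurableSet_Ioi] with z hz
        have hz : 0 < z := hz
        exact mul_nonneg (by positivity) (hψ0 _ (mul_pos (inv_pos.2 hst) hz))
    _ = _ := by
        rw [integral_const_mul, hsc]
        congr 1
        field_simp

lemma exists_lintegral_remainder_le {ω : ℝ × ℝ → ℝ} (hω : IntegrableOn ω halfPlane) :
    ∃ C : ℝ, 0 ≤ C ∧ ∀ t : ℝ, 0 < t →
      ∫⁻ x in halfPlane, ‖∫ y in halfPlane, remainderKernel t x y * ω y‖ₑ ≤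
        ∫⁻ y in halfPlane, ENNReal.ofReal (C * min 1 (Real.sqrt t / y.2)) * ‖ω y‖ₑ := by
  obtain ⟨C, hC0, hC⟩ := exists_lintegral_remainderKernel_le
  refine ⟨C, hC0, fun t ht => ?_⟩
  have hm : AEStronglyMeasurable (fun p : (ℝ × ℝ) × (ℝ × ℝ) => remainderKernel t p.1 p.2 * ω p.2)
      ((volume.restrict halfPlane).prod (volume.restrict halfPlane)) :=
    (continuous_remainderKernel ht).aestronglyMeasurable.mul hω.1.comp_snd
  calc _ ≤ ∫⁻ x in halfPlane, ∫⁻ y in halfPlane, ‖remainderKernel t x y * ω y‖ₑ :=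
        lintegral_mono fun x => enorm_integral_le_lintegral_enorm _
    _ = ∫⁻ y in halfPlane, ∫⁻ x in halfPlane, ‖remainderKernel t x y * ω y‖ₑ :=
        lintegral_lintegral_swap hm.enorm
    _ ≤ _ := by
        refine setLIntegral_mono_ae' measurableSet_halfPlane (.of_forall fun y hy => ?_)
        have hmk : Measurable fun x => ‖remainderKernel t x y‖ₑ :=
          ((continuous_remainderKernel ht).comp (Continuous.prodMk_left y)).enorm.measurable
        simp_rw [enorm_mul]
        rw [lintegral_mul_const _ hmk]
        gcongr
        exact hC t ht y hy

lemma lintegral_remainder_ne_top {ω : ℝ × ℝ → ℝ} (hω : IntegrableOn ω halfPlane) {t : ℝ}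
    (ht : 0 < t) :
    ∫⁻ x in halfPlane, ‖∫ y in halfPlane, remainderKernel t x y * ω y‖ₑ < ⊤ := by
  obtain ⟨C, hC0, hC⟩ := exists_lintegral_remainder_le hω
  refine (hC t ht).trans_lt ?_
  calc _ ≤ ∫⁻ y in halfPlane, ENNReal.ofReal C * ‖ω y‖ₑ := by
        gcongr with y
        exact mul_le_of_le_one_right hC0 (min_le_left _ _)
    _ = ENNReal.ofReal C * ∫⁻ y in halfPlane, ‖ω y‖ₑ := lintegral_const_mul'' _ hω.1.enorm
    _ < ⊤ := ENNReal.mul_lt_top ENNReal.ofReal_lt_top hω.2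

lemma tendsto_lintegral_remainder {ω : ℝ × ℝ → ℝ} (hω : IntegrableOn ω halfPlane) :
    Tendsto (fun t => ∫⁻ x in halfPlane, ‖∫ y in halfPlane, remainderKernel t x y * ω y‖ₑ)
      (𝓝[>] 0) (𝓝 0) := by
  obtain ⟨C, hC0, hC⟩ := exists_lintegral_remainder_le hω
  have h := tendsto_lintegral_filter_of_dominated_convergence' (μ := volume.restrict halfPlane)
    (l := 𝓝[>] (0 : ℝ)) (F := fun t y => ENNReal.ofReal (C * min 1 (Real.sqrt t / y.2)) * ‖ω y‖ₑ)
    (f := fun _ => 0) (fun y => ENNReal.ofReal C * ‖ω y‖ₑ)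
    (.of_forall fun t => (Measurable.aemeasurable (by fun_prop)).mul hω.1.enorm)
    (.of_forall fun t => .of_forall fun y => by
      gcongr
      exact mul_le_of_le_one_right hC0 (min_le_left _ _))
    (by
      rw [lintegral_const_mul'' _ hω.1.enorm]
      exact (ENNReal.mul_lt_top ENNReal.ofReal_lt_top hω.2).ne)
    (by
      have hfin : ∀ᵐ y ∂((volume : Measure (ℝ × ℝ)).restrict halfPlane), ‖ω y‖ₑ ≠ ⊤ :=
        .of_forall fun y => enorm_ne_top
      filter_upwards [hfin] with y hy
      have h1 : Tendsto (fun t => C * min 1 (Real.sqrt t / y.2)) (𝓝[>] 0) (𝓝 0) := by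
        have : Continuous fun t => C * min 1 (Real.sqrt t / y.2) := by fun_prop
        have h2 := (this.tendsto 0).mono_left (nhdsWithin_le_nhds (s := Ioi 0))
        simpa using h2
      have h3 := ENNReal.Tendsto.mul_const (b := ‖ω y‖ₑ) (ENNReal.tendsto_ofReal h1) (Or.inr hy)
      simpa using h3)
  rw [lintegral_zero] at h
  refine tendsto_of_tendsto_of_tendsto_of_le_of_le' tendsto_const_nhds h (.of_forall fun _ => zero_le) ?_
  filter_upwards [self_mem_nhdsWithin] with t ht
  exact hC t ht

/-! ### Strong continuity of the heat flow in `L¹` -/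

/-- The `L¹` modulus of continuity of `f` at the translation `v`. -/
def translationModulus (f : ℝ × ℝ → ℝ) (v : ℝ × ℝ) : ENNReal := ∫⁻ x, ‖f (x - v) - f x‖ₑ

lemma translationModulus_le {f : ℝ × ℝ → ℝ} (hf : Integrable f) (v : ℝ × ℝ) :
    translationModulus f v ≤ 2 * ∫⁻ x, ‖f x‖ₑ := by
  calc _ ≤ ∫⁻ x, (‖f (x - v)‖ₑ + ‖f x‖ₑ) := lintegral_mono fun x => enorm_sub_le
    _ = (∫⁻ x, ‖f (x - v)‖ₑ) + ∫⁻ x, ‖f x‖ₑ := lintegral_add_right' _ hf.1.enorm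
    _ = _ := by rw [lintegral_sub_right_eq_self (fun x => ‖f x‖ₑ) v, two_mul]

lemma tendsto_translationModulus {f : ℝ × ℝ → ℝ} (hf : Integrable f) :
    Tendsto (translationModulus f) (𝓝 0) (𝓝 0) := by
  have hf1 : MemLp f 1 := memLp_one_iff_integrable.2 hf
  -- Translations form a continuous family of measure-preserving maps for the compact-open topology,
  -- and composition with such a family is continuous in `L¹`.
  let g : ℝ × ℝ → C(ℝ × ℝ, ℝ × ℝ) := ContinuousMap.curry ⟨fun p => p.2 - p.1, by fun_prop⟩
  have hg : Tendsto g (𝓝 0) (𝓝 (g 0)) := (map_continuous (ContinuousMap.curry ⟨fun p : (ℝ × ℝ) × (ℝ × ℝ) => p.2 - p.1, by fun_prop⟩)).tendsto 0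
  have hgm : ∀ v, MeasurePreserving (g v) volume volume := fun v =>
    measurePreserving_sub_right volume v
  have h := (tendsto_const_nhds (x := hf1.toLp f)).compMeasurePreservingLp hg hgm (hgm 0)
    ENNReal.one_ne_top
  have h2 := tendsto_iff_edist_tendsto_0.1 h
  refine h2.congr fun v => ?_
  rw [Lp.toLp_compMeasurePreserving, Lp.toLp_compMeasurePreserving, Lp.edist_toLp_toLp,
    eLpNorm_one_eq_lintegral_enorm]
  refine lintegral_congr fun x => ?_
  simp [g]

/-- The heat extension of `f` to the plane at time `t`. -/
def heatFlow (t : ℝ) (f : ℝ × ℝ → ℝ) (x : ℝ × ℝ) : ℝ :=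
  ∫ y, gauss t (x.1 - y.1) * gauss t (x.2 - y.2) * f y

lemma gauss_sqrt_mul {t : ℝ} (ht : 0 < t) (r : ℝ) :
    gauss t (Real.sqrt t * r) = (Real.sqrt t)⁻¹ * gauss 1 r := by
  have h : -(Real.sqrt t * r) ^ 2 / (4 * t) = -r ^ 2 / (4 * 1) := by
    rw [mul_pow, Real.sq_sqrt ht.le]
    field_simp
  rw [gauss, gauss, h, Real.sqrt_mul (by positivity) t, mul_one (4 * Real.pi), mul_inv]
  ring

/-- Scaling by `√t` fixes the Gaussian and puts all the dependence on `t` into the translation, as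
dominated convergence requires. -/
lemma heatFlow_eq {t : ℝ} (ht : 0 < t) (f : ℝ × ℝ → ℝ) (x : ℝ × ℝ) :
    heatFlow t f x = ∫ u : ℝ × ℝ, gauss 1 u.1 * gauss 1 u.2 * f (x - Real.sqrt t • u) := by
  have hs : 0 < Real.sqrt t := Real.sqrt_pos.2 ht
  have h1 : heatFlow t f x = ∫ v : ℝ × ℝ, gauss t v.1 * gauss t v.2 * f (x - v) := by
    rw [heatFlow, ← integral_sub_left_eq_self _ volume x]
    simp
  have h2 := Measure.integral_comp_smul_of_nonneg (volume : Measure (ℝ × ℝ))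
    (fun v : ℝ × ℝ => gauss t v.1 * gauss t v.2 * f (x - v)) (Real.sqrt t) (hR := hs.le)
  have h3 : Module.finrank ℝ (ℝ × ℝ) = 2 := by simp
  rw [h3, smul_eq_mul, eq_inv_mul_iff_mul_eq₀ (by positivity)] at h2
  rw [h1, ← h2, ← integral_const_mul]
  refine integral_congr_ae (.of_forall fun u => ?_)
  simp only [Prod.smul_fst, Prod.smul_snd, smul_eq_mul, gauss_sqrt_mul ht]
  field_simp

lemma integrable_gauss_prod {t : ℝ} (ht : 0 < t) :
    Integrable fun u : ℝ × ℝ => gauss t u.1 * gauss t u.2 :=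
  (integrable_gauss ht).mul_prod (integrable_gauss ht)

lemma integral_gauss_prod {t : ℝ} (ht : 0 < t) :
    ∫ u : ℝ × ℝ, gauss t u.1 * gauss t u.2 = 1 := by
  rw [Measure.volume_eq_prod, integral_prod_mul, integral_gauss ht, one_mul]

/-- The Gaussian has mass `1`, so the error is an average of differences of translates; Tonelli
gives Minkowski's inequality. -/
lemma lintegral_heatFlow_sub_le {f : ℝ × ℝ → ℝ} (hfm : StronglyMeasurable f) (hf : Integrable f)
    {t : ℝ} (ht : 0 < t) :
    ∫⁻ x, ‖heatFlow t f x - f x‖ₑ ≤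
      ∫⁻ u : ℝ × ℝ, ‖gauss 1 u.1 * gauss 1 u.2‖ₑ * translationModulus f (Real.sqrt t • u) := by
  have hs : 0 < Real.sqrt t := Real.sqrt_pos.2 ht
  have hm : Measurable f := hfm.measurable
  have hgm : Measurable fun u : ℝ × ℝ => gauss 1 u.1 * gauss 1 u.2 :=
    Continuous.measurable (by fun_prop)
  have key (x : ℝ × ℝ) : ‖heatFlow t f x - f x‖ₑ ≤
      ∫⁻ u : ℝ × ℝ, ‖gauss 1 u.1 * gauss 1 u.2‖ₑ * ‖f (x - Real.sqrt t • u) - f x‖ₑ := by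
    have hi : Integrable fun u : ℝ × ℝ =>
        gauss 1 u.1 * gauss 1 u.2 * f (x - Real.sqrt t • u) := by
      have h0 : Integrable fun u : ℝ × ℝ => f (x - Real.sqrt t • u) :=
        (hf.comp_sub_left x).comp_smul hs.ne'
      refine h0.bdd_mul (c := gauss 1 0 * gauss 1 0) hgm.aestronglyMeasurable
        (.of_forall fun u => ?_)
      rw [norm_mul, Real.norm_of_nonneg (gauss_nonneg _ _), Real.norm_of_nonneg (gauss_nonneg _ _)]
      exact mul_le_mul (gauss_le _) (gauss_le _) (gauss_nonneg _ _) (gauss_nonneg _ _)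
    have : heatFlow t f x - f x =
        ∫ u : ℝ × ℝ, gauss 1 u.1 * gauss 1 u.2 * (f (x - Real.sqrt t • u) - f x) := by
      simp_rw [mul_sub]
      rw [integral_sub hi ((integrable_gauss_prod one_pos).mul_const _), integral_mul_const,
        integral_gauss_prod one_pos, one_mul, heatFlow_eq ht]
    rw [this]
    refine (enorm_integral_le_lintegral_enorm _).trans (le_of_eq ?_)
    exact lintegral_congr fun u => enorm_mul _ _
  calc _ ≤ ∫⁻ x, ∫⁻ u : ℝ × ℝ, ‖gauss 1 u.1 * gauss 1 u.2‖ₑ *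
        ‖f (x - Real.sqrt t • u) - f x‖ₑ := lintegral_mono key
    _ = ∫⁻ u : ℝ × ℝ, ∫⁻ x, ‖gauss 1 u.1 * gauss 1 u.2‖ₑ *
        ‖f (x - Real.sqrt t • u) - f x‖ₑ := by
      refine lintegral_lintegral_swap (Measurable.aemeasurable ?_)
      refine (hgm.comp measurable_snd).enorm.mul (Measurable.enorm ?_)
      exact (hm.comp (by fun_prop)).sub (hm.comp measurable_fst)
    _ = _ := by
      refine lintegral_congr fun u => ?_
      exact lintegral_const_mul (f := fun x => ‖f (x - Real.sqrt t • u) - f x‖ₑ) _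
        (Measurable.enorm ((hm.comp (by fun_prop)).sub hm))

lemma measurable_translationModulus {f : ℝ × ℝ → ℝ} (hm : Measurable f) :
    Measurable (translationModulus f) := by
  refine Measurable.lintegral_prod_right' (f := fun p : (ℝ × ℝ) × (ℝ × ℝ) =>
    ‖f (p.2 - p.1) - f p.2‖ₑ) ?_
  exact ((hm.comp (by fun_prop)).sub (hm.comp measurable_snd)).enorm

lemma lintegral_enorm_gauss_mul_const_ne_top {f : ℝ × ℝ → ℝ} (hf : Integrable f) :
    ∫⁻ u : ℝ × ℝ, ‖gauss 1 u.1 * gauss 1 u.2‖ₑ * (2 * ∫⁻ x, ‖f x‖ₑ) ≠ ⊤ := by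
  rw [lintegral_mul_const'' _ (integrable_gauss_prod one_pos).1.enorm]
  exact (ENNReal.mul_lt_top (integrable_gauss_prod one_pos).2
    (ENNReal.mul_lt_top ENNReal.ofNat_lt_top hf.2)).ne

lemma lintegral_heatFlow_sub_lt_top {f : ℝ × ℝ → ℝ} (hfm : StronglyMeasurable f)
    (hf : Integrable f) {t : ℝ} (ht : 0 < t) : ∫⁻ x, ‖heatFlow t f x - f x‖ₑ < ⊤ :=
  (lintegral_heatFlow_sub_le hfm hf ht).trans_lt <|
    (lintegral_mono fun _ => mul_le_mul_right (translationModulus_le hf _) _).trans_lt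
      (lintegral_enorm_gauss_mul_const_ne_top hf).lt_top

/-- The heat semigroup of the plane is strongly continuous at `0` in `L¹`. -/
lemma tendsto_lintegral_heatFlow_sub {f : ℝ × ℝ → ℝ} (hfm : StronglyMeasurable f)
    (hf : Integrable f) :
    Tendsto (fun t => ∫⁻ x, ‖heatFlow t f x - f x‖ₑ) (𝓝[>] 0) (𝓝 0) := by
  have h := tendsto_lintegral_filter_of_dominated_convergence (μ := volume) (l := 𝓝[>] (0 : ℝ))
    (F := fun t (u : ℝ × ℝ) =>
      ‖gauss 1 u.1 * gauss 1 u.2‖ₑ * translationModulus f (Real.sqrt t • u))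
    (f := fun _ => 0) (fun u => ‖gauss 1 u.1 * gauss 1 u.2‖ₑ * (2 * ∫⁻ x, ‖f x‖ₑ))
    (.of_forall fun t => (Continuous.measurable (by fun_prop)).enorm.mul
      ((measurable_translationModulus hfm.measurable).comp (by fun_prop)))
    (.of_forall fun t => .of_forall fun u => mul_le_mul_right (translationModulus_le hf _) _)
    (lintegral_enorm_gauss_mul_const_ne_top hf)
    (.of_forall fun u => by
      have h1 : Tendsto (fun t => Real.sqrt t • u) (𝓝[>] 0) (𝓝 0) := by
        have : Continuous fun t => Real.sqrt t • u := by fun_prop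
        simpa using (this.tendsto 0).mono_left (nhdsWithin_le_nhds (s := Ioi 0))
      have h2 := ENNReal.Tendsto.const_mul ((tendsto_translationModulus hf).comp h1)
        (Or.inr (enorm_ne_top (x := gauss 1 u.1 * gauss 1 u.2)))
      simpa using h2)
  rw [lintegral_zero] at h
  refine tendsto_of_tendsto_of_tendsto_of_le_of_le' tendsto_const_nhds h
    (.of_forall fun _ => zero_le) ?_
  filter_upwards [self_mem_nhdsWithin] with t ht
  exact lintegral_heatFlow_sub_le hfm hf ht

lemma measurePreserving_reflect : MeasurePreserving reflect volume volume :=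
  (MeasurePreserving.id volume).prod (Measure.measurePreserving_neg volume)

/-- The heat flow with Neumann boundary condition is the even part of the heat flow of the
extension by zero. -/
lemma lintegral_neumann_sub_le {ω f : ℝ × ℝ → ℝ} (hfm : StronglyMeasurable f)
    (hf : Integrable f) (hfω : halfPlane.indicator ω =ᵐ[volume] f)
    (hf0 : ∀ x, x ∉ halfPlane → f x = 0) (t : ℝ) :
    ∫⁻ x in halfPlane, ‖(∫ y in halfPlane, neumannKernel t x y * ω y) - ω x‖ₑ ≤
      2 * ∫⁻ x, ‖heatFlow t f x - f x‖ₑ := by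
  have hgt : Continuous (gauss t) := continuous_gauss t
  have hint (x : ℝ × ℝ) :
      Integrable fun y : ℝ × ℝ => gauss t (x.1 - y.1) * gauss t (x.2 - y.2) * f y := by
    refine hf.bdd_mul (c := gauss t 0 * gauss t 0)
      (Continuous.aestronglyMeasurable (by fun_prop)) (.of_forall fun u => ?_)
    rw [norm_mul, Real.norm_of_nonneg (gauss_nonneg _ _), Real.norm_of_nonneg (gauss_nonneg _ _)]
    exact mul_le_mul (gauss_le _) (gauss_le _) (gauss_nonneg _ _) (gauss_nonneg _ _)
  -- The term with `x₂ + y₂` is the planar heat kernel at the reflected point, because the Gaussian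
  -- is even.
  have hN (x : ℝ × ℝ) : ∫ y in halfPlane, neumannKernel t x y * ω y =
      heatFlow t f x + heatFlow t f (reflect x) := by
    rw [heatFlow, heatFlow, ← integral_add (hint _) (hint _),
      ← integral_indicator measurableSet_halfPlane]
    refine integral_congr_ae ?_
    filter_upwards [hfω] with y hy
    rw [← hy]
    by_cases hyH : y ∈ halfPlane
    · rw [indicator_of_mem hyH, indicator_of_mem hyH, neumannKernel, reflect,
        ← gauss_neg t (x.2 + y.2), neg_add']
      ring
    · rw [indicator_of_notMem hyH, indicator_of_notMem hyH]
      simp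
  have hfω' : ∀ᵐ x ∂(volume.restrict halfPlane), ω x = f x := by
    filter_upwards [ae_restrict_of_ae hfω, ae_restrict_mem measurableSet_halfPlane] with x hx hxH
    rw [← hx, indicator_of_mem hxH]
  have hmeas : AEMeasurable (fun x => ‖heatFlow t f x - f x‖ₑ) := by
    have : StronglyMeasurable (heatFlow t f) := by
      refine StronglyMeasurable.integral_prod_right' (ν := volume)
        (f := fun p : (ℝ × ℝ) × (ℝ × ℝ) => gauss t (p.1.1 - p.2.1) * gauss t (p.1.2 - p.2.2) *
          f p.2) ?_
      exact (Continuous.stronglyMeasurable (by fun_prop)).mul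
        (hfm.comp_measurable measurable_snd)
    exact (this.sub hfm).measurable.enorm.aemeasurable
  calc _ ≤ ∫⁻ x in halfPlane, (‖heatFlow t f x - f x‖ₑ +
        ‖heatFlow t f (reflect x) - f (reflect x)‖ₑ) := by
        refine lintegral_mono_ae ?_
        filter_upwards [hfω', ae_restrict_mem measurableSet_halfPlane] with x hx hxH
        -- As `f` vanishes at the reflected point, the second heat flow is itself an approximation
        -- error there; reflection preserves measure, which accounts for the factor `2`.
        have h0 : f (reflect x) = 0 := hf0 _ fun h => by
          have h1 : 0 < x.2 := hxH
          have h2 : 0 < -x.2 := h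
          linarith
        rw [hN, hx, h0, sub_zero, add_sub_right_comm]
        exact enorm_add_le _ _
    _ ≤ ∫⁻ x, (‖heatFlow t f x - f x‖ₑ + ‖heatFlow t f (reflect x) - f (reflect x)‖ₑ) :=
        setLIntegral_le_lintegral _ _
    _ = _ := by
        rw [lintegral_add_left' hmeas, two_mul]
        congr 1
        have := lintegral_map' (μ := volume) (f := fun x => ‖heatFlow t f x - f x‖ₑ)
          (g := reflect) (by rwa [measurePreserving_reflect.map_eq])
          measurePreserving_reflect.measurable.aemeasurable
        rw [← this, measurePreserving_reflect.map_eq]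

/-! ### Assembling the convergence -/

/-- The translation estimates need a genuinely measurable representative, and the reflection
argument needs it to vanish at every point outside the half plane, not just almost everywhere. -/
lemma exists_stronglyMeasurable_extension {ω : ℝ × ℝ → ℝ} (hω : IntegrableOn ω halfPlane) :
    ∃ f : ℝ × ℝ → ℝ, StronglyMeasurable f ∧ Integrable f ∧
      halfPlane.indicator ω =ᵐ[volume] f ∧ ∀ x, x ∉ halfPlane → f x = 0 := by
  have h : halfPlane.indicator ω =ᵐ[volume] halfPlane.indicator (hω.1.mk ω) :=
    (ae_eq_restrict_iff_indicator_ae_eq measurableSet_halfPlane).1 hω.1.ae_eq_mk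
  exact ⟨_, hω.1.stronglyMeasurable_mk.indicator measurableSet_halfPlane,
    (hω.integrable_indicator measurableSet_halfPlane).congr h, h,
    fun x hx => indicator_of_notMem hx _⟩

lemma aestronglyMeasurable_integral_mul {k : (ℝ × ℝ) × (ℝ × ℝ) → ℝ} (hk : Continuous k)
    {ω : ℝ × ℝ → ℝ} (hω : IntegrableOn ω halfPlane) :
    AEStronglyMeasurable (fun x => ∫ y in halfPlane, k (x, y) * ω y)
      (volume.restrict halfPlane) :=
  AEStronglyMeasurable.integral_prod_right' (f := fun p => k p * ω p.2)
    (hk.aestronglyMeasurable.mul hω.1.comp_snd)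

lemma integrableOn_T_and_tendsto_eLpNorm {ω₀ : ℝ × ℝ → ℝ} (hω₀ : IntegrableOn ω₀ halfPlane)
    (htrace : ∀ᵐ x₁ : ℝ, K ω₀ 0 (x₁, 0) = 0) :
    (∀ t : ℝ, 0 < t → IntegrableOn (T t ω₀) halfPlane) ∧
      Tendsto (fun t : ℝ => eLpNorm (fun x => T t ω₀ x - ω₀ x) 1 (volume.restrict halfPlane))
        (𝓝[>] 0) (𝓝 0) := by
  obtain ⟨f, hfm, hf, hfω, hf0⟩ := exists_stronglyMeasurable_extension hω₀
  have hN := lintegral_neumann_sub_le hfm hf hfω hf0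
  have hbound {t : ℝ} (ht : 0 < t) :
      ∫⁻ x in halfPlane, ‖T t ω₀ x - ω₀ x‖ₑ ≤ 2 * (∫⁻ x, ‖heatFlow t f x - f x‖ₑ) +
        ∫⁻ x in halfPlane, ‖∫ y in halfPlane, remainderKernel t x y * ω₀ y‖ₑ := by
    calc _ ≤ ∫⁻ x in halfPlane, (‖(∫ y in halfPlane, neumannKernel t x y * ω₀ y) - ω₀ x‖ₑ +
          ‖∫ y in halfPlane, remainderKernel t x y * ω₀ y‖ₑ) := by
          refine setLIntegral_mono' measurableSet_halfPlane fun x hx => ?_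
          rw [T_eq_add ht hω₀ htrace hx, add_sub_right_comm]
          exact enorm_add_le _ _
      _ = _ := lintegral_add_right' _
          (aestronglyMeasurable_integral_mul (continuous_remainderKernel ht) hω₀).enorm
      _ ≤ _ := add_le_add_left (hN t) _
  refine ⟨fun t ht => ?_, ?_⟩
  · have hmeas : AEStronglyMeasurable (T t ω₀) (volume.restrict halfPlane) := by
      refine ((aestronglyMeasurable_integral_mul (continuous_neumannKernel t) hω₀).add
        (aestronglyMeasurable_integral_mul (continuous_remainderKernel ht) hω₀)).congr ?_
      filter_upwards [ae_restrict_mem measurableSet_halfPlane] with x hx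
      exact (T_eq_add ht hω₀ htrace hx).symm
    -- Integrability of `T t ω₀` comes from that of the difference, which the same bound controls at
    -- each fixed `t`.
    have hsub : IntegrableOn (fun x => T t ω₀ x - ω₀ x) halfPlane :=
      ⟨hmeas.sub hω₀.1, (hbound ht).trans_lt <| ENNReal.add_lt_top.2
        ⟨ENNReal.mul_lt_top ENNReal.ofNat_lt_top (lintegral_heatFlow_sub_lt_top hfm hf ht),
          lintegral_remainder_ne_top hω₀ ht⟩⟩
    exact (hsub.add hω₀).congr (.of_forall fun x => sub_add_cancel _ _)
  · have h := (ENNReal.Tendsto.const_mul (a := 2) (tendsto_lintegral_heatFlow_sub hfm hf)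
      (Or.inr ENNReal.ofNat_ne_top)).add (tendsto_lintegral_remainder hω₀)
    rw [mul_zero, add_zero] at h
    refine tendsto_of_tendsto_of_tendsto_of_le_of_le' tendsto_const_nhds h
      (.of_forall fun _ => zero_le) ?_
    filter_upwards [self_mem_nhdsWithin] with t ht
    rw [eLpNorm_one_eq_lintegral_enorm]
    exact hbound ht

end

end HalfPlaneStokes

theorem lemma4p5 (ω₀ : ℝ × ℝ → ℝ)
    (hω₀ : IntegrableOn ω₀ HalfPlaneStokes.halfPlane volume)
    (htrace : ∀ᵐ x₁ : ℝ, HalfPlaneStokes.K ω₀ 0 (x₁, 0) = 0) :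
    (∀ t : ℝ, 0 < t →
      IntegrableOn (HalfPlaneStokes.T t ω₀) HalfPlaneStokes.halfPlane volume) ∧
    Tendsto
      (fun t : ℝ => eLpNorm (fun x => HalfPlaneStokes.T t ω₀ x - ω₀ x) 1
        (volume.restrict HalfPlaneStokes.halfPlane))
      (𝓝[>] 0) (𝓝 0) :=
  HalfPlaneStokes.integrableOn_T_and_tendsto_eLpNorm hω₀ htrace
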